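/- Let $M$ be a connected smooth manifold (finite-dimensional, Hausdorff, second countable). A pseudogroup $\Gamma$ on $M$ is a set of diffeomorphisms between open subsets of $M$ that contains $\mathrm{id}_M$ and is closed under composition, inversion, restriction to open subsets and gluing. For $k\ge 0$ let $D_k$ be the space of $k$-jets $[\varphi]^k_x$ of local diffeomorphisms of $M$, let $G_k=\{[\varphi]^k_x:\varphi\in\Gamma,\ x\in\operatorname{dom}\varphi\}\subset D_k$, and let $G_k(a,b)\subset D_k(a,b)$ be the sets of jets with source $a$ and target $b$. We regard $G_1(a,b)$ as a set of linear isomorphisms $T_aM\to T_bM$; $G_1(a)=G_1(a,a)$ is the linear isotropy group. The pseudogroup $\Gamma$ is transitive if for all $a,b\in M$ some $\varphi\in\Gamma$ has $\varphi(a)=b$. It is a Lie pseudogroup if, for all $k\geq 1$, $G_k$ is a smooth submanifold of $D_k$ and the maps $G_k\to M$ (source) and $G_k\to G_{k-1}$ are submersions, and if there is $k_0\ge1$ such that for all $k\ge k_0$ the first prolongation of $G_k$ (the set of jets $[\varphi]^{k+1}_x$ of local diffeomorphisms $\varphi$ such that $[\varphi]^k_x\in G_k$ and the section $y\mapsto[\varphi]^k_y$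 is tangent to $G_k$ at $x$) is contained in $G_{k+1}$. It is algebraic if moreover, for all $k\ge1$ and $a,b\in M$, $G_k(a,b)$ is cut out of $D_k(a,b)$ by polynomial equations in the standard jet coordinates. Let $A$ be a linear scalar differential operator of order $\le k$ on $M$ with smooth coefficients and let $\sigma_{A,a}\in S^kT_aM$ be its symbol, i.e. the homogeneous polynomial on $T_a^*M$ with $\sigma_{A,a}(d_af)=\frac1{k!}A(f^k)(a)$ for smooth $f$ with $f(a)=0$. Let $O_a\subset S^kT_aM$ be the $G_1(a)$-orbit of $\sigma_{A,a}$. The operator $A$ has constant $\Gamma$-type if $g(O_a)=O_b$ for all $a,b\in M$ and $g\in G_1(a,b)$. An affine connection on $M$ is a smooth covariant derivative $\nabla$ on $TM$. It is a $\Gamma$-connection if its parallel transport along every smooth path from $a$ to $b$ is an element of $G_1(a,b)$, for all $a,b\in M$, and it preserves $\sigma_A$ if its parallel transport along every smooth path from $a$ to $b$ sends $\sigma_{A,a}$ to $\sigma_{A,b}$. **Theorem (existence and uniqueness of the Wagner $\Gamma$-connection).** Let $\Gamma$ be a transitive algebraic Lie pseudogroup on $M$ and let $A$ be a differential operator of order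 $\le k$ on $M$ of constant $\Gamma$-type. Suppose that for every $a\in M$ the stabilizer of $\sigma_{A,a}$ in $G_1(a)$ is finite, or that $\dim O_a=\dim G_1(a)$ for every $a\in M$. Then there exists one and only one affine $\Gamma$-connection on $M$ that preserves the symbol $\sigma_A$. -/

import Mathlib

open Set Filter Topology Bundle Manifold
open scoped ContDiff

noncomputable section

/-! ### Jets of local diffeomorphisms, in coordinates -/

section Jets

variable {W : Type*} [NormedAddCommGroup W] [NormedSpace ℝ W]

/-- `S` is a smooth embedded submanifold of the vector space `W`: near each of its points it is
straightened to a linear subspace by a local diffeomorphism of `W`. -/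
def IsSmoothSubmanifold (S : Set W) : Prop :=
  ∀ s ∈ S, ∃ (Φ : OpenPartialHomeomorph W W) (L : Submodule ℝ W), s ∈ Φ.source ∧
    ContDiffOn ℝ ∞ Φ Φ.source ∧ ContDiffOn ℝ ∞ Φ.symm Φ.target ∧
    ∀ w ∈ Φ.source, w ∈ S ↔ Φ w ∈ L

/-- The tangent vectors to `S` at `s`: the velocities at time `0` of the smooth curves
through `s` that stay in `S` near time `0`. -/
def tangentVectors (S : Set W) (s : W) : Set W :=
  {w | ∃ c : ℝ → W, ContDiff ℝ ∞ c ∧ c 0 = s ∧ (∀ᶠ t in 𝓝 (0 : ℝ), c t ∈ S) ∧ deriv c 0 = w}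

/-- The polynomial functions on a real vector space: the algebra generated by linear forms. -/
def polyFunctionAlgebra (W : Type*) [AddCommGroup W] [Module ℝ W] : Subalgebra ℝ (W → ℝ) :=
  Algebra.adjoin ℝ {f | ∃ l : W →ₗ[ℝ] ℝ, f = fun w => l w}

/-- The coordinates of a `k`-jet at a given source point: the derivatives of orders `0, …, k`
(the one of order `0` is the target point). -/
abbrev JetCoeff (E : Type*) [NormedAddCommGroup E] [NormedSpace ℝ E] (k : ℕ) : Type _ :=
  (i : Fin (k + 1)) → ContinuousMultilinearMap ℝ (fun _ : Fin (i : ℕ) => E) E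

/-- The coordinates of a `k`-jet: the source point and the derivatives of orders `0, …, k`. -/
abbrev JetSpace (E : Type*) [NormedAddCommGroup E] [NormedSpace ℝ E] (k : ℕ) : Type _ :=
  E × JetCoeff E k

/-- The reduction of a `(k + 1)`-jet to the `k`-jet. -/
def jetTruncate {E : Type*} [NormedAddCommGroup E] [NormedSpace ℝ E] {k : ℕ}
    (j : JetSpace E (k + 1)) : JetSpace E k :=
  (j.1, fun i => j.2 i.castSucc)

variable {E : Type*} [NormedAddCommGroup E] [NormedSpace ℝ E]
  {M : Type*} [TopologicalSpace M] [ChartedSpace E M]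

/-- A local diffeomorphism of `M`: a diffeomorphism between two open subsets of `M`. -/
def IsLocalDiffeo (φ : OpenPartialHomeomorph M M) : Prop :=
  ContMDiffOn 𝓘(ℝ, E) 𝓘(ℝ, E) ∞ φ φ.source ∧ ContMDiffOn 𝓘(ℝ, E) 𝓘(ℝ, E) ∞ φ.symm φ.target

/-- The `k`-jet `[φ]ᵏₓ` in the chart around `p` on the source and the chart around `q` on the
target. -/
def jetAt (k : ℕ) (p q : M) (φ : OpenPartialHomeomorph M M) (x : M) : JetSpace E k :=
  (chartAt E p x, fun i => iteratedFDeriv ℝ (i : ℕ)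
    (fun u => chartAt E q (φ ((chartAt E p).symm u))) (chartAt E p x))

/-- The `k`-jets of the elements of `P` whose source lies in the chart around `p` and whose target
lies in the chart around `q`, in these charts. If `P` is a pseudogroup, this is the coordinate
expression of the part of `Gₖ` over the product of the two chart domains. -/
def jetSet (P : Set (OpenPartialHomeomorph M M)) (k : ℕ) (p q : M) : Set (JetSpace E k) :=
  {j | ∃ φ ∈ P, ∃ x ∈ φ.source, x ∈ (chartAt E p).source ∧ φ x ∈ (chartAt E q).source ∧
    j = jetAt k p q φ x}

/-- The `k`-jets of the elements of `P` with source `a` and target `b`, that is, the fibre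
`Gₖ(a, b)` of `Gₖ → M × M`, in the charts around `a` and `b`. -/
def jetFibre (P : Set (OpenPartialHomeomorph M M)) (k : ℕ) (a b : M) : Set (JetCoeff E k) :=
  {v | ∃ φ ∈ P, a ∈ φ.source ∧ φ a = b ∧ v = (jetAt k a b φ a).2}

/-- The first prolongation of `Gₖ`: the `(k + 1)`-jets `[φ]ₓᵏ⁺¹` of local diffeomorphisms such
that `[φ]ₓᵏ` lies in `Gₖ` and the section `y ↦ [φ]ᵏ_y` is tangent to `Gₖ` at `x`. -/
def jetProlongation (P : Set (OpenPartialHomeomorph M M)) (k : ℕ) (p q : M) :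
    Set (JetSpace E (k + 1)) :=
  {j | ∃ φ : OpenPartialHomeomorph M M, IsLocalDiffeo (E := E) φ ∧
    ∃ x ∈ φ.source, x ∈ (chartAt E p).source ∧ φ x ∈ (chartAt E q).source ∧
      jetAt k p q φ x ∈ jetSet (E := E) P k p q ∧
      (∀ w : E, fderiv ℝ (fun u : E => (jetAt k p q φ ((chartAt E p).symm u) : JetSpace E k))
          (chartAt E p x) w ∈ tangentVectors (jetSet (E := E) P k p q) (jetAt k p q φ x)) ∧
      j = jetAt (k + 1) p q φ x}

end Jets

/-! ### Lie pseudogroups -/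

section Pseudogroups

variable (E : Type*) [NormedAddCommGroup E] [NormedSpace ℝ E]
  {M : Type*} [TopologicalSpace M] [ChartedSpace E M]

/-- The pseudogroup `Γ` acts transitively on `M`. -/
def IsTransitivePseudogroup (Γ : StructureGroupoid M) : Prop :=
  ∀ a b : M, ∃ φ ∈ Γ, a ∈ φ.source ∧ φ a = b

/-- `Γ` is a Lie pseudogroup. A `StructureGroupoid M` is a set of homeomorphisms between open
subsets of `M` that contains the identity and is stable under composition, inversion, restriction
and gluing. -/
structure IsLiePseudogroup (Γ : StructureGroupoid M) : Prop where
  /-- The elements of `Γ` are local diffeomorphisms. -/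
  smooth : ∀ φ ∈ Γ, IsLocalDiffeo (E := E) φ
  /-- Each `Gₖ` is a smooth submanifold of the space of `k`-jets of local diffeomorphisms. -/
  submanifold : ∀ k, 1 ≤ k → ∀ p q : M, IsSmoothSubmanifold (jetSet (E := E) Γ.members k p q)
  /-- Each `Gₖ` is fibred over `M`. -/
  fibred : ∀ k, 1 ≤ k → ∀ p q : M, ∀ j ∈ jetSet (E := E) Γ.members k p q, ∀ w : E,
    ∃ v ∈ tangentVectors (jetSet (E := E) Γ.members k p q) j, v.1 = w
  /-- Each `Gₖ₊₁` is fibred over `Gₖ`. -/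
  tower : ∀ k, ∀ p q : M, ∀ j ∈ jetSet (E := E) Γ.members (k + 1) p q,
    ∀ w ∈ tangentVectors (jetSet (E := E) Γ.members k p q) (jetTruncate j),
      ∃ v ∈ tangentVectors (jetSet (E := E) Γ.members (k + 1) p q) j, jetTruncate v = w
  /-- From some order on, the first prolongation of `Gₖ` is contained in (hence equal to)
  `Gₖ₊₁`. -/
  integrable : ∃ k₀, 1 ≤ k₀ ∧ ∀ k, k₀ ≤ k → ∀ p q : M,
    jetProlongation (E := E) Γ.members k p q ⊆ jetSet (E := E) Γ.members (k + 1) p q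

/-- `Γ` is an algebraic Lie pseudogroup: each fibre `Gₖ(a, b)` is cut out by polynomial equations
from the jets of all local diffeomorphisms sending `a` to `b`. (The composition law of jets is
polynomial.) -/
structure IsAlgebraicLiePseudogroup (Γ : StructureGroupoid M) : Prop
    extends IsLiePseudogroup E Γ where
  algebraic : ∀ k, 1 ≤ k → ∀ a b : M, ∃ P : Set (JetCoeff E k → ℝ),
    P ⊆ (polyFunctionAlgebra (JetCoeff E k) : Set (JetCoeff E k → ℝ)) ∧
    jetFibre (E := E) Γ.members k a b =
      {v ∈ jetFibre (E := E) {φ : OpenPartialHomeomorph M M | IsLocalDiffeo (E := E) φ} k a b |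
        ∀ f ∈ P, f v = 0}

/-- `G₁(a, b)`: the differentials at `a` of the elements of `Γ` that send `a` to `b`. The linear
isotropy group at `a` is `G₁(a, a)`. -/
def linearJets (Γ : StructureGroupoid M) (a b : M) :
    Set (TangentSpace 𝓘(ℝ, E) a →L[ℝ] TangentSpace 𝓘(ℝ, E) b) :=
  {g | ∃ φ ∈ Γ, a ∈ φ.source ∧ φ a = b ∧ HasMFDerivAt 𝓘(ℝ, E) 𝓘(ℝ, E) φ a g}

end Pseudogroups

/-! ### Differential operators and their symbols -/

section Operators

variable {E : Type*} [NormedAddCommGroup E] [NormedSpace ℝ E]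
  {M : Type*} [TopologicalSpace M] [ChartedSpace E M]

/-- The commutator of `A` with the multiplication by `f`. -/
def commMul (A : C^∞⟮𝓘(ℝ, E), M; ℝ⟯ →ₗ[ℝ] C^∞⟮𝓘(ℝ, E), M; ℝ⟯) (f : C^∞⟮𝓘(ℝ, E), M; ℝ⟯) :
    C^∞⟮𝓘(ℝ, E), M; ℝ⟯ →ₗ[ℝ] C^∞⟮𝓘(ℝ, E), M; ℝ⟯ :=
  A ∘ₗ LinearMap.mulLeft ℝ f - LinearMap.mulLeft ℝ f ∘ₗ A

/-- `A` is a linear scalar differential operator of order at most `k` on `M`. -/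
def IsDiffOp : ℕ → (C^∞⟮𝓘(ℝ, E), M; ℝ⟯ →ₗ[ℝ] C^∞⟮𝓘(ℝ, E), M; ℝ⟯) → Prop
  | 0, A => ∀ f, commMul A f = 0
  | k + 1, A => ∀ f, IsDiffOp k (commMul A f)

/-- Elements of `SᵏTₐM` are regarded as (homogeneous polynomial) functions on the cotangent
space. -/
abbrev CotangentFun (E : Type*) [NormedAddCommGroup E] [NormedSpace ℝ E]
    {M : Type*} [TopologicalSpace M] [ChartedSpace E M] (a : M) : Type _ :=
  (TangentSpace 𝓘(ℝ, E) a →L[ℝ] ℝ) → ℝ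

/-- The action of a linear map of tangent spaces on symmetric tensors. -/
def pushSymbol {a b : M} (g : TangentSpace 𝓘(ℝ, E) a →L[ℝ] TangentSpace 𝓘(ℝ, E) b)
    (s : CotangentFun E a) : CotangentFun E b :=
  fun θ => s (θ.comp g)

/-- The symbol of an operator `A` of order at most `k` at the point `a`: its value at the
covector `θ` is `A (fᵏ)(a) / k!` for any smooth function `f` with `f a = 0` and `d_a f = θ`. -/
def symbol (k : ℕ) (A : C^∞⟮𝓘(ℝ, E), M; ℝ⟯ →ₗ[ℝ] C^∞⟮𝓘(ℝ, E), M; ℝ⟯) (a : M) :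
    CotangentFun E a :=
  fun θ =>
    let f : C^∞⟮𝓘(ℝ, E), M; ℝ⟯ :=
      Classical.epsilon fun f => f a = 0 ∧ HasMFDerivAt 𝓘(ℝ, E) 𝓘(ℝ, ℝ) f a θ
    A (f ^ k) a / (k.factorial : ℝ)

variable (Γ : StructureGroupoid M) (k : ℕ)
  (A : C^∞⟮𝓘(ℝ, E), M; ℝ⟯ →ₗ[ℝ] C^∞⟮𝓘(ℝ, E), M; ℝ⟯)

/-- The orbit `Oₐ` of the symbol of `A` at `a` under the linear isotropy group `G₁(a)`. -/
def symbolOrbit (a : M) : Set (CotangentFun E a) :=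
  {s | ∃ g ∈ linearJets E Γ a a, s = pushSymbol g (symbol k A a)}

/-- The stabilizer of the symbol of `A` at `a` in the linear isotropy group `G₁(a)`. -/
def symbolStabilizer (a : M) : Set (TangentSpace 𝓘(ℝ, E) a →L[ℝ] TangentSpace 𝓘(ℝ, E) a) :=
  {g ∈ linearJets E Γ a a | pushSymbol g (symbol k A a) = symbol k A a}

/-- `A` has constant `Γ`-type. -/
def HasConstantType : Prop :=
  ∀ a b : M, ∀ g ∈ linearJets E Γ a b,
    pushSymbol g '' symbolOrbit Γ k A a = symbolOrbit Γ k A b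

/-- The tangent vectors at the identity to the linear isotropy group `G₁(a)`. -/
def isotropyTangent (a : M) : Set (E →L[ℝ] E) :=
  tangentVectors (W := E →L[ℝ] E) (linearJets E Γ a a) (ContinuousLinearMap.id ℝ E)

/-- The tangent vectors at the symbol to its orbit `Oₐ`: the velocities of the curves
`t ↦ c(t) · σ`, where `c` is a smooth curve in `G₁(a)` through the identity. -/
def orbitTangent (a : M) : Set (CotangentFun E a) :=
  {s | ∃ c : ℝ → (E →L[ℝ] E), ContDiff ℝ ∞ c ∧ c 0 = ContinuousLinearMap.id ℝ E ∧
    (∀ᶠ t in 𝓝 (0 : ℝ), c t ∈ linearJets E Γ a a) ∧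
    s = fun θ => deriv (fun t => pushSymbol (a := a) (b := a) (c t) (symbol k A a) θ) 0}

/-- `dim Oₐ = dim G₁(a)`. -/
def OrbitHasFullDim (a : M) : Prop :=
  Set.finrank ℝ (orbitTangent Γ k A a) = Set.finrank ℝ (isotropyTangent (E := E) Γ a)

end Operators

/-! ### Affine connections and parallel transport -/

section Connections

variable {E : Type*} [NormedAddCommGroup E] [NormedSpace ℝ E]
  {M : Type*} [TopologicalSpace M] [ChartedSpace E M] [IsManifold 𝓘(ℝ, E) ∞ M]

/-- The vector field `V` along the curve `γ` is parallel for `∇`. In the trivialization of the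
tangent bundle around `γ t`, write `v` for the components of `V`; the covariant derivative of `V`
along `γ` at time `t` is `v'(t) + ∇_{γ'(t)} Y`, where `Y` is the local vector field with constant
components `v(t)`. -/
def IsParallelAlong
    (nabla : CovariantDerivative 𝓘(ℝ, E) E (TangentSpace 𝓘(ℝ, E) : M → Type _))
    (γ : ℝ → M) (V : (t : ℝ) → TangentSpace 𝓘(ℝ, E) (γ t)) : Prop :=
  ∀ t : ℝ, HasDerivAt
    (fun s : ℝ => (trivializationAt E (TangentSpace 𝓘(ℝ, E)) (γ t)
      (⟨γ s, V s⟩ : TangentBundle 𝓘(ℝ, E) M)).2)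
    (-(nabla (FiberBundle.extend E (V t)) (γ t) (mfderiv 𝓘(ℝ, ℝ) 𝓘(ℝ, E) γ t (1 : ℝ)) : E)) t

/-- `T` is the parallel transport of `∇` along the curve `γ` from `γ 0` to `γ 1`. -/
def IsParallelTransport
    (nabla : CovariantDerivative 𝓘(ℝ, E) E (TangentSpace 𝓘(ℝ, E) : M → Type _))
    (γ : ℝ → M) (T : TangentSpace 𝓘(ℝ, E) (γ 0) →L[ℝ] TangentSpace 𝓘(ℝ, E) (γ 1)) : Prop :=
  ∀ v w, (∃ V : (t : ℝ) → TangentSpace 𝓘(ℝ, E) (γ t),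
    IsParallelAlong nabla γ V ∧ V 0 = v ∧ V 1 = w) ↔ T v = w

/-- `∇` is a `Γ`-connection: its parallel transports along smooth paths from `a` to `b` are elements
of `G₁(a, b)`. -/
def IsGammaConnection (Γ : StructureGroupoid M)
    (nabla : CovariantDerivative 𝓘(ℝ, E) E (TangentSpace 𝓘(ℝ, E) : M → Type _)) : Prop :=
  ∀ γ : ℝ → M, ContMDiff 𝓘(ℝ, ℝ) 𝓘(ℝ, E) ∞ γ →
    ∃ T ∈ linearJets E Γ (γ 0) (γ 1), IsParallelTransport nabla γ T

/-- `∇` preserves the field `s` of symmetric tensors: the parallel transports along smooth paths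
from `a` to `b` send `s a` to `s b`. -/
def PreservesSymbol
    (nabla : CovariantDerivative 𝓘(ℝ, E) E (TangentSpace 𝓘(ℝ, E) : M → Type _))
    (s : (a : M) → CotangentFun E a) : Prop :=
  ∀ γ : ℝ → M, ContMDiff 𝓘(ℝ, ℝ) 𝓘(ℝ, E) ∞ γ →
    ∀ T, IsParallelTransport nabla γ T → pushSymbol T (s (γ 0)) = s (γ 1)

end Connections

end

open Set Filter Topology Bundle Manifold
open scoped ContDiff

/-! Let `P a b` be the set of elements of `G₁(a, b)` that carry the symbol at `a` to the symbol at
`b` (`symbolJets`). Transitivity and constant type make it nonempty, and the hypothesis on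
stabilizers or dimensions makes the isotropy groups `P a a` discrete. A groupoid of isomorphisms of
tangent spaces with discrete isotropy and smooth local sections (`IsFlatGroupoid`) is the same as a
flat way of moving vectors. A local section starting at the identity of `x` is a frame, two frames
differ near a common point by a constant factor, and declaring all frames parallel gives a smooth
connection whose transports lie in `P`. Conversely, the transports of any `Γ`-connection preserving
the symbol lie in `P`, start at the identity and vary continuously, so by discreteness they must
follow the frames. This gives uniqueness (`extend_eq_connection_extend`, `eq_connection`).

The work is in showing that `P` is flat (`isFlatGroupoid_symbolJets`). The symbol is represented
near each point by a smooth family of tensors (`exists_symbol_family`), and `G₁` has smooth local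
sections `s b` from a base point `o` (`exists_isoJets_section`). Pulling the symbol back along `s b`
gives a smooth map into the orbit of the symbol at `o`, and `exists_slice` lifts this map to a
smooth map `h` into `G₁(o)`. Then `s b ∘ h b` preserves the symbol.

Both the lift and the discreteness need the Lie algebra of `G₁(o)` to act injectively on the symbol
(`eq_zero_of_stabilizer`). If the stabilizers are finite, a Lie algebra element killing the symbol
exponentiates to a curve in the stabilizer, which must be constant. If the orbit has full dimension,
it is a rank count. That exponentials stay in the group is proved directly from a local defining
submersion (`exists_exp_mem`). -/

noncomputable section

/-! ### Submanifolds as zero sets of submersions. -/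

section TangentVectors

variable {W : Type*} [NormedAddCommGroup W] [NormedSpace ℝ W]
  {V : Type*} [NormedAddCommGroup V] [NormedSpace ℝ V]

/-- Tangent vectors to a level set are killed by the derivative. -/
lemma fderiv_eq_zero_of_mem_tangentVectors {F : W → V} {S : Set W} {s v : W}
    (hF : DifferentiableAt ℝ F s) (hS : ∀ᶠ w in 𝓝 s, w ∈ S → F w = 0)
    (hv : v ∈ tangentVectors S s) : fderiv ℝ F s v = 0 := by
  obtain ⟨c, hc, hc0, hcS, rfl⟩ := hv
  have hcd : HasDerivAt c (deriv c 0) 0 := (hc.differentiable (by simp) 0).hasDerivAt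
  have h1 : HasDerivAt (fun t => F (c t)) (fderiv ℝ F s (deriv c 0)) 0 := by
    refine HasFDerivAt.comp_hasDerivAt (0 : ℝ) ?_ hcd
    rw [hc0]
    exact hF.hasFDerivAt
  have h2 : (fun t => F (c t)) =ᶠ[𝓝 0] fun _ => 0 := by
    have : Tendsto c (𝓝 0) (𝓝 s) := by simpa [hc0] using hc.continuous.tendsto 0
    filter_upwards [this.eventually hS, hcS] with t ht1 ht2 using ht1 ht2
  exact h1.unique ((hasDerivAt_const (0 : ℝ) (0 : V)).congr_of_eventuallyEq h2)

end TangentVectors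

section Submersions

variable {W : Type*} [NormedAddCommGroup W] [NormedSpace ℝ W] [FiniteDimensional ℝ W]
  {V : Type*} [NormedAddCommGroup V] [NormedSpace ℝ V] [FiniteDimensional ℝ V]

/-- The straightening map, followed by the projection along `L` onto a complement of `L`. -/
lemma IsSmoothSubmanifold.exists_defining_map {S : Set W} (hS : IsSmoothSubmanifold S) {s : W}
    (hs : s ∈ S) : ∃ (V : Submodule ℝ W) (F : W → V), ContDiffAt ℝ ∞ F s ∧ F s = 0 ∧
      Function.Surjective (fderiv ℝ F s) ∧ ∀ᶠ w in 𝓝 s, w ∈ S ↔ F w = 0 := by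
  obtain ⟨Φ, L, hsΦ, hΦ, hΦs, hL⟩ := hS s hs
  obtain ⟨V, hV⟩ := L.exists_isCompl
  let pj : W →L[ℝ] V := LinearMap.toContinuousLinearMap (Submodule.projectionOnto V L hV.symm)
  have hpj : ∀ w, pj w = 0 ↔ w ∈ L := fun w => by
    simp [pj]
  have hcd : ContDiffAt ℝ ∞ Φ s := hΦ.contDiffAt (Φ.open_source.mem_nhds hsΦ)
  have hd : DifferentiableAt ℝ Φ s := hcd.differentiableAt (by simp)
  have hcs : ContDiffAt ℝ ∞ Φ.symm (Φ s) :=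
    hΦs.contDiffAt (Φ.open_target.mem_nhds (Φ.map_source hsΦ))
  have hds : DifferentiableAt ℝ Φ.symm (Φ s) := hcs.differentiableAt (by simp)
  refine ⟨V, fun w => pj (Φ w), pj.contDiff.contDiffAt.comp s hcd, ?_, ?_, ?_⟩
  · exact (hpj _).2 ((hL s hsΦ).1 hs)
  · have h1 : fderiv ℝ (fun w => pj (Φ w)) s = pj.comp (fderiv ℝ Φ s) :=
      (pj.hasFDerivAt.comp s hd.hasFDerivAt).fderiv
    rw [h1]
    have h2 : (fderiv ℝ Φ s).comp (fderiv ℝ Φ.symm (Φ s)) = ContinuousLinearMap.id ℝ W := by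
      have h3 : HasFDerivAt (fun w => Φ (Φ.symm w))
          ((fderiv ℝ Φ s).comp (fderiv ℝ Φ.symm (Φ s))) (Φ s) := by
        refine HasFDerivAt.comp (Φ s) ?_ hds.hasFDerivAt
        rw [Φ.left_inv hsΦ]
        exact hd.hasFDerivAt
      have h4 : (fun w => Φ (Φ.symm w)) =ᶠ[𝓝 (Φ s)] id := by
        filter_upwards [Φ.open_target.mem_nhds (Φ.map_source hsΦ)] with w hw
        exact Φ.right_inv hw
      exact h3.unique ((hasFDerivAt_id (Φ s)).congr_of_eventuallyEq h4)
    intro v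
    refine ⟨fderiv ℝ Φ.symm (Φ s) v, ?_⟩
    have := congrArg (fun T : W →L[ℝ] W => pj (T v)) h2
    simp only [ContinuousLinearMap.comp_apply, ContinuousLinearMap.id_apply] at this
    simp only [ContinuousLinearMap.comp_apply, this]
    simp [pj]
  · filter_upwards [Φ.open_source.mem_nhds hsΦ] with w hw
    rw [hpj, hL w hw]

lemma exists_local_inverse {H : W → V} {s : W} (hH : ContDiffAt ℝ ∞ H s)
    (hbij : Function.Bijective (fderiv ℝ H s)) :
    ∃ θ : V → W, ContDiffAt ℝ ∞ θ (H s) ∧ θ (H s) = s ∧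
      (∀ᶠ v in 𝓝 (H s), H (θ v) = v) ∧ ∀ᶠ w in 𝓝 s, θ (H w) = w := by
  let e : W ≃L[ℝ] V := ContinuousLinearEquiv.ofBijective (fderiv ℝ H s)
    (LinearMap.ker_eq_bot.2 hbij.1) (LinearMap.range_eq_top.2 hbij.2)
  have he : HasFDerivAt H (e : W →L[ℝ] V) s := (hH.differentiableAt (by simp)).hasFDerivAt
  have hstr : HasStrictFDerivAt H (e : W →L[ℝ] V) s := hH.hasStrictFDerivAt' he (by simp)
  exact ⟨hH.localInverse he (by simp), hH.to_localInverse he (by simp),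
    hH.localInverse_apply_image he (by simp), hstr.eventually_right_inverse,
    hstr.eventually_left_inverse⟩

/-- Apply the inverse function theorem to `w ↦ (F w, κ (w - s))`, with `κ` a projection onto the
kernel of the derivative. In these coordinates the zero set of `F` is `{0} × ker`, and it is
parametrized by the second factor. -/
lemma exists_straightening {F : W → V} {s : W} (hF : ContDiffAt ℝ ∞ F s) (h0 : F s = 0)
    (hsurj : Function.Surjective (fderiv ℝ F s)) :
    ∃ (κ : W →L[ℝ] (fderiv ℝ F s).ker) (θ : V × (fderiv ℝ F s).ker → W),
      (∀ k : (fderiv ℝ F s).ker, κ k = k) ∧ ContDiffAt ℝ ∞ θ 0 ∧ θ 0 = s ∧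
      (∀ᶠ p in 𝓝 (0 : V × (fderiv ℝ F s).ker), F (θ p) = p.1) ∧
      (∀ᶠ w in 𝓝 s, θ (F w, κ (w - s)) = w) ∧
      ∀ w, fderiv ℝ θ 0 (fderiv ℝ F s w, κ w) = w := by
  set K := (fderiv ℝ F s).ker with hK
  obtain ⟨C, hC⟩ := K.exists_isCompl
  let κ : W →L[ℝ] K := LinearMap.toContinuousLinearMap (Submodule.projectionOnto K C hC)
  have hκ : ∀ k : K, κ k = k := fun k => by simp [κ]
  have hFd : HasFDerivAt F (fderiv ℝ F s) s := (hF.differentiableAt (by simp)).hasFDerivAt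
  let H : W → V × K := fun w => (F w, κ (w - s))
  have hH : ContDiffAt ℝ ∞ H s :=
    hF.prodMk (κ.contDiff.contDiffAt.comp s (contDiffAt_id.sub contDiffAt_const))
  have hHd : HasFDerivAt H ((fderiv ℝ F s).prod κ) s := by
    refine hFd.prodMk ?_
    exact κ.hasFDerivAt.comp s ((hasFDerivAt_id (𝕜 := ℝ) s).sub_const s)
  have hbij : Function.Bijective ((fderiv ℝ F s).prod κ) := by
    constructor
    · rw [injective_iff_map_eq_zero]
      intro w hw
      simp only [ContinuousLinearMap.prod_apply, Prod.mk_eq_zero] at hw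
      have hwK : w ∈ K := hw.1
      have := hκ ⟨w, hwK⟩
      rw [hw.2] at this
      exact congrArg Subtype.val this.symm
    · rintro ⟨v, k⟩
      obtain ⟨w, rfl⟩ := hsurj v
      refine ⟨w - κ w + k, ?_⟩
      have h1 : fderiv ℝ F s (κ w : W) = 0 := (κ w).2
      have h2 : fderiv ℝ F s (k : W) = 0 := k.2
      simp [h1, h2, hκ]
  have hHs : H s = 0 := by simp [H, h0]
  obtain ⟨θ, hθ, hθ0, hright, hleft⟩ := exists_local_inverse hH (by rwa [hHd.fderiv])
  rw [hHs] at hθ hθ0 hright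
  refine ⟨κ, θ, hκ, hθ, hθ0, ?_, hleft, ?_⟩
  · filter_upwards [hright] with p hp
    exact congrArg Prod.fst hp
  · intro w
    have h1 : HasFDerivAt (fun w => θ (H w)) ((fderiv ℝ θ 0).comp ((fderiv ℝ F s).prod κ)) s := by
      refine HasFDerivAt.comp s ?_ hHd
      rw [hHs]
      exact (hθ.differentiableAt (by simp)).hasFDerivAt
    have h2 := h1.unique ((hasFDerivAt_id (𝕜 := ℝ) s).congr_of_eventuallyEq hleft)
    exact congrArg (fun T : W →L[ℝ] W => T w) h2

/-- A submersion-like level set has local smooth sections over a linear map that is onto on its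
tangent space. -/
lemma exists_local_section {V₂ : Type*} [NormedAddCommGroup V₂] [NormedSpace ℝ V₂]
    [FiniteDimensional ℝ V₂] {F : W → V} {s : W} (hF : ContDiffAt ℝ ∞ F s) (h0 : F s = 0)
    (hsurj : Function.Surjective (fderiv ℝ F s)) (pr : W →L[ℝ] V₂)
    (hpr : ∀ u, ∃ v, fderiv ℝ F s v = 0 ∧ pr v = u) :
    ∃ β : V₂ → W, ContDiffAt ℝ ∞ β (pr s) ∧ β (pr s) = s ∧
      ∀ᶠ u in 𝓝 (pr s), F (β u) = 0 ∧ pr (β u) = u := by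
  -- Adjoining `pr` to `F` still gives a submersion, because `pr` is onto on the kernel of the
  -- derivative of `F`; the section is the slice where the first component is `0`.
  let F₂ : W → V × V₂ := fun w => (F w, pr (w - s))
  have hF₂ : ContDiffAt ℝ ∞ F₂ s :=
    hF.prodMk (pr.contDiff.contDiffAt.comp s (contDiffAt_id.sub contDiffAt_const))
  have hF₂d : fderiv ℝ F₂ s = (fderiv ℝ F s).prod pr := by
    refine HasFDerivAt.fderiv ((hF.differentiableAt (by simp)).hasFDerivAt.prodMk ?_)
    exact pr.hasFDerivAt.comp s ((hasFDerivAt_id (𝕜 := ℝ) s).sub_const s)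
  have hs2 : Function.Surjective (fderiv ℝ F₂ s) := by
    rw [hF₂d]
    rintro ⟨v, u⟩
    obtain ⟨w, rfl⟩ := hsurj v
    obtain ⟨t, ht, htu⟩ := hpr (u - pr w)
    exact ⟨w + t, by simp [ht, htu]⟩
  obtain ⟨κ, θ, -, hθ, hθ0, hFθ, -, -⟩ := exists_straightening hF₂ (by simp [F₂, h0]) hs2
  let j : V₂ → (V × V₂) × (fderiv ℝ F₂ s).ker := fun u => ((0, u - pr s), 0)
  have hj : ContDiff ℝ ∞ j :=
    (contDiff_const.prodMk (contDiff_id.sub contDiff_const)).prodMk contDiff_const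
  have hj0 : j (pr s) = 0 := by simp [j]
  refine ⟨fun u => θ (j u), ?_, by simp only [hj0, hθ0], ?_⟩
  · refine ContDiffAt.comp (pr s) ?_ hj.contDiffAt
    rwa [hj0]
  · have : Tendsto j (𝓝 (pr s)) (𝓝 0) := by
      have := hj.continuous.tendsto (pr s)
      rwa [hj0] at this
    filter_upwards [this.eventually hFθ] with u hu
    simp only [F₂, j, Prod.mk.injEq, map_sub, sub_left_inj] at hu
    exact hu

end Submersions

/-! ### Matrix-like groups cut out by a submersion: exponentials, stabilizers and orbits. -/

section GroupGerms

variable {𝔸 : Type*} [NormedRing 𝔸] [NormedAlgebra ℝ 𝔸] [FiniteDimensional ℝ 𝔸]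
  {V : Type*} [NormedAddCommGroup V] [NormedSpace ℝ V] [FiniteDimensional ℝ V]

/-- `G` is a group of units of `𝔸`, defined near `1` by the submersion `F`. -/
structure IsSubmersiveGroup (G : Set 𝔸) (F : 𝔸 → V) : Prop where
  one_mem : (1 : 𝔸) ∈ G
  mul_mem : ∀ g ∈ G, ∀ h ∈ G, g * h ∈ G
  exists_inv : ∀ g ∈ G, ∃ h ∈ G, g * h = 1 ∧ h * g = 1
  contDiffAt : ContDiffAt ℝ ∞ F 1
  map_one : F 1 = 0
  surjective : Function.Surjective (fderiv ℝ F 1)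
  mem_iff : ∀ᶠ g in 𝓝 (1 : 𝔸), g ∈ G ↔ F g = 0

namespace IsSubmersiveGroup

variable {G : Set 𝔸} {F : 𝔸 → V} (hG : IsSubmersiveGroup G F)

include hG

/-- The left-invariant field `g ↦ g * X` is tangent to the group near `1`: take a curve in the group
through `1` with velocity `X` and translate it by `g`. -/
lemma eventually_fderiv_mul_eq_zero {X : 𝔸} (hX : fderiv ℝ F 1 X = 0) :
    ∀ᶠ g in 𝓝 (1 : 𝔸), F g = 0 → fderiv ℝ F g (g * X) = 0 := by
  obtain ⟨κ, θ, hκ, hθ, hθ0, hFθ, -, hdθ⟩ :=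
    exists_straightening hG.contDiffAt hG.map_one hG.surjective
  let XK : (fderiv ℝ F 1).ker := ⟨X, hX⟩
  let c : ℝ → 𝔸 := fun t => θ (0, t • XK)
  have hc0 : c 0 = 1 := by simpa [c] using! hθ0
  have hlin : HasDerivAt (fun t : ℝ => ((0 : V), t • XK)) (0, XK) 0 := by
    refine (hasDerivAt_const _ _).prodMk ?_
    simpa using (hasDerivAt_id (0 : ℝ)).smul_const XK
  have hcd : HasDerivAt c X 0 := by
    have h1 : HasFDerivAt θ (fderiv ℝ θ 0) ((0 : V), (0 : ℝ) • XK) := by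
      rw [zero_smul]
      exact (hθ.differentiableAt (by simp)).hasFDerivAt
    have h2 := h1.comp_hasDerivAt (0 : ℝ) hlin
    have h3 := hdθ X
    rw [hX, show κ X = XK from hκ XK] at h3
    rwa [h3] at h2
  have hcG : ∀ᶠ t in 𝓝 (0 : ℝ), c t ∈ G := by
    have h1 : Tendsto (fun t : ℝ => ((0 : V), t • XK)) (𝓝 0) (𝓝 0) := by
      simpa using! hlin.continuousAt.tendsto
    have h2 : Tendsto c (𝓝 0) (𝓝 1) := by simpa [hc0] using hcd.continuousAt.tendsto
    filter_upwards [h1.eventually hFθ, h2.eventually hG.mem_iff] with t ht1 ht2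
    exact ht2.2 ht1
  have hFd : ∀ᶠ g in 𝓝 (1 : 𝔸), DifferentiableAt ℝ F g := by
    have : ContDiffAt ℝ 1 F 1 := hG.contDiffAt.of_le (by exact_mod_cast le_top)
    filter_upwards [this.eventually (by simp)] with g hg using hg.differentiableAt (by simp)
  filter_upwards [hG.mem_iff.eventually_nhds, hFd] with g hg hgd hFg
  have hgG : g ∈ G := hg.self_of_nhds.2 hFg
  have h1 : HasDerivAt (fun t => g * c t) (g * X) 0 := hcd.const_mul g
  have h2 : HasDerivAt (fun t => F (g * c t)) (fderiv ℝ F g (g * X)) 0 := by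
    refine HasFDerivAt.comp_hasDerivAt (0 : ℝ) ?_ h1
    rw [hc0, mul_one]
    exact hgd.hasFDerivAt
  have h3 : (fun t => F (g * c t)) =ᶠ[𝓝 0] fun _ => 0 := by
    have : Tendsto (fun t => g * c t) (𝓝 0) (𝓝 g) := by
      simpa [hc0] using h1.continuousAt.tendsto
    filter_upwards [this.eventually hg, hcG] with t ht1 ht2
    exact ht1.1 (hG.mul_mem _ hgG _ ht2)
  exact h2.unique ((hasDerivAt_const (0 : ℝ) (0 : V)).congr_of_eventuallyEq h3)

/-- Along `exp (t X)` the derivative of `F` is `m g = dF_g (g X)`. This vanishes on the group and is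
Lipschitz in the straightened coordinates, so `‖m g‖ ≤ C ‖F g‖`. Grönwall's inequality with initial
value `F 1 = 0` forces `F` to vanish along the curve. -/
lemma exists_exp_mem {X : 𝔸} (hX : fderiv ℝ F 1 X = 0) :
    ∃ ε > (0 : ℝ), ∀ t ∈ Icc (0 : ℝ) ε, NormedSpace.exp (t • X) ∈ G := by
  have : CompleteSpace 𝔸 := FiniteDimensional.complete ℝ 𝔸
  obtain ⟨κ, θ, hκ, hθ, hθ0, hFθ, hleft, -⟩ :=
    exists_straightening hG.contDiffAt hG.map_one hG.surjective
  let m : 𝔸 → V := fun g => fderiv ℝ F g (g * X)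
  have hm : ContDiffAt ℝ 1 m 1 :=
    ((hG.contDiffAt.fderiv_right (m := 1) (by norm_cast)).clm_apply
      (contDiffAt_id.mul contDiffAt_const))
  have hmθ : ContDiffAt ℝ 1 (m ∘ θ) 0 := by
    refine ContDiffAt.comp 0 ?_ (hθ.of_le (by exact_mod_cast le_top))
    rwa [hθ0]
  obtain ⟨C, u, hu, hLip⟩ := hmθ.exists_lipschitzOnWith
  let e : ℝ → 𝔸 := fun t => NormedSpace.exp (t • X)
  have he : ∀ t, HasDerivAt e (e t * X) t := fun t => hasDerivAt_exp_smul_const X t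
  have he0 : Tendsto e (𝓝 0) (𝓝 1) := by
    have := (he 0).continuousAt.tendsto
    simpa [e] using this
  have hFd : ∀ᶠ g in 𝓝 (1 : 𝔸), DifferentiableAt ℝ F g := by
    have : ContDiffAt ℝ 1 F 1 := hG.contDiffAt.of_le (by exact_mod_cast le_top)
    filter_upwards [this.eventually (by simp)] with g hg using hg.differentiableAt (by simp)
  let p : 𝔸 → V × (fderiv ℝ F 1).ker := fun g => (F g, κ (g - 1))
  have hp : Tendsto p (𝓝 1) (𝓝 0) := by
    have : ContinuousAt p 1 := hG.contDiffAt.continuousAt.prodMk (by fun_prop)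
    simpa [p, ContinuousAt, hG.map_one] using! this.tendsto
  -- `θ (q g)` is the projection of `g` to the group in the straightened coordinates; `p g` and `q
  -- g` differ exactly by `F g`.
  let q : 𝔸 → V × (fderiv ℝ F 1).ker := fun g => (0, κ (g - 1))
  have hq : Tendsto q (𝓝 1) (𝓝 0) := by
    have : ContinuousAt q 1 := continuousAt_const.prodMk (by fun_prop)
    simpa [q, ContinuousAt] using! this.tendsto
  have hθt : Tendsto θ (𝓝 0) (𝓝 1) := by
    simpa [hθ0] using hθ.continuousAt.tendsto
  have hall : ∀ᶠ g in 𝓝 (1 : 𝔸), DifferentiableAt ℝ F g ∧ ‖m g‖ ≤ C * ‖F g‖ ∧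
      (g ∈ G ↔ F g = 0) := by
    filter_upwards [hFd, hleft, hp.eventually hu, hq.eventually hu, hq.eventually hFθ,
      (hθt.comp hq).eventually (hG.eventually_fderiv_mul_eq_zero hX), hG.mem_iff]
      with g h1 h2 h3 h4 h5 h6 h7
    refine ⟨h1, ?_, h7⟩
    have h8 : m (θ (q g)) = 0 := h6 h5
    have h9 := hLip.norm_sub_le h3 h4
    simp only [Function.comp_apply, h8, sub_zero] at h9
    rw [show θ (p g) = g from h2] at h9
    refine h9.trans (le_of_eq ?_)
    congr 1
    simp [p, q]
  obtain ⟨ε, hε, hball⟩ := Metric.eventually_nhds_iff.1 (he0.eventually hall)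
  have key : ∀ t ∈ Icc (0 : ℝ) (ε / 2), DifferentiableAt ℝ F (e t) ∧
      ‖m (e t)‖ ≤ C * ‖F (e t)‖ ∧ (e t ∈ G ↔ F (e t) = 0) := fun t ht => hball (by
    rw [Real.dist_eq, sub_zero, abs_of_nonneg ht.1]; linarith [ht.2])
  refine ⟨ε / 2, by positivity, fun t ht => (key t ht).2.2.2 ?_⟩
  have hd : ∀ t ∈ Icc (0 : ℝ) (ε / 2), HasDerivAt (fun t => F (e t)) (m (e t)) t := fun t ht =>
    (key t ht).1.hasFDerivAt.comp_hasDerivAt t (he t)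
  have h10 := norm_le_gronwallBound_of_norm_deriv_right_le (f := fun t => F (e t))
    (f' := fun t => m (e t)) (δ := 0) (K := C) (ε := 0) (a := 0) (b := ε / 2)
    (fun t ht => (hd t ht).continuousAt.continuousWithinAt)
    (fun t ht => (hd t (Ico_subset_Icc_self ht)).hasDerivWithinAt)
    (by simp [e, hG.map_one])
    (fun t ht => by simpa using (key t (Ico_subset_Icc_self ht)).2.1) t ht
  simpa [gronwallBound_ε0_δ0] using h10

lemma eventually_exp_mem {X : 𝔸} (hX : fderiv ℝ F 1 X = 0) :
    ∀ᶠ t in 𝓝 (0 : ℝ), NormedSpace.exp (t • X) ∈ G := by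
  obtain ⟨ε₁, h1, h1'⟩ := hG.exists_exp_mem hX
  obtain ⟨ε₂, h2, h2'⟩ := hG.exists_exp_mem (X := -X) (by rw [map_neg, hX, neg_zero])
  filter_upwards [Icc_mem_nhds (neg_neg_of_pos h2) h1] with t ht
  rcases le_total 0 t with h | h
  · exact h1' t ⟨h, ht.2⟩
  · simpa using h2' (-t) ⟨by linarith, by linarith [ht.1]⟩

variable {S : Type*} [NormedAddCommGroup S] [NormedSpace ℝ S]
  {α : 𝔸 → S →L[ℝ] S} (hα : ContDiff ℝ ∞ α) (hα1 : ∀ s, α 1 s = s)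
  (hαmul : ∀ g h s, α (g * h) s = α g (α h s)) {σ : S}

include hα hα1 hαmul

/-- If `X` kills `σ` infinitesimally, then `exp (t X)` fixes `σ` for every `t` and lies in the group
for small `t`. In a finite set the point `1` is isolated, so `exp (t X) = 1` near `t = 0`, and
differentiating gives `X = 0`. -/
lemma eq_zero_of_finite_stabilizer (hfin : {g ∈ G | α g σ = σ}.Finite) {X : 𝔸}
    (hX : fderiv ℝ F 1 X = 0) (hX' : fderiv ℝ α 1 X σ = 0) : X = 0 := by
  have : CompleteSpace 𝔸 := FiniteDimensional.complete ℝ 𝔸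
  let e : ℝ → 𝔸 := fun t => NormedSpace.exp (t • X)
  have he : ∀ t, HasDerivAt e (e t * X) t := fun t => hasDerivAt_exp_smul_const X t
  have he0 : e 0 = 1 := by simp [e]
  have hαd : HasFDerivAt α (fderiv ℝ α 1) 1 := (hα.differentiable (by simp) 1).hasFDerivAt
  -- Differentiate `α (g (1 + u X)) σ = α g (α (1 + u X) σ)` at `u = 0` in two ways.
  have hinv : ∀ g, fderiv ℝ α g (g * X) σ = 0 := by
    intro g
    have h1 : HasDerivAt (fun u : ℝ => 1 + u • X) X 0 := by
      simpa using ((hasDerivAt_id (0 : ℝ)).smul_const X).const_add 1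
    have h2 : HasDerivAt (fun u : ℝ => α (g * (1 + u • X)) σ) (fderiv ℝ α g (g * X) σ) 0 := by
      have h3 : HasDerivAt (fun u : ℝ => α (g * (1 + u • X))) (fderiv ℝ α g (g * X)) 0 := by
        refine HasFDerivAt.comp_hasDerivAt (0 : ℝ) ?_ (h1.const_mul g)
        simpa using (hα.differentiable (by simp) g).hasFDerivAt
      simpa using h3.clm_apply (hasDerivAt_const (0 : ℝ) σ)
    have h4 : HasDerivAt (fun u : ℝ => α (g * (1 + u • X)) σ) (α g (fderiv ℝ α 1 X σ)) 0 := by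
      have h3 : HasDerivAt (fun u : ℝ => α (1 + u • X)) (fderiv ℝ α 1 X) 0 := by
        refine HasFDerivAt.comp_hasDerivAt (0 : ℝ) ?_ h1
        simpa using hαd
      have h5 := h3.clm_apply (hasDerivAt_const (0 : ℝ) σ)
      simp only [map_zero, add_zero] at h5
      simp only [hαmul]
      exact (α g).hasFDerivAt.comp_hasDerivAt (0 : ℝ) h5
    rw [h2.unique h4, hX', map_zero]
  have hd : ∀ t, HasDerivAt (fun t => α (e t) σ) 0 t := by
    intro t
    have h1 : HasDerivAt (fun t => α (e t)) (fderiv ℝ α (e t) (e t * X)) t :=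
      (hα.differentiable (by simp) (e t)).hasFDerivAt.comp_hasDerivAt t (he t)
    simpa [hinv] using h1.clm_apply (hasDerivAt_const t σ)
  have hconst : ∀ t, α (e t) σ = σ := by
    intro t
    have := is_const_of_deriv_eq_zero (fun t => (hd t).differentiableAt)
      (fun t => (hd t).deriv) t 0
    rw [this, he0, hα1]
  have hmem : ∀ᶠ t in 𝓝 (0 : ℝ), e t ∈ {g ∈ G | α g σ = σ} := by
    filter_upwards [hG.eventually_exp_mem hX] with t ht using ⟨ht, hconst t⟩
  have hone : ∀ᶠ t in 𝓝 (0 : ℝ), e t = 1 := by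
    have h1 : IsClosed ({g ∈ G | α g σ = σ} \ {1}) := (hfin.subset sdiff_subset).isClosed
    have h2 : Tendsto e (𝓝 0) (𝓝 1) := by simpa [he0] using (he 0).continuousAt.tendsto
    filter_upwards [hmem, h2.eventually (h1.isOpen_compl.mem_nhds (by simp))] with t h3 h4
    by_contra h5
    exact h4 ⟨h3, h5⟩
  have h6 := (he 0).unique ((hasDerivAt_const (0 : ℝ) (1 : 𝔸)).congr_of_eventuallyEq hone)
  simpa [he0] using h6

/-- The orbit map of a group with discrete infinitesimal stabilizer has local smooth sections over
maps with values in the orbit. -/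
lemma exists_slice [FiniteDimensional ℝ S]
    (hinj : ∀ X, fderiv ℝ F 1 X = 0 → fderiv ℝ α 1 X σ = 0 → X = 0) :
    (∀ᶠ g in 𝓝 (1 : 𝔸), g ∈ G → α g σ = σ → g = 1) ∧
    ∀ {Y : Type*} [NormedAddCommGroup Y] [NormedSpace ℝ Y] (f : Y → S) (y₀ : Y),
      ContDiffAt ℝ ∞ f y₀ → f y₀ = σ → (∀ᶠ y in 𝓝 y₀, ∃ g ∈ G, f y = α g σ) →
      ∃ h : Y → 𝔸, ContDiffAt ℝ ∞ h y₀ ∧ h y₀ = 1 ∧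
        ∀ᶠ y in 𝓝 y₀, h y ∈ G ∧ α (h y) σ = f y := by
  have hex := exists_straightening hG.contDiffAt hG.map_one hG.surjective
  have hker : ∀ X, X ∈ (fderiv ℝ F 1).ker ↔ fderiv ℝ F 1 X = 0 := fun X => Iff.rfl
  generalize (fderiv ℝ F 1).ker = K at hex hker
  obtain ⟨κ, θ, hκ, hθ, hθ0, hFθ, hleft, hdθ⟩ := hex
  let η : K → 𝔸 := fun k => θ (0, k)
  have hη0 : η 0 = 1 := hθ0
  have hη : ContDiffAt ℝ ∞ η 0 :=
    ContDiffAt.comp (0 : K) hθ (contDiffAt_const.prodMk contDiffAt_id)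
  have hηd : HasFDerivAt η K.subtypeL 0 := by
    have h1 : HasFDerivAt η ((fderiv ℝ θ 0).comp (ContinuousLinearMap.inr ℝ V K)) 0 :=
      HasFDerivAt.comp (0 : K) (hθ.differentiableAt (by simp)).hasFDerivAt
        (ContinuousLinearMap.inr ℝ V K).hasFDerivAt
    convert h1 using 1
    ext k
    have h2 := hdθ k
    rw [show fderiv ℝ F 1 k = 0 from (hker k).1 k.2, hκ] at h2
    simpa using h2.symm
  have hηG : ∀ᶠ k in 𝓝 (0 : K), η k ∈ G := by
    have h1 : Tendsto (fun k : K => ((0 : V), k)) (𝓝 0) (𝓝 0) :=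
      (Continuous.prodMk_right (0 : V)).tendsto' 0 0 rfl
    have h2 : Tendsto η (𝓝 0) (𝓝 1) := by simpa [hη0] using hη.continuousAt.tendsto
    filter_upwards [h1.eventually hFθ, h2.eventually hG.mem_iff] with k h3 h4 using h4.2 h3
  let κ₁ : 𝔸 → K := fun g => κ (g - 1)
  have hκ₁ : Tendsto κ₁ (𝓝 1) (𝓝 0) :=
    (by fun_prop : Continuous κ₁).tendsto' 1 0 (by simp [κ₁])
  have hκη : ∀ᶠ g in 𝓝 (1 : 𝔸), g ∈ G → η (κ₁ g) = g := by
    filter_upwards [hleft, hG.mem_iff] with g h1 h2 h3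
    rwa [h2.1 h3] at h1
  let D : K →L[ℝ] S := ((ContinuousLinearMap.apply ℝ S σ).comp (fderiv ℝ α 1)).comp K.subtypeL
  have hD : ∀ k : K, D k = fderiv ℝ α 1 k σ := fun k => rfl
  have hDinj : Function.Injective D := by
    rw [injective_iff_map_eq_zero]
    intro k hk
    exact Subtype.ext (hinj k ((hker k).1 k.2) hk)
  -- `N` is a transversal to the orbit: near `σ`, each vector is moved by a unique small group
  -- element from a unique point of `σ + N`.
  obtain ⟨N, hN⟩ := (D : K →ₗ[ℝ] S).range.exists_isCompl
  let ψ : K × N → S := fun p => α (η p.1) (σ + p.2)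
  have hψ : ContDiffAt ℝ ∞ ψ 0 := by
    have h1 : ContDiffAt ℝ ∞ (fun p : K × N => η p.1) 0 :=
      ContDiffAt.comp (0 : K × N) (g := η) hη contDiffAt_fst
    exact (hα.contDiffAt.comp _ h1).clm_apply
      (contDiffAt_const.add (N.subtypeL.contDiff.comp contDiff_snd).contDiffAt)
  have hψ0 : ψ 0 = σ := by simp [ψ, hη0, hα1]
  have hψd : HasFDerivAt ψ (D.coprod N.subtypeL) 0 := by
    have h1 : HasFDerivAt (fun p : K × N => α (η p.1))
        ((fderiv ℝ α 1).comp (K.subtypeL.comp (ContinuousLinearMap.fst ℝ K N))) 0 := by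
      have h2 : HasFDerivAt (fun p : K × N => η p.1)
          (K.subtypeL.comp (ContinuousLinearMap.fst ℝ K N)) 0 :=
        HasFDerivAt.comp (0 : K × N) (g := η) hηd hasFDerivAt_fst
      refine HasFDerivAt.comp (0 : K × N) ?_ h2
      simp only [Prod.fst_zero, hη0]
      exact (hα.differentiable (by simp) 1).hasFDerivAt
    have h3 : HasFDerivAt (fun p : K × N => σ + (p.2 : S))
        (N.subtypeL.comp (ContinuousLinearMap.snd ℝ K N)) 0 :=
      (HasFDerivAt.comp (0 : K × N) N.subtypeL.hasFDerivAt hasFDerivAt_snd).const_add σ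
    refine (h1.clm_apply h3).congr_fderiv ?_
    ext p <;> simp [hη0, hα1, hD]
  have hbij : Function.Bijective (D.coprod N.subtypeL) := by
    constructor
    · rw [injective_iff_map_eq_zero]
      rintro ⟨k, n⟩ hp
      simp only [ContinuousLinearMap.coprod_apply, Submodule.subtypeL_apply] at hp
      have h1 : D k = -(n : S) := eq_neg_of_add_eq_zero_left hp
      have h2 : D k = 0 := by
        refine Submodule.disjoint_def.1 hN.disjoint (D k) ⟨k, rfl⟩ ?_
        rw [h1]
        exact N.neg_mem n.2
      have h3 : (n : S) = 0 := by simpa [h2] using hp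
      have h4 : n = 0 := Subtype.ext h3
      rw [hDinj (h2.trans (map_zero D).symm), h4]
      rfl
    · intro s
      obtain ⟨x, hx, n, hn, rfl⟩ := Submodule.mem_sup.1
        (by rw [hN.sup_eq_top]; trivial : s ∈ (D : K →ₗ[ℝ] S).range ⊔ N)
      obtain ⟨k, rfl⟩ := hx
      exact ⟨(k, ⟨n, hn⟩), by simp⟩
  obtain ⟨χ, hχ, hχ0, hright, hχψ⟩ := exists_local_inverse hψ (by rwa [hψd.fderiv])
  rw [hψ0] at hχ hχ0 hright
  refine ⟨?_, ?_⟩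
  · have h1 : Tendsto (fun g => ((κ₁ g, 0) : K × N)) (𝓝 1) (𝓝 0) :=
      hκ₁.prodMk_nhds tendsto_const_nhds
    filter_upwards [hκη, h1.eventually hχψ] with g h2 h3 h4 h5
    have h6 : ψ (κ₁ g, 0) = σ := by simp only [ψ, h2 h4, ZeroMemClass.coe_zero, add_zero, h5]
    rw [h6, hχ0] at h3
    have h7 : κ₁ g = 0 := (congrArg Prod.fst h3).symm
    rw [← h2 h4, h7, hη0]
  · intro Y _ _ f y₀ hf hfy hforb
    have hηG' : ∀ᶠ p : K × N in 𝓝 0, η p.1 ∈ G :=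
      (continuous_fst.tendsto (0 : K × N)).eventually hηG
    obtain ⟨U, hU, hUo, h0U⟩ := eventually_nhds_iff.1 (hχψ.and hηG')
    have hinjU : ∀ p ∈ U, ∀ q ∈ U, ψ p = ψ q → p = q := fun p hp q hq h => by
      rw [← (hU p hp).1, ← (hU q hq).1, h]
    -- The orbit may return to the transversal infinitely often near `σ`, but only countably often.
    -- The set `Z` of group elements bringing `σ` back is discrete: a nearby `g` is `η k * g₀`, so
    -- `ψ (k, n₀) = ψ (0, n)` and injectivity of `ψ` gives `k = 0`. A discrete subset of a
    -- finite-dimensional space is countable.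
    let Z : Set 𝔸 := {g | g ∈ G ∧ ∃ n : N, ((0 : K), n) ∈ U ∧ α g σ = σ + n}
    have hZ : Z.Countable := by
      have hdisc : DiscreteTopology Z := by
        rw [discreteTopology_subtype_iff']
        rintro g₀ ⟨hg₀, n₀, hn₀, hgn₀⟩
        obtain ⟨h₀, hh₀, hgh, hhg⟩ := hG.exists_inv g₀ hg₀
        have t1 : Tendsto (fun g => g * h₀) (𝓝 g₀) (𝓝 1) :=
          (continuous_mul_const h₀).tendsto' _ _ hgh
        have t2 : Tendsto (fun g => ((κ₁ (g * h₀), n₀) : K × N)) (𝓝 g₀) (𝓝 (0, n₀)) :=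
          (hκ₁.comp t1).prodMk_nhds tendsto_const_nhds
        obtain ⟨O, hO, hOo, hgO⟩ := eventually_nhds_iff.1
          ((t1.eventually hκη).and (t2.eventually (hUo.mem_nhds hn₀)))
        refine ⟨O, hOo, Set.Subset.antisymm ?_ ?_⟩
        · rintro g ⟨hg, hgG, n, hn, hgn⟩
          obtain ⟨h1, h2⟩ := hO g hg
          have h3 := h1 (hG.mul_mem _ hgG _ hh₀)
          have h4 : ψ (κ₁ (g * h₀), n₀) = ψ (0, n) := by
            simp only [ψ, h3, hη0, hα1]
            rw [← hgn, ← hgn₀, ← hαmul, mul_assoc, hhg, mul_one]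
          have h5 : κ₁ (g * h₀) = 0 := congrArg Prod.fst (hinjU _ h2 _ hn h4)
          rw [h5, hη0] at h3
          calc g = g * h₀ * g₀ := by rw [mul_assoc, hhg, mul_one]
            _ = g₀ := by rw [← h3, one_mul]
        · rintro g rfl
          exact ⟨hgO, hg₀, n₀, hn₀, hgn₀⟩
      exact TopologicalSpace.separableSpace_iff_countable.1 inferInstance
    let C : Set N := {n | ((0 : K), n) ∈ U ∧ ∃ g ∈ G, α g σ = σ + n}
    have hC : C.Countable := by
      refine ((hZ.image fun g => α g σ - σ).preimage
        (Subtype.val_injective : Function.Injective ((↑) : N → S))).mono ?_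
      rintro n ⟨hn, g, hg, hgn⟩
      exact ⟨g, ⟨hg, n, hn, hgn⟩, by simp [hgn]⟩
    let p : Y → K × N := fun y => χ (f y)
    have hp : ContDiffAt ℝ ∞ p y₀ := by
      refine ContDiffAt.comp y₀ ?_ hf
      rwa [hfy]
    have hp0 : p y₀ = 0 := by simp only [p, hfy, hχ0]
    have hpt : Tendsto p (𝓝 y₀) (𝓝 0) := by simpa [hp0] using hp.continuousAt.tendsto
    have hft : Tendsto f (𝓝 y₀) (𝓝 σ) := by simpa [hfy] using hf.continuousAt.tendsto
    have hp2 : Tendsto (fun y => ((0 : K), (p y).2)) (𝓝 y₀) (𝓝 0) :=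
      tendsto_const_nhds.prodMk_nhds ((continuous_snd.tendsto _).comp hpt)
    have hpc : ∀ᶠ y in 𝓝 y₀, ContinuousAt p y := by
      have : ContDiffAt ℝ 1 p y₀ := hp.of_le (by exact_mod_cast le_top)
      filter_upwards [this.eventually (by simp)] with y hy using hy.continuousAt
    obtain ⟨r, hr, hball⟩ := Metric.eventually_nhds_iff_ball.1
      (hpc.and ((hpt.eventually (hUo.mem_nhds h0U)).and ((hp2.eventually (hUo.mem_nhds h0U)).and
        ((hft.eventually hright).and hforb))))
    have hnC : ∀ y ∈ Metric.ball y₀ r, (p y).2 ∈ C := by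
      intro y hy
      obtain ⟨-, h1, h2, h3, g, hg, hfg⟩ := hball y hy
      obtain ⟨g', hg', -, hgg⟩ := hG.exists_inv _ (hU _ h1).2
      refine ⟨h2, g' * g, hG.mul_mem _ hg' _ hg, ?_⟩
      rw [hαmul, ← hfg, ← h3]
      simp only [ψ]
      rw [← hαmul, hgg, hα1]
    -- The transversal coordinate maps a connected ball continuously into the countable set `C`, so
    -- it is constant.
    have hn0 : ∀ y ∈ Metric.ball y₀ r, (p y).2 = 0 := by
      intro y hy
      have hpre : IsPreconnected ((fun y => (p y).2) '' Metric.ball y₀ r) :=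
        (convex_ball y₀ r).isPreconnected.image _ fun y hy =>
          ((hball y hy).1.snd).continuousWithinAt
      have := hC.isTotallyDisconnected _ (by rintro _ ⟨y, hy, rfl⟩; exact hnC y hy) hpre
        ⟨y, hy, rfl⟩ ⟨y₀, Metric.mem_ball_self hr, rfl⟩
      simpa [hp0] using this
    refine ⟨fun y => η (p y).1, ?_, by simp [hp0, hη0], ?_⟩
    · refine ContDiffAt.comp y₀ (g := η) ?_ hp.fst
      simpa [hp0] using hη
    · filter_upwards [Metric.ball_mem_nhds y₀ hr] with y hy
      obtain ⟨-, h1, -, h3, -⟩ := hball y hy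
      refine ⟨(hU _ h1).2, ?_⟩
      have h4 : ψ (p y) = f y := h3
      simpa [ψ, hn0 y hy] using h4

end IsSubmersiveGroup

end GroupGerms

/-! ### Hadamard's lemma. -/

section Hadamard

universe u

/-- Differentiating under the integral replaces `f` by its derivative and the weight `w t` by `w t *
t`. The weight and the varying target space are there so that the result has the same form and the
induction on `n` closes. -/
lemma contDiff_integral_smul {E : Type u} [NormedAddCommGroup E] [NormedSpace ℝ E]
    [FiniteDimensional ℝ E] (n : ℕ) : ∀ {F : Type u} [NormedAddCommGroup F] [NormedSpace ℝ F]
      [FiniteDimensional ℝ F] {f : E → F} {w : ℝ → ℝ}, ContDiff ℝ ∞ f → Continuous w →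
      ContDiff ℝ n fun x => ∫ t in (0 : ℝ)..1, w t • f (t • x) := by
  have hderiv : ∀ {F : Type u} [NormedAddCommGroup F] [NormedSpace ℝ F] [FiniteDimensional ℝ F]
      {f : E → F} {w : ℝ → ℝ}, ContDiff ℝ ∞ f → Continuous w → ∀ x,
      HasFDerivAt (fun x => ∫ t in (0 : ℝ)..1, w t • f (t • x))
        (∫ t in (0 : ℝ)..1, (w t * t) • fderiv ℝ f (t • x)) x := by
    intro F _ _ _ f w hf hw x
    have hf1 : Continuous (fderiv ℝ f) := hf.continuous_fderiv (by simp)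
    have hc : Continuous fun p : ℝ × E => (w p.1 * p.1) • fderiv ℝ f (p.1 • p.2) := by fun_prop
    obtain ⟨C, hC⟩ := (isCompact_Icc (a := (0 : ℝ)) (b := 1)).prod
      (isCompact_closedBall x 1) |>.exists_bound_of_continuousOn hc.continuousOn
    have hf0 : Continuous f := hf.continuous
    refine intervalIntegral.hasFDerivAt_integral_of_dominated_of_fderiv_le
      (F := fun x t => w t • f (t • x)) (F' := fun x t => (w t * t) • fderiv ℝ f (t • x))
      (bound := fun _ => C)
      (Metric.closedBall_mem_nhds x one_pos) ?_ ?_ ?_ ?_ ?_ ?_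
    · exact Eventually.of_forall fun y =>
        (by fun_prop : Continuous fun t : ℝ => w t • f (t • y)).aestronglyMeasurable
    · exact (by fun_prop : Continuous fun t : ℝ => w t • f (t • x)).intervalIntegrable _ _
    · exact (by fun_prop : Continuous fun t : ℝ =>
        (w t * t) • fderiv ℝ f (t • x)).aestronglyMeasurable
    · refine Eventually.of_forall fun t ht y hy => hC (t, y) ⟨?_, hy⟩
      rw [uIoc_of_le zero_le_one] at ht
      exact Ioc_subset_Icc_self ht
    · exact intervalIntegrable_const
    · refine Eventually.of_forall fun t _ y _ => ?_
      have h1 : HasFDerivAt (fun y : E => t • y) (t • ContinuousLinearMap.id ℝ E) y :=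
        (hasFDerivAt_id y).const_smul t
      have h2 := ((hf.differentiable (by simp) (t • y)).hasFDerivAt.comp y h1).const_smul (w t)
      refine h2.congr_fderiv ?_
      ext v
      simp [mul_smul]
  induction n with
  | zero =>
    intro F _ _ _ f w hf hw
    simp only [CharP.cast_eq_zero, contDiff_zero]
    exact continuous_iff_continuousAt.2 fun x => (hderiv hf hw x).continuousAt
  | succ n ih =>
    intro F _ _ _ f w hf hw
    push_cast
    refine contDiff_succ_iff_hasFDerivAt.2 ⟨_, ?_, hderiv hf hw⟩
    exact ih (hf.fderiv_right (by simp)) (by fun_prop)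

/-- Hadamard's lemma. -/
lemma exists_eq_clm_apply_sub {E : Type u} [NormedAddCommGroup E] [NormedSpace ℝ E]
    [FiniteDimensional ℝ E] {f : E → ℝ} (hf : ContDiff ℝ ∞ f) (x₀ : E) :
    ∃ G : E → E →L[ℝ] ℝ, ContDiff ℝ ∞ G ∧ G x₀ = fderiv ℝ f x₀ ∧
      ∀ x, f x = f x₀ + G x (x - x₀) := by
  have hf₁ : ContDiff ℝ ∞ fun y => fderiv ℝ f (x₀ + y) :=
    (hf.fderiv_right (m := ∞) (by simp)).comp (contDiff_const.add contDiff_id)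
  let G₀ : E → E →L[ℝ] ℝ := fun x => ∫ t in (0 : ℝ)..1, (1 : ℝ) • fderiv ℝ f (x₀ + t • x)
  have hG₀ : ContDiff ℝ ∞ G₀ := contDiff_infty.2 fun n =>
    contDiff_integral_smul n hf₁ (continuous_const (y := (1 : ℝ)))
  refine ⟨fun x => G₀ (x - x₀), hG₀.comp (contDiff_id.sub contDiff_const), by simp [G₀], ?_⟩
  intro x
  have hd : ∀ t ∈ uIcc (0 : ℝ) 1, HasDerivAt (fun t : ℝ => f (x₀ + t • (x - x₀)))
      (fderiv ℝ f (x₀ + t • (x - x₀)) (x - x₀)) t := by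
    intro t _
    have h1 : HasDerivAt (fun t : ℝ => x₀ + t • (x - x₀)) (x - x₀) t := by
      simpa using ((hasDerivAt_id t).smul_const (x - x₀)).const_add x₀
    exact (hf.differentiable (by simp) _).hasFDerivAt.comp_hasDerivAt t h1
  have hc : Continuous fun t : ℝ => fderiv ℝ f (x₀ + t • (x - x₀)) :=
    hf₁.continuous.comp (by fun_prop : Continuous fun t : ℝ => t • (x - x₀))
  have h2 := intervalIntegral.integral_eq_sub_of_hasDerivAt hd
    ((hc.clm_apply continuous_const).intervalIntegrable _ _)
  simp only [one_smul, zero_smul, add_zero, add_sub_cancel] at h2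
  have h3 : G₀ (x - x₀) (x - x₀) =
      ∫ t in (0 : ℝ)..1, fderiv ℝ f (x₀ + t • (x - x₀)) (x - x₀) := by
    simp only [G₀, one_smul]
    exact ContinuousLinearMap.intervalIntegral_apply (hc.intervalIntegrable _ _) _
  rw [h3, h2]
  ring

end Hadamard

section Charts

variable {E : Type*} [NormedAddCommGroup E] [NormedSpace ℝ E]
  {M : Type*} [TopologicalSpace M] [ChartedSpace E M]
  {F : Type*} [NormedAddCommGroup F] [NormedSpace ℝ F]

lemma HasMFDerivAt.hasFDerivAt_comp_extChartAt_symm {f : M → F} {a : M} {f' : E →L[ℝ] F}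
    (hf : HasMFDerivAt 𝓘(ℝ, E) 𝓘(ℝ, F) f a f') :
    HasFDerivAt (fun x => f ((extChartAt 𝓘(ℝ, E) a).symm x)) f' (extChartAt 𝓘(ℝ, E) a a) := by
  have h := hf.2
  simp only [writtenInExtChartAt, mfld_simps, chartAt_self_eq] at h
  exact hasFDerivWithinAt_univ.1 h

end Charts

/-! ### Differential operators, vanishing ideals and iterated commutators. -/

section VanishingIdeals

variable {E : Type*} [NormedAddCommGroup E] [NormedSpace ℝ E]
  {M : Type*} [TopologicalSpace M] [ChartedSpace E M]

variable (E) in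
/-- The ideal of the smooth functions vanishing at `a`. -/
def vanishingIdealAt (a : M) : Ideal C^∞⟮𝓘(ℝ, E), M; ℝ⟯ where
  carrier := {f | f a = 0}
  add_mem' {f g} hf hg := by
    simp only [mem_ofPred_eq] at *
    simp [hf, hg]
  zero_mem' := rfl
  smul_mem' f g hg := by
    simp only [mem_ofPred_eq] at *
    simp [hg]

lemma mem_vanishingIdealAt {a : M} {f : C^∞⟮𝓘(ℝ, E), M; ℝ⟯} :
    f ∈ vanishingIdealAt E a ↔ f a = 0 := Iff.rfl

variable {A : C^∞⟮𝓘(ℝ, E), M; ℝ⟯ →ₗ[ℝ] C^∞⟮𝓘(ℝ, E), M; ℝ⟯}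

lemma commMul_apply (f g : C^∞⟮𝓘(ℝ, E), M; ℝ⟯) (a : M) :
    commMul A f g a = A (f * g) a - f a * A g a := rfl

/-- For `u` vanishing at `a`, `A (u v)` and `[A, u] v` have the same value at `a`, and `[A, u]` has
lower order; in order zero, `A g = g * A 1`. -/
lemma apply_eq_zero_of_mem_pow {a : M} {k : ℕ} (hA : IsDiffOp k A) :
    ∀ g ∈ vanishingIdealAt E a ^ (k + 1), A g a = 0 := by
  induction k generalizing A with
  | zero =>
    intro g hg
    rw [zero_add, pow_one] at hg
    have h1 := commMul_apply (A := A) g 1 a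
    rw [hA g, mem_vanishingIdealAt.1 hg, zero_mul, sub_zero, mul_one] at h1
    exact h1.symm
  | succ k ih =>
    intro g hg
    rw [pow_succ'] at hg
    refine Submodule.mul_induction_on hg ?_ ?_
    · intro u hu v hv
      have h1 := ih (hA u) v hv
      rwa [commMul_apply, mem_vanishingIdealAt.1 hu, zero_mul, sub_zero] at h1
    · intro u v hu hv
      simp [hu, hv]

lemma pow_sub_pow_mem {R : Type*} [CommRing R] {I : Ideal R} {f g : R} (hf : f ∈ I) (hg : g ∈ I)
    (hfg : f - g ∈ I ^ 2) (k : ℕ) : f ^ k - g ^ k ∈ I ^ (k + 1) := by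
  induction k with
  | zero => simp
  | succ k ih =>
    have h1 : f ^ (k + 1) - g ^ (k + 1) = f * (f ^ k - g ^ k) + (f - g) * g ^ k := by ring
    rw [h1]
    refine add_mem ?_ ?_
    · rw [pow_succ' I (k + 1)]
      exact Ideal.mul_mem_mul hf ih
    · rw [show k + 1 + 1 = 2 + k by ring, pow_add]
      exact Ideal.mul_mem_mul hfg (Ideal.pow_mem_pow hg k)

/-- The iterated commutator of `A` with the multiplication by `f`. -/
def iterComm (f : C^∞⟮𝓘(ℝ, E), M; ℝ⟯) :
    ℕ → (C^∞⟮𝓘(ℝ, E), M; ℝ⟯ →ₗ[ℝ] C^∞⟮𝓘(ℝ, E), M; ℝ⟯) →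
      C^∞⟮𝓘(ℝ, E), M; ℝ⟯ →ₗ[ℝ] C^∞⟮𝓘(ℝ, E), M; ℝ⟯
  | 0, A => A
  | k + 1, A => iterComm f k (commMul A f)

/-- This links iterated commutators to the expression `A (f ^ k) a` defining the symbol. -/
lemma iterComm_apply_of_eq_zero {f : C^∞⟮𝓘(ℝ, E), M; ℝ⟯} {a : M} (hf : f a = 0) (k : ℕ)
    (g : C^∞⟮𝓘(ℝ, E), M; ℝ⟯) : iterComm f k A g a = A (f ^ k * g) a := by
  induction k generalizing A with
  | zero => simp [iterComm]
  | succ k ih => rw [iterComm, ih, commMul_apply, hf, zero_mul, sub_zero, pow_succ', mul_assoc]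

/-- Constants commute with `A`. Hence commutators compute the symbol without the normalization `f a
= 0`, and one function serves all nearby points. -/
lemma iterComm_sub_algebraMap (f : C^∞⟮𝓘(ℝ, E), M; ℝ⟯) (c : ℝ) (k : ℕ) :
    iterComm (f - algebraMap ℝ _ c) k A = iterComm f k A := by
  induction k generalizing A with
  | zero => rfl
  | succ k ih =>
    rw [iterComm, iterComm, ih]
    congr 1
    ext g a
    rw [commMul_apply, commMul_apply, sub_mul, map_sub, ← Algebra.smul_def, map_smul]
    simp only [ContMDiffMap.coe_sub, Pi.sub_apply, ContMDiffMap.coe_smul, Pi.smul_apply,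
      smul_eq_mul]
    change _ - c * _ - (f a - c) * _ = _
    ring

/-- The iterated commutators with a linear family of functions are the values on the diagonal of a
multilinear map. -/
lemma exists_multilinear_iterComm {V : Type*} [AddCommGroup V] [Module ℝ V]
    (L : V →ₗ[ℝ] C^∞⟮𝓘(ℝ, E), M; ℝ⟯) (k : ℕ) :
    ∃ m : (C^∞⟮𝓘(ℝ, E), M; ℝ⟯ →ₗ[ℝ] C^∞⟮𝓘(ℝ, E), M; ℝ⟯) →ₗ[ℝ]
      MultilinearMap ℝ (fun _ : Fin k => V) C^∞⟮𝓘(ℝ, E), M; ℝ⟯,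
      ∀ A v, m A (fun _ => v) = iterComm (L v) k A 1 := by
  induction k with
  | zero =>
    exact ⟨{ toFun := fun A => MultilinearMap.constOfIsEmpty ℝ _ (A 1)
             map_add' := fun A B => by ext; simp
             map_smul' := fun c A => by ext; simp }, fun A v => rfl⟩
  | succ k ih =>
    obtain ⟨m, hm⟩ := ih
    let comm : (C^∞⟮𝓘(ℝ, E), M; ℝ⟯ →ₗ[ℝ] C^∞⟮𝓘(ℝ, E), M; ℝ⟯) →ₗ[ℝ] V →ₗ[ℝ]
        (C^∞⟮𝓘(ℝ, E), M; ℝ⟯ →ₗ[ℝ] C^∞⟮𝓘(ℝ, E), M; ℝ⟯) :=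
      LinearMap.mk₂ ℝ (fun A v => commMul A (L v))
        (fun A B v => by
          ext g a
          simp only [commMul_apply, LinearMap.add_apply, ContMDiffMap.coe_add, Pi.add_apply]
          ring)
        (fun c A v => by
          ext g a
          simp only [commMul_apply, LinearMap.smul_apply, ContMDiffMap.coe_smul, Pi.smul_apply,
            smul_eq_mul]
          ring)
        (fun A v w => by
          ext g a
          simp only [commMul_apply, LinearMap.add_apply, ContMDiffMap.coe_add, Pi.add_apply,
            map_add, add_mul]
          ring)
        (fun c A v => by
          ext g a
          simp only [commMul_apply, LinearMap.smul_apply, ContMDiffMap.coe_smul, Pi.smul_apply,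
            smul_eq_mul, map_smul, smul_mul_assoc]
          ring)
    refine ⟨(multilinearCurryLeftEquiv ℝ (fun _ : Fin (k + 1) => V)
      C^∞⟮𝓘(ℝ, E), M; ℝ⟯).symm.toLinearMap ∘ₗ (LinearMap.llcomp ℝ V _ _ m) ∘ₗ comm, ?_⟩
    intro A v
    rw [iterComm, ← hm]
    rfl

end VanishingIdeals

section Symbols

variable {E : Type*} [NormedAddCommGroup E] [NormedSpace ℝ E] [FiniteDimensional ℝ E]
  {M : Type*} [TopologicalSpace M] [ChartedSpace E M] [IsManifold 𝓘(ℝ, E) ∞ M] [T2Space M]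

/-- The product of a bump function and a smooth function of the chart. -/
def bumpMul {a : M} (χ : SmoothBumpFunction 𝓘(ℝ, E) a) (g : E → ℝ) (hg : ContDiff ℝ ∞ g) :
    C^∞⟮𝓘(ℝ, E), M; ℝ⟯ :=
  ⟨fun b => χ b • g (extChartAt 𝓘(ℝ, E) a b),
    χ.contMDiff_smul (hg.contMDiff.comp_contMDiffOn contMDiffOn_extChartAt)⟩

lemma bumpMul_apply {a : M} (χ : SmoothBumpFunction 𝓘(ℝ, E) a) {g : E → ℝ} (hg : ContDiff ℝ ∞ g)
    (b : M) : bumpMul χ g hg b = χ b * g (extChartAt 𝓘(ℝ, E) a b) := rfl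

lemma bumpMul_eventuallyEq {a : M} (χ : SmoothBumpFunction 𝓘(ℝ, E) a) {g : E → ℝ}
    (hg : ContDiff ℝ ∞ g) :
    bumpMul χ g hg =ᶠ[𝓝 a] fun b => g (extChartAt 𝓘(ℝ, E) a b) := by
  filter_upwards [χ.eventuallyEq_one] with b hb
  simp [bumpMul_apply, hb]

/-- In a chart, Hadamard's lemma writes a cut-off of `h` as a sum of products of the coordinates
with the components of a smooth covector field, which vanishes at `a` with the differential of `h`.
-/
lemma mem_vanishingIdealAt_sq {a : M} {h : C^∞⟮𝓘(ℝ, E), M; ℝ⟯} (h0 : h a = 0)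
    (hd : HasMFDerivAt 𝓘(ℝ, E) 𝓘(ℝ, ℝ) h a 0) : h ∈ vanishingIdealAt E a ^ 2 := by
  obtain ⟨χ⟩ : Nonempty (SmoothBumpFunction 𝓘(ℝ, E) a) := inferInstance
  set x₀ := extChartAt 𝓘(ℝ, E) a a with hx₀
  let f : E → ℝ := fun x => χ.toContDiffBump x * h ((extChartAt 𝓘(ℝ, E) a).symm x)
  have hf : ContDiff ℝ ∞ f := by
    refine contDiff_iff_contDiffAt.2 fun x => ?_
    by_cases hx : x ∈ (extChartAt 𝓘(ℝ, E) a).target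
    · refine χ.toContDiffBump.contDiffAt.mul ?_
      have h1 : ContMDiffAt 𝓘(ℝ, E) 𝓘(ℝ, E) ∞ (extChartAt 𝓘(ℝ, E) a).symm x :=
        (contMDiffOn_extChartAt_symm a).contMDiffAt (extChartAt_target_mem_nhds' hx)
      exact (h.contMDiff.contMDiffAt.comp x h1).contDiffAt
    · have h1 : x ∉ tsupport χ.toContDiffBump := by
        rw [χ.toContDiffBump.tsupport_eq]
        exact fun h2 => hx (χ.closedBall_subset ⟨h2, by simp⟩)
      have h2 : f =ᶠ[𝓝 x] fun _ => 0 := by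
        filter_upwards [notMem_tsupport_iff_eventuallyEq.1 h1] with y hy
        change χ.toContDiffBump y * _ = 0
        rw [hy, Pi.zero_apply, zero_mul]
      exact contDiffAt_const.congr_of_eventuallyEq h2
  have hfd : fderiv ℝ f x₀ = 0 := by
    have h1 : HasFDerivAt (fun x => h ((extChartAt 𝓘(ℝ, E) a).symm x)) (0 : E →L[ℝ] ℝ) x₀ := by
      exact hd.hasFDerivAt_comp_extChartAt_symm
    refine (h1.congr_of_eventuallyEq ?_).fderiv
    filter_upwards [χ.toContDiffBump.eventuallyEq_one] with x hx
    simp only [f, hx, Pi.one_apply, one_mul]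
  obtain ⟨G, hG, hG0, hfG⟩ := exists_eq_clm_apply_sub hf x₀
  let B := Module.finBasis ℝ E
  let l : Fin (Module.finrank ℝ E) → E →L[ℝ] ℝ :=
    fun i => LinearMap.toContinuousLinearMap (B.coord i)
  have hl : ∀ i, ContDiff ℝ ∞ fun x => l i (x - x₀) := fun i =>
    (l i).contDiff.comp (contDiff_id.sub contDiff_const)
  have hg : ∀ i, ContDiff ℝ ∞ fun x => G x (B i) := fun i => hG.clm_apply contDiff_const
  have hf0 : f x₀ = 0 := by simp [f, hx₀, h0]
  have hsum : ∀ x, f x = ∑ i, l i (x - x₀) * G x (B i) := by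
    intro x
    rw [hfG, hf0, zero_add]
    conv_lhs => rw [← B.sum_repr (x - x₀), map_sum]
    simp [l]
  let c : C^∞⟮𝓘(ℝ, E), M; ℝ⟯ := bumpMul χ (fun _ => 1) contDiff_const
  have hc : ∀ b, c b = χ b := fun b => by simp [c, bumpMul_apply]
  -- The third power of the bump function counts the one inside `f` and one for each of the two
  -- factors pulled back from the chart.
  have key : h = (1 - c ^ 3) * h + ∑ i, bumpMul χ _ (hl i) * bumpMul χ _ (hg i) := by
    ext b
    have h1 : (∑ i, bumpMul χ _ (hl i) * bumpMul χ _ (hg i)) b = χ b ^ 3 * h b := by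
      have h2 : (∑ i, bumpMul χ _ (hl i) * bumpMul χ _ (hg i)) b =
          ∑ i, χ b ^ 2 * (l i (extChartAt 𝓘(ℝ, E) a b - x₀) *
            G (extChartAt 𝓘(ℝ, E) a b) (B i)) := by
        rw [← ContMDiffMap.coeFnAddMonoidHom_apply, map_sum, Finset.sum_apply]
        refine Finset.sum_congr rfl fun i _ => ?_
        simp only [ContMDiffMap.coeFnAddMonoidHom_apply, ContMDiffMap.coe_mul, Pi.mul_apply,
          bumpMul_apply]
        ring
      rw [h2, ← Finset.mul_sum, ← hsum]
      by_cases hb : b ∈ (chartAt E a).source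
      · simp only [f]
        rw [(extChartAt 𝓘(ℝ, E) a).left_inv (by simpa using hb), ← Function.comp_apply
          (f := χ.toContDiffBump), ← χ.eqOn_source hb]
        ring
      · have : χ b = 0 := by
          simp [χ.coe_def, Set.indicator_of_notMem hb]
        simp [this]
    simp only [ContMDiffMap.coe_add, ContMDiffMap.coe_mul, Pi.add_apply, Pi.mul_apply, h1,
      ContMDiffMap.coe_sub, Pi.sub_apply, ContMDiffMap.coe_one, Pi.one_apply,
      ContMDiffMap.coe_pow, Pi.pow_apply, hc]
    ring
  rw [key, sq]
  refine add_mem (Ideal.mul_mem_mul ?_ h0) (sum_mem fun i _ => Ideal.mul_mem_mul ?_ ?_)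
  · simp [mem_vanishingIdealAt, hc]
  · rw [mem_vanishingIdealAt, bumpMul_apply, ← hx₀, sub_self, map_zero, mul_zero]
  · rw [mem_vanishingIdealAt, bumpMul_apply, ← hx₀, hG0, hfd]
    simp

end Symbols

/-! ### Contravariant tensors, symmetrization and polarization. -/

section MultilinearForms

variable {V : Type*} [NormedAddCommGroup V] [NormedSpace ℝ V] [FiniteDimensional ℝ V] {k : ℕ}

lemma MultilinearMap.continuous_of_finiteDimensional_domain
    (m : MultilinearMap ℝ (fun _ : Fin k => V) ℝ) : Continuous m := by
  let b := Module.finBasis ℝ V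
  have h : ⇑m = fun v => ∑ r : Fin k → Fin (Module.finrank ℝ V),
      (∏ i, b.coord (r i) (v i)) • m fun i => b (r i) := by
    funext v
    conv_lhs => rw [show v = fun i => ∑ j, b.coord j (v i) • b j from
      funext fun i => (b.sum_repr (v i)).symm]
    rw [m.map_sum]
    exact Finset.sum_congr rfl fun r _ => m.map_smul_univ _ _
  rw [h]
  refine continuous_finsetSum _ fun r _ => Continuous.mul ?_ continuous_const
  refine continuous_finsetProd _ fun i _ => ?_
  exact (LinearMap.continuous_of_finiteDimensional (b.coord (r i))).comp (continuous_apply i)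

instance ContinuousMultilinearMap.finiteDimensional_fin_fun {F : Type*} [NormedAddCommGroup F]
    [NormedSpace ℝ F] [FiniteDimensional ℝ F] :
    FiniteDimensional ℝ (ContinuousMultilinearMap ℝ (fun _ : Fin k => V) F) :=
  FiniteDimensional.of_injective
    (ContinuousMultilinearMap.toMultilinearMapLinear :
      ContinuousMultilinearMap ℝ (fun _ : Fin k => V) F →ₗ[ℝ]
        MultilinearMap ℝ (fun _ : Fin k => V) F)
    ContinuousMultilinearMap.toMultilinearMap_injective

/-- A map to a finite-dimensional space is smooth if its compositions with a separating family of
functionals are. -/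
lemma contMDiffAt_of_separating {E : Type*} [NormedAddCommGroup E] [NormedSpace ℝ E]
    {M : Type*} [TopologicalSpace M] [ChartedSpace E M] {f : M → V} {a : M}
    {ι : Type*} (l : ι → V →L[ℝ] ℝ) (hl : ∀ v, (∀ i, l i v = 0) → v = 0)
    (hf : ∀ i, ContMDiffAt 𝓘(ℝ, E) 𝓘(ℝ, ℝ) ∞ (fun b => l i (f b)) a) :
    ContMDiffAt 𝓘(ℝ, E) 𝓘(ℝ, V) ∞ f a := by
  let Q : Submodule ℝ (Module.Dual ℝ V) :=
    { carrier := {φ | ContMDiffAt 𝓘(ℝ, E) 𝓘(ℝ, ℝ) ∞ (fun b => φ (f b)) a}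
      add_mem' := fun h₁ h₂ => ContMDiffAt.add h₁ h₂
      zero_mem' := contMDiffAt_const
      smul_mem' := fun c φ h =>
        (contDiff_const.mul contDiff_id : ContDiff ℝ ∞ fun x : ℝ => c * x).contMDiff.contMDiffAt.comp
          a h }
  -- A proper subspace of the dual would annihilate a nonzero vector, contradicting separation.
  have hQ : Q = ⊤ := by
    have h1 : Q.dualCoannihilator = ⊥ := by
      rw [eq_bot_iff]
      intro v hv
      rw [Submodule.mem_dualCoannihilator] at hv
      exact hl v fun i => hv (l i : V →ₗ[ℝ] ℝ) (hf i)
    rw [← Subspace.dualCoannihilator_dualAnnihilator_eq (W := Q), h1,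
      Submodule.dualAnnihilator_bot]
  let b := Module.finBasis ℝ V
  have h2 : f = fun x => ∑ i, b.coord i (f x) • b i := funext fun x => (b.sum_repr (f x)).symm
  rw [h2]
  refine ContMDiffAt.sum fun i _ => ?_
  have h3 : b.coord i ∈ Q := by rw [hQ]; trivial
  exact ContMDiffAt.smul h3 contMDiffAt_const

/-- The symmetrization of a multilinear form. -/
def ContinuousMultilinearMap.symmetrization (V : Type*) [NormedAddCommGroup V] [NormedSpace ℝ V]
    (k : ℕ) : ContinuousMultilinearMap ℝ (fun _ : Fin k => V) ℝ →ₗ[ℝ]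
      ContinuousMultilinearMap ℝ (fun _ : Fin k => V) ℝ where
  toFun m := (k.factorial : ℝ)⁻¹ • ∑ p : Equiv.Perm (Fin k), m.domDomCongr p
  map_add' m m' := by
    ext v
    simp [Finset.sum_add_distrib, mul_add]
  map_smul' c m := by
    ext v
    simp [← Finset.mul_sum]
    ring

lemma ContinuousMultilinearMap.symmetrization_apply {V : Type*} [NormedAddCommGroup V]
    [NormedSpace ℝ V] (m : ContinuousMultilinearMap ℝ (fun _ : Fin k => V) ℝ) (v : Fin k → V) :
    ContinuousMultilinearMap.symmetrization V k m v =
      (k.factorial : ℝ)⁻¹ * ∑ p : Equiv.Perm (Fin k), m fun i => v (p i) := by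
  simp [ContinuousMultilinearMap.symmetrization]

end MultilinearForms

section ContraTensors

/-- Contravariant tensors of degree `k`. -/
def ContraTensor (E : Type*) [NormedAddCommGroup E] [NormedSpace ℝ E] (k : ℕ) : Type _ :=
  ContinuousMultilinearMap ℝ (fun _ : Fin k => E →L[ℝ] ℝ) ℝ

variable {E : Type*} [NormedAddCommGroup E] [NormedSpace ℝ E] {k : ℕ}

namespace ContraTensor

instance : NormedAddCommGroup (ContraTensor E k) :=
  inferInstanceAs (NormedAddCommGroup (ContinuousMultilinearMap ℝ (fun _ : Fin k => E →L[ℝ] ℝ) ℝ))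

instance : NormedSpace ℝ (ContraTensor E k) :=
  inferInstanceAs (NormedSpace ℝ (ContinuousMultilinearMap ℝ (fun _ : Fin k => E →L[ℝ] ℝ) ℝ))

instance : CoeFun (ContraTensor E k) fun _ => (Fin k → E →L[ℝ] ℝ) → ℝ :=
  ⟨fun m => (show ContinuousMultilinearMap ℝ (fun _ : Fin k => E →L[ℝ] ℝ) ℝ from m).toFun⟩

@[ext]
lemma ext {m m' : ContraTensor E k} (h : ∀ θ, m θ = m' θ) : m = m' :=
  ContinuousMultilinearMap.ext h

lemma contDiff (m : ContraTensor E k) : ContDiff ℝ ∞ m :=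
  ContinuousMultilinearMap.contDiff m

variable [FiniteDimensional ℝ E]

instance : FiniteDimensional ℝ (ContraTensor E k) :=
  ContinuousMultilinearMap.finiteDimensional_fin_fun (V := E →L[ℝ] ℝ) (F := ℝ) (k := k)

/-- The evaluation of tensors. -/
def evalL (θ : Fin k → E →L[ℝ] ℝ) : ContraTensor E k →L[ℝ] ℝ :=
  LinearMap.toContinuousLinearMap
    { toFun := fun m => m θ
      map_add' := fun _ _ => rfl
      map_smul' := fun _ _ => rfl }

lemma contMDiffAt_of_apply {M : Type*} [TopologicalSpace M] [ChartedSpace E M]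
    {f : M → ContraTensor E k} {a : M} (hf : ∀ θ, ContMDiffAt 𝓘(ℝ, E) 𝓘(ℝ, ℝ) ∞ (fun b => f b θ) a) :
    ContMDiffAt 𝓘(ℝ, E) 𝓘(ℝ, ContraTensor E k) ∞ f a :=
  contMDiffAt_of_separating evalL (fun _ h => ext h) hf

/-- The symmetrization of a tensor. -/
def symm : ContraTensor E k →L[ℝ] ContraTensor E k :=
  LinearMap.toContinuousLinearMap (show ContraTensor E k →ₗ[ℝ] ContraTensor E k from
    ContinuousMultilinearMap.symmetrization (E →L[ℝ] ℝ) k)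

lemma symm_apply (m : ContraTensor E k) (θ : Fin k → E →L[ℝ] ℝ) :
    symm m θ = (k.factorial : ℝ)⁻¹ * ∑ p : Equiv.Perm (Fin k), m fun i => θ (p i) :=
  ContinuousMultilinearMap.symmetrization_apply m θ

lemma symm_diag (m : ContraTensor E k) (θ : E →L[ℝ] ℝ) :
    symm m (fun _ => θ) = m fun _ => θ := by
  rw [symm_apply]
  simp [Fintype.card_perm, Nat.factorial_ne_zero]

/-- Polarization: the sum over permutations is the `k`-th derivative at `0` of the polynomial `θ ↦ m
(θ, …, θ)`. -/
lemma symm_congr {m m' : ContraTensor E k} (h : ∀ θ, (m fun _ => θ) = m' fun _ => θ) :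
    symm m = symm m' := by
  ext v
  rw [symm_apply, symm_apply]
  congr 1
  refine (ContinuousMultilinearMap.iteratedFDeriv_comp_diagonal m 0 v).symm.trans
    (Eq.trans ?_ (ContinuousMultilinearMap.iteratedFDeriv_comp_diagonal m' 0 v))
  congr 2
  exact funext h

/-- The action of endomorphisms on contravariant tensors. -/
def act (g : E →L[ℝ] E) : ContraTensor E k →L[ℝ] ContraTensor E k :=
  LinearMap.toContinuousLinearMap
    { toFun := fun m => ContinuousMultilinearMap.compContinuousLinearMap
        (show ContinuousMultilinearMap ℝ (fun _ : Fin k => E →L[ℝ] ℝ) ℝ from m)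
        fun _ => (ContinuousLinearMap.compL ℝ E E ℝ).flip g
      map_add' := fun _ _ => rfl
      map_smul' := fun _ _ => rfl }

lemma act_apply (g : E →L[ℝ] E) (m : ContraTensor E k) (θ : Fin k → E →L[ℝ] ℝ) :
    act g m θ = m fun i => (θ i).comp g := rfl

lemma contDiff_act : ContDiff ℝ ∞ (act : (E →L[ℝ] E) → ContraTensor E k →L[ℝ] ContraTensor E k) := by
  refine contDiff_clm_apply_iff.2 fun m => contDiff_iff_contDiffAt.2 fun g => ?_
  refine ContMDiffAt.contDiffAt ?_
  refine contMDiffAt_of_separating evalL (fun _ h => ext h) fun θ => ContDiffAt.contMDiffAt ?_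
  exact (m.contDiff.comp (contDiff_pi.2 fun i =>
    ((ContinuousLinearMap.compL ℝ E E ℝ) (θ i)).contDiff)).contDiffAt

lemma act_one (m : ContraTensor E k) : act 1 m = m := by
  ext θ
  rw [act_apply]
  rfl

lemma act_mul (g h : E →L[ℝ] E) (m : ContraTensor E k) : act (g * h) m = act g (act h m) := by
  ext θ
  simp only [act_apply]
  rfl

lemma act_symm (g : E →L[ℝ] E) (m : ContraTensor E k) : act g (symm m) = symm (act g m) := by
  ext θ
  simp only [act_apply, symm_apply]

end ContraTensor

end ContraTensors

/-! ### The symbol is well defined, polynomial and smooth in the base point. -/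

section SymbolFamilies

variable {E : Type*} [NormedAddCommGroup E] [NormedSpace ℝ E] [FiniteDimensional ℝ E]
  {M : Type*} [TopologicalSpace M] [ChartedSpace E M] [IsManifold 𝓘(ℝ, E) ∞ M] [T2Space M]
  {k : ℕ} {A : C^∞⟮𝓘(ℝ, E), M; ℝ⟯ →ₗ[ℝ] C^∞⟮𝓘(ℝ, E), M; ℝ⟯}

lemma hasMFDerivAt_bumpMul {a b : M} (χ : SmoothBumpFunction 𝓘(ℝ, E) a) {g : E → ℝ}
    (hg : ContDiff ℝ ∞ g) (hb : b ∈ (chartAt E a).source)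
    (heq : bumpMul χ g hg =ᶠ[𝓝 b] fun b => g (extChartAt 𝓘(ℝ, E) a b)) :
    HasMFDerivAt 𝓘(ℝ, E) 𝓘(ℝ, ℝ) (bumpMul χ g hg) b
      ((fderiv ℝ g (extChartAt 𝓘(ℝ, E) a b)).comp
        (mfderiv 𝓘(ℝ, E) 𝓘(ℝ, E) (extChartAt 𝓘(ℝ, E) a) b)) := by
  refine HasMFDerivAt.congr_of_eventuallyEq ?_ heq
  have h1 : HasMFDerivAt 𝓘(ℝ, E) 𝓘(ℝ, ℝ) g (extChartAt 𝓘(ℝ, E) a b)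
      (fderiv ℝ g (extChartAt 𝓘(ℝ, E) a b)) :=
    (hg.differentiable (by simp) _).hasFDerivAt.hasMFDerivAt
  exact h1.comp b (mdifferentiableAt_extChartAt hb).hasMFDerivAt

lemma exists_hasMFDerivAt (a : M) (θ : E →L[ℝ] ℝ) : ∃ f : C^∞⟮𝓘(ℝ, E), M; ℝ⟯,
    f a = 0 ∧ HasMFDerivAt 𝓘(ℝ, E) 𝓘(ℝ, ℝ) f a θ := by
  obtain ⟨χ⟩ : Nonempty (SmoothBumpFunction 𝓘(ℝ, E) a) := inferInstance
  have hg : ContDiff ℝ ∞ fun x => θ (x - extChartAt 𝓘(ℝ, E) a a) :=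
    θ.contDiff.comp (contDiff_id.sub contDiff_const)
  refine ⟨bumpMul χ _ hg, by rw [bumpMul_apply, sub_self, map_zero, mul_zero], ?_⟩
  have h1 := hasMFDerivAt_bumpMul χ hg (mem_chart_source E a) (bumpMul_eventuallyEq χ hg)
  have h2 : fderiv ℝ (fun x => θ (x - extChartAt 𝓘(ℝ, E) a a)) (extChartAt 𝓘(ℝ, E) a a) = θ :=
    (θ.hasFDerivAt.comp _ ((hasFDerivAt_id (𝕜 := ℝ) _).sub_const _)).fderiv
  rw [h2, mfderiv_extChartAt_self] at h1
  exact h1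

/-- The symbol is defined through a chosen function. Two choices differ by an element of the square
of the vanishing ideal, so their `k`-th powers differ by an element of its power `k + 1`, which an
operator of order `k` kills at `a`. -/
lemma symbol_eq_of_eq_zero (hA : IsDiffOp k A) {a : M} {f : C^∞⟮𝓘(ℝ, E), M; ℝ⟯} (hf : f a = 0)
    {θ : E →L[ℝ] ℝ} (hfd : HasMFDerivAt 𝓘(ℝ, E) 𝓘(ℝ, ℝ) f a θ) :
    symbol k A a θ = A (f ^ k) a / (k.factorial : ℝ) := by
  obtain ⟨h0, hd⟩ := Classical.epsilon_spec (exists_hasMFDerivAt a θ)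
  simp only [symbol]
  congr 1
  rw [← sub_eq_zero]
  have hsub : HasMFDerivAt 𝓘(ℝ, E) 𝓘(ℝ, ℝ)
      (⇑((Classical.epsilon fun f : C^∞⟮𝓘(ℝ, E), M; ℝ⟯ =>
        f a = 0 ∧ HasMFDerivAt 𝓘(ℝ, E) 𝓘(ℝ, ℝ) f a θ) - f)) a (0 : E →L[ℝ] ℝ) := by
    exact (hd.sub hfd).congr_mfderiv (sub_self θ)
  have h1 := apply_eq_zero_of_mem_pow hA _ (pow_sub_pow_mem (I := vanishingIdealAt E a) h0 hf
    (mem_vanishingIdealAt_sq (by simp [h0, hf]) hsub) k)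
  rw [map_sub] at h1
  exact h1

lemma symbol_eq_iterComm (hA : IsDiffOp k A) {a : M} {f : C^∞⟮𝓘(ℝ, E), M; ℝ⟯}
    {θ : E →L[ℝ] ℝ} (hfd : HasMFDerivAt 𝓘(ℝ, E) 𝓘(ℝ, ℝ) f a θ) :
    symbol k A a θ = iterComm f k A 1 a / (k.factorial : ℝ) := by
  have hc : (f - algebraMap ℝ C^∞⟮𝓘(ℝ, E), M; ℝ⟯ (f a)) a = 0 := by
    change f a - f a = 0
    exact sub_self _
  rw [← iterComm_sub_algebraMap f (f a), iterComm_apply_of_eq_zero hc, mul_one]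
  refine symbol_eq_of_eq_zero hA hc ?_
  have h1 : HasMFDerivAt 𝓘(ℝ, E) 𝓘(ℝ, ℝ) (fun _ : M => f a) a (0 : E →L[ℝ] ℝ) :=
    hasMFDerivAt_const _ _
  exact (hfd.sub h1).congr_mfderiv (sub_zero θ)

/-- In a chart, the symbol is given by tensors depending smoothly on the point. -/
lemma exists_symbol_family (hA : IsDiffOp k A) (a : M) : ∃ m : M → ContraTensor E k,
    ContMDiffAt 𝓘(ℝ, E) 𝓘(ℝ, ContraTensor E k) ∞ m a ∧
    ∀ᶠ b in 𝓝 a, ∀ θ : E →L[ℝ] ℝ,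
      symbol k A b (θ.comp (mfderiv 𝓘(ℝ, E) 𝓘(ℝ, E) (extChartAt 𝓘(ℝ, E) a) b)) =
        m b fun _ => θ := by
  obtain ⟨χ⟩ : Nonempty (SmoothBumpFunction 𝓘(ℝ, E) a) := inferInstance
  -- One linear family of functions serves every `b` near `a`: where the bump function is `1`, the
  -- differential is `θ` composed with the derivative of the chart. The iterated commutators with
  -- this family are smooth functions, hence the smooth dependence on `b`.
  let L : (E →L[ℝ] ℝ) →ₗ[ℝ] C^∞⟮𝓘(ℝ, E), M; ℝ⟯ :=
    { toFun := fun θ => bumpMul χ θ θ.contDiff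
      map_add' := fun θ θ' => by
        ext b
        simp [bumpMul_apply, mul_add]
      map_smul' := fun c θ => by
        ext b
        simp [bumpMul_apply]
        ring }
  obtain ⟨mm, hmm⟩ := exists_multilinear_iterComm L k
  let ev : M → C^∞⟮𝓘(ℝ, E), M; ℝ⟯ →ₗ[ℝ] ℝ := fun b =>
    { toFun := fun f => f b
      map_add' := fun f g => rfl
      map_smul' := fun c f => rfl }
  let m : M → ContraTensor E k := fun b =>
    (k.factorial : ℝ)⁻¹ • (⟨(ev b).compMultilinearMap (mm A),
      MultilinearMap.continuous_of_finiteDimensional_domain _⟩ :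
        ContinuousMultilinearMap ℝ (fun _ : Fin k => E →L[ℝ] ℝ) ℝ)
  have hm : ∀ b v, m b v = (k.factorial : ℝ)⁻¹ * mm A v b := fun b v => rfl
  refine ⟨m, ?_, ?_⟩
  · refine ContraTensor.contMDiffAt_of_apply fun v => ?_
    simp only [hm]
    have h1 : ContMDiffAt 𝓘(ℝ, E) 𝓘(ℝ, ℝ) ∞ (mm A v) a := (mm A v).contMDiff.contMDiffAt
    exact (contDiff_const.mul contDiff_id : ContDiff ℝ ∞
      fun x : ℝ => (k.factorial : ℝ)⁻¹ * x).contMDiff.contMDiffAt.comp a h1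
  · filter_upwards [χ.eventuallyEq_one.eventually_nhds,
      (chartAt E a).open_source.mem_nhds (mem_chart_source E a)] with b hb hbs θ
    have h1 : bumpMul χ θ θ.contDiff =ᶠ[𝓝 b] fun b => θ (extChartAt 𝓘(ℝ, E) a b) := by
      filter_upwards [hb] with c hc
      simp [bumpMul_apply, hc]
    have h2 := hasMFDerivAt_bumpMul χ θ.contDiff hbs h1
    rw [ContinuousLinearMap.fderiv] at h2
    rw [symbol_eq_iterComm hA h2, hm, hmm, div_eq_inv_mul]
    rfl

end SymbolFamilies

/-! ### Fibred submanifolds and coordinates on `1`-jets. -/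

section SubmanifoldFibres

variable {W : Type*} [NormedAddCommGroup W] [NormedSpace ℝ W] [FiniteDimensional ℝ W]
  {B : Type*} [NormedAddCommGroup B] [NormedSpace ℝ B]
  {N : Type*} [NormedAddCommGroup N] [NormedSpace ℝ N]
  {S : Set W} {s : W} (e : W ≃ₗ[ℝ] B × N)

/-- A submanifold that is fibred over `B` has local smooth sections. -/
lemma IsSmoothSubmanifold.exists_section [FiniteDimensional ℝ B] (hS : IsSmoothSubmanifold S) (hs : s ∈ S)
    (hfib : ∀ u, ∃ v ∈ tangentVectors S s, (e v).1 = u) :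
    ∃ β : B → N, ContDiffAt ℝ ∞ β (e s).1 ∧ β (e s).1 = (e s).2 ∧
      ∀ᶠ b in 𝓝 (e s).1, e.symm (b, β b) ∈ S := by
  obtain ⟨V, F, hF, hF0, hFs, hFS⟩ := hS.exists_defining_map hs
  let p : W →L[ℝ] B := LinearMap.toContinuousLinearMap ((LinearMap.fst ℝ B N).comp e.toLinearMap)
  let r : W →L[ℝ] N := LinearMap.toContinuousLinearMap ((LinearMap.snd ℝ B N).comp e.toLinearMap)
  obtain ⟨β, hβ, hβ0, hβF⟩ := exists_local_section hF hF0 hFs p fun u => by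
    obtain ⟨v, hv, hvu⟩ := hfib u
    exact ⟨v, fderiv_eq_zero_of_mem_tangentVectors (hF.differentiableAt (by simp))
      (hFS.mono fun w hw => hw.1) hv, hvu⟩
  refine ⟨fun b => r (β b), r.contDiff.contDiffAt.comp _ hβ, congrArg r hβ0, ?_⟩
  have hβt : Tendsto β (𝓝 (p s)) (𝓝 s) := by
    simpa only [hβ0] using hβ.continuousAt.tendsto
  filter_upwards [hβF, hβt.eventually hFS] with b hb hbS
  have h1 : (b, r (β b)) = e (β b) := Prod.ext hb.2.symm rfl
  rw [h1, e.symm_apply_apply]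
  exact hbS.2 hb.1

/-- The fibres of a fibred submanifold are given by submersions. -/
lemma IsSmoothSubmanifold.exists_defining_map_fibre [FiniteDimensional ℝ N] (hS : IsSmoothSubmanifold S) (hs : s ∈ S)
    (hfib : ∀ u, ∃ v ∈ tangentVectors S s, (e v).1 = u) :
    ∃ (V : Submodule ℝ W) (F : N → V), ContDiffAt ℝ ∞ F (e s).2 ∧ F (e s).2 = 0 ∧
      Function.Surjective (fderiv ℝ F (e s).2) ∧
      ∀ᶠ g in 𝓝 (e s).2, e.symm ((e s).1, g) ∈ S ↔ F g = 0 := by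
  obtain ⟨V, F, hF, hF0, hFs, hFS⟩ := hS.exists_defining_map hs
  let i : N →L[ℝ] W := LinearMap.toContinuousLinearMap
    (e.symm.toLinearMap.comp (LinearMap.inr ℝ B N))
  let j : N → W := fun g => e.symm ((e s).1, 0) + i g
  have hj : ∀ g, j g = e.symm ((e s).1, g) := fun g => by
    change e.symm ((e s).1, 0) + e.symm (0, g) = _
    rw [← map_add]
    simp
  have hjs : j (e s).2 = s := by rw [hj]; simp
  have hjd : ∀ g, HasFDerivAt j i g := fun g => i.hasFDerivAt.const_add _
  have hjc : ContDiff ℝ ∞ j := contDiff_const.add i.contDiff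
  have hFd : HasFDerivAt (fun g => F (j g)) ((fderiv ℝ F s).comp i) (e s).2 := by
    refine HasFDerivAt.comp _ ?_ (hjd _)
    rw [hjs]
    exact (hF.differentiableAt (by simp)).hasFDerivAt
  refine ⟨V, fun g => F (j g), ?_, by simp only [hjs, hF0], ?_, ?_⟩
  · refine ContDiffAt.comp _ ?_ hjc.contDiffAt
    rwa [hjs]
  · rw [hFd.fderiv]
    intro v
    obtain ⟨w, rfl⟩ := hFs v
    -- Subtracting a tangent vector of `S` with the same base component makes `w` vertical without
    -- changing its image under the derivative of `F`.
    obtain ⟨t, ht, htu⟩ := hfib (e w).1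
    have ht0 := fderiv_eq_zero_of_mem_tangentVectors (hF.differentiableAt (by simp))
      (hFS.mono fun w hw => hw.1) ht
    refine ⟨(e (w - t)).2, ?_⟩
    have h1 : i (e (w - t)).2 = w - t := by
      change e.symm (0, (e (w - t)).2) = w - t
      rw [e.symm_apply_eq]
      exact Prod.ext (by simp [htu]) rfl
    rw [ContinuousLinearMap.comp_apply, h1, map_sub, ht0, sub_zero]
  · have hjt : Tendsto j (𝓝 (e s).2) (𝓝 s) := by
      simpa only [hjs] using hjc.continuous.tendsto (e s).2
    filter_upwards [hjt.eventually hFS] with g hg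
    rwa [← hj]

end SubmanifoldFibres

section JetCoordinates

variable {E : Type*} [NormedAddCommGroup E] [NormedSpace ℝ E]

variable (E) in
/-- The source, the target and the derivative of a `1`-jet. -/
def jetEquiv : JetSpace E 1 ≃ₗ[ℝ] (E × E) × (E →L[ℝ] E) where
  toFun w := ((w.1, (w.2 0) (fun _ => 0)), continuousMultilinearCurryFin1 ℝ E E (w.2 1))
  map_add' w w' := rfl
  map_smul' c w := rfl
  invFun u := (u.1.1, fun i => match i with
    | ⟨0, _⟩ => ContinuousMultilinearMap.constOfIsEmpty ℝ _ u.1.2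
    | ⟨1, _⟩ => (continuousMultilinearCurryFin1 ℝ E E).symm u.2)
  left_inv w := by
    refine Prod.ext rfl (funext fun i => ?_)
    match i with
    | ⟨0, _⟩ =>
      refine ContinuousMultilinearMap.ext fun v => ?_
      change (w.2 0) (fun _ => 0) = (w.2 0) v
      congr 1
      exact funext fun i => i.elim0
    | ⟨1, _⟩ => exact (continuousMultilinearCurryFin1 ℝ E E).symm_apply_apply (w.2 1)
  right_inv u := by
    refine Prod.ext rfl ?_
    exact (continuousMultilinearCurryFin1 ℝ E E).apply_symm_apply u.2

instance [FiniteDimensional ℝ E] : FiniteDimensional ℝ (JetSpace E 1) :=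
  (jetEquiv E).symm.finiteDimensional

variable {M : Type*} [TopologicalSpace M] [ChartedSpace E M]

lemma jetEquiv_jetAt (p q : M) (φ : OpenPartialHomeomorph M M) {x : M}
    (hx : x ∈ (chartAt E p).source) :
    jetEquiv E (jetAt 1 p q φ x) = ((chartAt E p x, chartAt E q (φ x)),
      fderiv ℝ (fun u => chartAt E q (φ ((chartAt E p).symm u))) (chartAt E p x)) := by
  refine Prod.ext (Prod.ext rfl ?_) ?_
  · change iteratedFDeriv ℝ 0 _ _ _ = _
    rw [iteratedFDeriv_zero_apply, (chartAt E p).left_inv hx]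
  · ext v
    change iteratedFDeriv ℝ 1 _ _ _ = _
    rw [iteratedFDeriv_one_apply]
    rfl

lemma jetSet_zero {Γ : StructureGroupoid M} (htrans : IsTransitivePseudogroup Γ) (p q : M)
    (j : JetSpace E 0) : j ∈ jetSet (E := E) Γ.members 0 p q ↔
      j.1 ∈ (chartAt E p).target ∧ (j.2 0) (fun _ => 0) ∈ (chartAt E q).target := by
  constructor
  · rintro ⟨φ, -, x, -, hp, hq, rfl⟩
    refine ⟨(chartAt E p).map_source hp, ?_⟩
    change iteratedFDeriv ℝ 0 _ _ _ ∈ _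
    rw [iteratedFDeriv_zero_apply, (chartAt E p).left_inv hp]
    exact (chartAt E q).map_source hq
  · rintro ⟨hp, hq⟩
    obtain ⟨φ, hφ, hs, hφs⟩ := htrans ((chartAt E p).symm j.1)
      ((chartAt E q).symm ((j.2 0) (fun _ => 0)))
    refine ⟨φ, hφ, _, hs, (chartAt E p).map_target hp, ?_, ?_⟩
    · rw [hφs]
      exact (chartAt E q).map_target hq
    · refine Prod.ext ((chartAt E p).right_inv hp).symm (funext fun i => ?_)
      obtain rfl : i = 0 := Fin.ext (Nat.lt_one_iff.1 i.2)
      refine ContinuousMultilinearMap.ext fun v => ?_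
      change _ = iteratedFDeriv ℝ 0 _ _ _
      rw [iteratedFDeriv_zero_apply, (chartAt E p).right_inv hp, hφs, (chartAt E q).right_inv hq]
      congr 1
      exact funext fun i => i.elim0

/-- By transitivity the `0`-jets fill the whole product of the chart targets, so every vector is
tangent there. The bottom level of the tower then shows that `G₁` is submersive over source and
target jointly. -/
lemma IsLiePseudogroup.exists_tangentVector {Γ : StructureGroupoid M}
    (hΓ : IsLiePseudogroup E Γ) (htrans : IsTransitivePseudogroup Γ) {p q : M} {j : JetSpace E 1}
    (hj : j ∈ jetSet (E := E) Γ.members 1 p q) (u : E × E) :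
    ∃ v ∈ tangentVectors (jetSet (E := E) Γ.members 1 p q) j, (jetEquiv E v).1 = u := by
  let w : JetSpace E 0 := (u.1, fun i => match i with
    | ⟨0, _⟩ => ContinuousMultilinearMap.constOfIsEmpty ℝ _ u.2)
  have hw : w ∈ tangentVectors (jetSet (E := E) Γ.members 0 p q) (jetTruncate j) := by
    refine ⟨fun t => jetTruncate j + t • w, contDiff_const.add (contDiff_id.smul contDiff_const),
      by simp, ?_, ?_⟩
    · have h0 : j.1 ∈ (chartAt E p).target ∧ (j.2 0) (fun _ => 0) ∈ (chartAt E q).target := by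
        obtain ⟨φ, hφ, x, hx, hp, hq, rfl⟩ := hj
        exact (jetSet_zero htrans p q (jetAt 0 p q φ x)).1 ⟨φ, hφ, x, hx, hp, hq, rfl⟩
      have h1 : Tendsto (fun t : ℝ => j.1 + t • u.1) (𝓝 0) (𝓝 j.1) :=
        (by fun_prop : Continuous fun t : ℝ => j.1 + t • u.1).tendsto' _ _ (by simp)
      have h2 : Tendsto (fun t : ℝ => (j.2 0) (fun _ => 0) + t • u.2) (𝓝 0)
          (𝓝 ((j.2 0) (fun _ => 0))) :=
        (by fun_prop : Continuous fun t : ℝ => (j.2 0) (fun _ => 0) + t • u.2).tendsto' _ _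
          (by simp)
      filter_upwards [h1.eventually ((chartAt E p).open_target.mem_nhds h0.1),
        h2.eventually ((chartAt E q).open_target.mem_nhds h0.2)] with t h3 h4
      exact (jetSet_zero htrans p q _).2 ⟨h3, h4⟩
    · have h1 : HasDerivAt (fun t : ℝ => jetTruncate j + t • w) ((1 : ℝ) • w) 0 :=
        ((hasDerivAt_id (0 : ℝ)).smul_const w).const_add _
      rw [h1.deriv, one_smul]
  obtain ⟨v, hv, hvw⟩ := hΓ.tower 0 p q j hj w hw
  have h1 : v.1 = u.1 := congrArg (fun z : JetSpace E 0 => z.1) hvw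
  have h2 : (v.2 0) (fun _ => 0) = u.2 :=
    congrArg (fun z : JetSpace E 0 => (z.2 0) (fun _ => 0)) hvw
  exact ⟨v, hv, Prod.ext h1 h2⟩

end JetCoordinates

/-! ### The groupoid of linear jets of `Γ`. -/

section LinearJets

variable {E : Type*} [NormedAddCommGroup E] [NormedSpace ℝ E]
  {M : Type*} [TopologicalSpace M] [ChartedSpace E M]

/-- `G₁(a, b)`, with the tangent spaces identified with the model space. -/
def isoJets (Γ : StructureGroupoid M) (a b : M) : Set (E →L[ℝ] E) :=
  linearJets E Γ a b

/-- The derivative at `b` of the chart around `a`. -/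
def chartDeriv (a b : M) : E →L[ℝ] E :=
  mfderiv 𝓘(ℝ, E) 𝓘(ℝ, E) (extChartAt 𝓘(ℝ, E) a) b

variable {Γ : StructureGroupoid M} {a b c : M} {f g : E →L[ℝ] E}

lemma isoJets_id (a : M) : ContinuousLinearMap.id ℝ E ∈ isoJets Γ a a :=
  ⟨OpenPartialHomeomorph.refl M, Γ.id_mem, mem_univ _, rfl, hasMFDerivAt_id a⟩

lemma isoJets_comp (hg : g ∈ isoJets Γ b c) (hf : f ∈ isoJets Γ a b) :
    g.comp f ∈ isoJets Γ a c := by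
  obtain ⟨φ, hφ, ha, rfl, hd⟩ := hf
  obtain ⟨ψ, hψ, hb, rfl, hd'⟩ := hg
  refine ⟨φ.trans ψ, Γ.trans hφ hψ, ?_, rfl, HasMFDerivAt.comp (g := ψ) a hd' hd⟩
  rw [OpenPartialHomeomorph.trans_source]
  exact ⟨ha, hb⟩

lemma isoJets_inv [IsManifold 𝓘(ℝ, E) ∞ M] (hΓ : IsLiePseudogroup E Γ) (hg : g ∈ isoJets Γ a b) :
    ∃ h ∈ isoJets Γ b a, h.comp g = ContinuousLinearMap.id ℝ E ∧
      g.comp h = ContinuousLinearMap.id ℝ E := by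
  obtain ⟨φ, hφ, ha, rfl, hd⟩ := hg
  have hb : φ a ∈ φ.target := φ.map_source ha
  have h1 : MDifferentiableAt 𝓘(ℝ, E) 𝓘(ℝ, E) φ.symm (φ a) :=
    (((hΓ.smooth φ hφ).2 _ hb).contMDiffAt (φ.open_target.mem_nhds hb)).mdifferentiableAt (by simp)
  have h2 := h1.hasMFDerivAt
  have h3 : HasMFDerivAt 𝓘(ℝ, E) 𝓘(ℝ, E) φ.symm (φ a)
    (mfderiv 𝓘(ℝ, E) 𝓘(ℝ, E) φ.symm (φ a) : E →L[ℝ] E) := h2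
  refine ⟨mfderiv 𝓘(ℝ, E) 𝓘(ℝ, E) φ.symm (φ a), ⟨φ.symm, Γ.symm hφ, hb, φ.left_inv ha, h2⟩, ?_, ?_⟩
  · have h4 := HasMFDerivAt.comp a h3 hd
    exact hasMFDerivAt_unique h4 ((hasMFDerivAt_id a).congr_of_eventuallyEq
      (by filter_upwards [φ.open_source.mem_nhds ha] with x hx using φ.left_inv hx))
  · have hd' : HasMFDerivAt 𝓘(ℝ, E) 𝓘(ℝ, E) φ (φ.symm (φ a)) g := by rwa [φ.left_inv ha]
    have h4 := HasMFDerivAt.comp (φ a) hd' h3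
    exact hasMFDerivAt_unique h4 ((hasMFDerivAt_id (φ a)).congr_of_eventuallyEq
      (by filter_upwards [φ.open_target.mem_nhds hb] with x hx using φ.right_inv hx))

lemma chartDeriv_self (a : M) : chartDeriv (E := E) a a = ContinuousLinearMap.id ℝ E := by
  have h : HasMFDerivAt 𝓘(ℝ, E) 𝓘(ℝ, E) (extChartAt 𝓘(ℝ, E) a) a (ContinuousLinearMap.id ℝ E) := by
    refine ⟨continuousAt_extChartAt a, ?_⟩
    have h1 : HasFDerivWithinAt (id : E → E) (ContinuousLinearMap.id ℝ E) (range 𝓘(ℝ, E))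
      (extChartAt 𝓘(ℝ, E) a a) := hasFDerivWithinAt_id _ _
    refine h1.congr_of_eventuallyEq ?_ ?_
    · filter_upwards [extChartAt_target_mem_nhdsWithin (I := 𝓘(ℝ, E)) a] with u hu
      exact (extChartAt 𝓘(ℝ, E) a).right_inv hu
    · exact (extChartAt 𝓘(ℝ, E) a).right_inv ((extChartAt 𝓘(ℝ, E) a).map_source
        (mem_extChartAt_source a))
  exact h.mfderiv

variable [IsManifold 𝓘(ℝ, E) ∞ M]

lemma hasMFDerivAt_extChartAt_chartDeriv (hb : b ∈ (chartAt E a).source) :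
    HasMFDerivAt 𝓘(ℝ, E) 𝓘(ℝ, E) (extChartAt 𝓘(ℝ, E) a) b (chartDeriv a b : E →L[ℝ] E) :=
  (mdifferentiableAt_extChartAt hb).hasMFDerivAt

lemma chartDeriv_isInvertible (hb : b ∈ (chartAt E a).source) :
    (chartDeriv (E := E) a b).IsInvertible :=
  isInvertible_mfderiv_extChartAt (by simpa using hb)

lemma chartDeriv_injective (hb : b ∈ (chartAt E a).source)
    (h : (chartDeriv a b).comp f = (chartDeriv a b).comp g) : f = g := by
  obtain ⟨D, hD⟩ := chartDeriv_isInvertible hb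
  rw [← hD] at h
  ext v
  exact D.injective (DFunLike.congr_fun h v)

/-- The tangent space at `b` is identified with `E` by the preferred chart at `b`, which may jump as
`b` moves. Composing with `chartDeriv a b` passes to the fixed chart around `a`, where smoothness in
`b` makes sense. -/
lemma mem_isoJets_iff_jet (hΓ : IsLiePseudogroup E Γ) {o : M} (hb : b ∈ (chartAt E a).source) :
    g ∈ isoJets Γ o b ↔ (jetEquiv E).symm ((chartAt E o o, chartAt E a b),
      (chartDeriv a b).comp g) ∈ jetSet (E := E) Γ.members 1 o a := by
  have key : ∀ (φ : OpenPartialHomeomorph M M) (g : E →L[ℝ] E), φ o = b →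
      HasMFDerivAt 𝓘(ℝ, E) 𝓘(ℝ, E) φ o g → jetEquiv E (jetAt 1 o a φ o) =
        ((chartAt E o o, chartAt E a b), (chartDeriv a b).comp g) := by
    rintro φ g rfl hd
    rw [jetEquiv_jetAt _ _ _ (mem_chart_source E o)]
    have h1 := (HasMFDerivAt.comp o (hasMFDerivAt_extChartAt_chartDeriv hb)
      hd).hasFDerivAt_comp_extChartAt_symm
    exact Prod.ext rfl h1.fderiv
  constructor
  · rintro ⟨φ, hφ, ho, hφo, hd⟩
    rw [← key φ g hφo hd, LinearEquiv.symm_apply_apply]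
    exact ⟨φ, hφ, o, ho, mem_chart_source E o, by rwa [hφo], rfl⟩
  · rintro ⟨φ, hφ, x, hx, hxo, hφx, hj⟩
    rw [LinearEquiv.symm_apply_eq] at hj
    have hj' := hj
    rw [jetEquiv_jetAt _ _ _ hxo] at hj'
    have h1 := congrArg (fun z => z.1.1) hj'
    have h2 := congrArg (fun z => z.1.2) hj'
    obtain rfl : o = x := (chartAt E o).injOn (mem_chart_source E o) hxo h1
    have h3 : φ o = b := (chartAt E a).injOn hφx hb h2.symm
    have h4 : MDifferentiableAt 𝓘(ℝ, E) 𝓘(ℝ, E) φ o :=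
      (((hΓ.smooth φ hφ).1 _ hx).contMDiffAt (φ.open_source.mem_nhds hx)).mdifferentiableAt
        (by simp)
    have h5 := key φ _ h3 h4.hasMFDerivAt
    have h6 : g = mfderiv 𝓘(ℝ, E) 𝓘(ℝ, E) φ o :=
      chartDeriv_injective hb (congrArg Prod.snd (hj.trans h5))
    refine ⟨φ, hφ, hx, h3, ?_⟩
    rw [h6]
    exact h4.hasMFDerivAt

/-- The linear isotropy group is a group, defined near the identity by a submersion. -/
lemma IsLiePseudogroup.exists_isSubmersiveGroup [FiniteDimensional ℝ E]
    (hΓ : IsLiePseudogroup E Γ) (htrans : IsTransitivePseudogroup Γ) (o : M) :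
    ∃ (V : Submodule ℝ (JetSpace E 1)) (F : (E →L[ℝ] E) → V),
      IsSubmersiveGroup (isoJets Γ o o) F := by
  have hj : ∀ g : E →L[ℝ] E, g ∈ isoJets Γ o o ↔ (jetEquiv E).symm ((chartAt E o o, chartAt E o o),
      g) ∈ jetSet (E := E) Γ.members 1 o o := fun g => by
    rw [mem_isoJets_iff_jet hΓ (mem_chart_source E o), chartDeriv_self, ContinuousLinearMap.id_comp]
  have h1 := (hj _).1 (isoJets_id o)
  obtain ⟨V, F, hF, hF0, hFs, hFm⟩ :=
    (hΓ.submanifold 1 le_rfl o o).exists_defining_map_fibre (jetEquiv E) h1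
      (hΓ.exists_tangentVector htrans h1)
  rw [LinearEquiv.apply_symm_apply] at hF hF0 hFs hFm
  exact ⟨V, F, isoJets_id o, fun g hg h hh => isoJets_comp hg hh, fun g hg => by
    obtain ⟨h, hh, h2, h3⟩ := isoJets_inv hΓ hg
    exact ⟨h, hh, h3, h2⟩, hF, hF0, hFs, hFm.mono fun g hg => (hj g).trans hg⟩

/-- The bundle of linear jets with source `o` has local smooth sections. -/
lemma IsLiePseudogroup.exists_isoJets_section [FiniteDimensional ℝ E]
    (hΓ : IsLiePseudogroup E Γ) (htrans : IsTransitivePseudogroup Γ) {o : M}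
    (hg : g ∈ isoJets Γ o a) :
    ∃ β : E → (E →L[ℝ] E), ContDiffAt ℝ ∞ β (chartAt E a a) ∧ β (chartAt E a a) = g ∧
      ∀ᶠ b in 𝓝 a, ∃ s ∈ isoJets Γ o b, (chartDeriv a b).comp s = β (chartAt E a b) := by
  have h1 := (mem_isoJets_iff_jet hΓ (mem_chart_source E a)).1 hg
  rw [chartDeriv_self, ContinuousLinearMap.id_comp] at h1
  obtain ⟨β, hβ, hβ0, hβS⟩ :=
    (hΓ.submanifold 1 le_rfl o a).exists_section (jetEquiv E) h1
      (hΓ.exists_tangentVector htrans h1)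
  rw [LinearEquiv.apply_symm_apply] at hβ hβ0 hβS
  have hβ' : ContDiffAt ℝ ∞ β (chartAt E o o, chartAt E a a) := hβ
  refine ⟨fun y => β (chartAt E o o, y), ContDiffAt.comp (f := fun y => (chartAt E o o, y)) _ hβ'
    (contDiffAt_const.prodMk contDiffAt_id), hβ0, ?_⟩
  have h2 : Tendsto (fun b => (chartAt E o o, chartAt E a b)) (𝓝 a)
      (𝓝 (chartAt E o o, chartAt E a a)) :=
    tendsto_const_nhds.prodMk_nhds ((chartAt E a).continuousAt (mem_chart_source E a)).tendsto
  filter_upwards [h2.eventually hβS, (chartAt E a).open_source.mem_nhds (mem_chart_source E a)]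
    with b hb hbs
  obtain ⟨D, hD⟩ := chartDeriv_isInvertible hbs
  have h3 : (chartDeriv a b).comp ((D.symm : E →L[ℝ] E).comp (β (chartAt E o o, chartAt E a b))) =
      β (chartAt E o o, chartAt E a b) := by
    rw [← hD]
    ext v
    simp
  refine ⟨_, (mem_isoJets_iff_jet hΓ hbs).2 ?_, h3⟩
  rwa [h3]

end LinearJets

/-! ### Linear jets preserving the symbol, and the infinitesimal stabilizer. -/

section SymbolJets

namespace ContraTensor

variable {E : Type*} [NormedAddCommGroup E] [NormedSpace ℝ E] [FiniteDimensional ℝ E] {k : ℕ}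
  {m m' : ContraTensor E k}

/-- Symmetric tensors are determined by the associated polynomials. -/
lemma eq_of_diag (hm : symm m = m) (hm' : symm m' = m')
    (h : ∀ θ, (m fun _ => θ) = m' fun _ => θ) : m = m' := by
  rw [← hm, ← hm', symm_congr h]

lemma symm_symm (m : ContraTensor E k) : symm (symm m) = symm m :=
  symm_congr fun θ => symm_diag m θ

lemma symm_act (g : E →L[ℝ] E) (hm : symm m = m) : symm (act g m) = act g m := by
  rw [← act_symm, hm]

end ContraTensor

variable {E : Type*} [NormedAddCommGroup E] [NormedSpace ℝ E]
  {M : Type*} [TopologicalSpace M] [ChartedSpace E M]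
  {k : ℕ} {A : C^∞⟮𝓘(ℝ, E), M; ℝ⟯ →ₗ[ℝ] C^∞⟮𝓘(ℝ, E), M; ℝ⟯}

variable (k A) in
/-- The symbol of `A`, with the cotangent spaces identified with the dual of the model space. -/
def symbolFun (b : M) : (E →L[ℝ] ℝ) → ℝ :=
  symbol k A b

lemma exists_symbolTensor [FiniteDimensional ℝ E] [IsManifold 𝓘(ℝ, E) ∞ M] [T2Space M]
    (hA : IsDiffOp k A) (a : M) : ∃ σ : ContraTensor E k,
      ContraTensor.symm σ = σ ∧ ∀ θ, symbolFun k A a θ = σ fun _ => θ := by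
  obtain ⟨m, -, hm⟩ := exists_symbol_family hA a
  refine ⟨ContraTensor.symm (m a), ContraTensor.symm_symm _, fun θ => ?_⟩
  rw [ContraTensor.symm_diag, ← hm.self_of_nhds θ]
  change symbolFun k A a θ = symbolFun k A a (θ.comp (chartDeriv a a))
  rw [chartDeriv_self, ContinuousLinearMap.comp_id]

variable (Γ : StructureGroupoid M)

variable (k A) in
/-- The elements of `G₁(a, b)` that preserve the symbol of `A`. -/
def symbolJets (a b : M) : Set (E →L[ℝ] E) :=
  {T ∈ isoJets Γ a b | ∀ θ : E →L[ℝ] ℝ, symbolFun k A a (θ.comp T) = symbolFun k A b θ}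

variable {Γ} {a b c : M} {f g : E →L[ℝ] E}

lemma symbolJets_id (a : M) : ContinuousLinearMap.id ℝ E ∈ symbolJets k A Γ a a :=
  ⟨isoJets_id a, fun θ => by rw [ContinuousLinearMap.comp_id]⟩

lemma symbolJets_comp (hg : g ∈ symbolJets k A Γ b c) (hf : f ∈ symbolJets k A Γ a b) :
    g.comp f ∈ symbolJets k A Γ a c :=
  ⟨isoJets_comp hg.1 hf.1, fun θ => by
    rw [← hg.2 θ, ← hf.2, ContinuousLinearMap.comp_assoc]⟩

lemma symbolJets_inv [IsManifold 𝓘(ℝ, E) ∞ M] (hΓ : IsLiePseudogroup E Γ)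
    (hg : g ∈ symbolJets k A Γ a b) :
    ∃ h ∈ symbolJets k A Γ b a, h.comp g = ContinuousLinearMap.id ℝ E ∧
      g.comp h = ContinuousLinearMap.id ℝ E := by
  obtain ⟨h, hh, h1, h2⟩ := isoJets_inv hΓ hg.1
  exact ⟨h, ⟨hh, fun θ => by
    rw [← hg.2 (θ.comp h), ContinuousLinearMap.comp_assoc, h1, ContinuousLinearMap.comp_id]⟩, h1, h2⟩

/-- An operator of constant type has equivalent symbols at all points. -/
lemma symbolJets_nonempty [IsManifold 𝓘(ℝ, E) ∞ M] (hΓ : IsLiePseudogroup E Γ)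
    (htrans : IsTransitivePseudogroup Γ)
    (htype : HasConstantType Γ k A) (a b : M) : (symbolJets k A Γ a b).Nonempty := by
  obtain ⟨φ, hφ, ha, rfl⟩ := htrans a b
  have hd : HasMFDerivAt 𝓘(ℝ, E) 𝓘(ℝ, E) φ a (mfderiv 𝓘(ℝ, E) 𝓘(ℝ, E) φ a) :=
    ((((hΓ.smooth φ hφ).1 _ ha).contMDiffAt (φ.open_source.mem_nhds ha)).mdifferentiableAt
      (by simp)).hasMFDerivAt
  have hg : mfderiv 𝓘(ℝ, E) 𝓘(ℝ, E) φ a ∈ linearJets E Γ a (φ a) := ⟨φ, hφ, ha, rfl, hd⟩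
  have h1 : symbol k A (φ a) ∈ symbolOrbit Γ k A (φ a) := ⟨_, isoJets_id (φ a), rfl⟩
  rw [← htype a (φ a) _ hg] at h1
  obtain ⟨s, ⟨h, hh, rfl⟩, hs⟩ := h1
  exact ⟨_, isoJets_comp hg hh, fun θ => congrFun hs θ⟩

variable [FiniteDimensional ℝ E] {σ : ContraTensor E k}

/-- By polarization, fixing the polynomial amounts to fixing the symmetric tensor, so the stabilizer
can be studied in a finite-dimensional representation. -/
lemma mem_symbolJets_self_iff (hσs : ContraTensor.symm σ = σ)
    (hσ : ∀ θ, symbolFun k A a θ = σ fun _ => θ) :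
    g ∈ symbolJets k A Γ a a ↔ g ∈ isoJets Γ a a ∧ ContraTensor.act g σ = σ := by
  refine and_congr_right fun _ => ⟨fun h => ?_, fun h θ => ?_⟩
  · refine ContraTensor.eq_of_diag (ContraTensor.symm_act g hσs) hσs fun θ => ?_
    rw [ContraTensor.act_apply, ← hσ, ← hσ, h]
  · rw [hσ, hσ, ← ContraTensor.act_apply g σ fun _ => θ, h]

/-- Exponentials realize every kernel vector as a velocity. In particular the tangent vectors form a
subspace, and `Set.finrank`, the dimension of a span, is its actual dimension. -/
lemma isotropyTangent_eq_ker {V : Type*} [NormedAddCommGroup V] [NormedSpace ℝ V]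
    [FiniteDimensional ℝ V] {F : (E →L[ℝ] E) → V} (hG : IsSubmersiveGroup (isoJets Γ a a) F) :
    isotropyTangent Γ a = ((fderiv ℝ F 1).ker : Set (E →L[ℝ] E)) := by
  ext X
  constructor
  · intro hX
    exact fderiv_eq_zero_of_mem_tangentVectors (hG.contDiffAt.differentiableAt (by simp))
      (hG.mem_iff.mono fun w hw => hw.1) hX
  · intro hX
    have := FiniteDimensional.complete ℝ E
    refine ⟨fun t => NormedSpace.exp (t • X), ?_, ?_, hG.eventually_exp_mem hX, ?_⟩
    · have h1 : ContDiff ℝ ∞ (NormedSpace.exp : (E →L[ℝ] E) → E →L[ℝ] E) :=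
        contDiff_iff_contDiffAt.2 fun x => (NormedSpace.exp_analytic (𝕂 := ℝ) x).contDiffAt
      exact h1.comp (contDiff_id.smul contDiff_const)
    · change NormedSpace.exp ((0 : ℝ) • X) = 1
      rw [zero_smul, NormedSpace.exp_zero]
    · rw [(hasDerivAt_exp_smul_const X (0 : ℝ)).deriv, zero_smul, NormedSpace.exp_zero, one_mul]

/-- The infinitesimal action of the linear isotropy algebra on the symbol is injective. -/
lemma IsSubmersiveGroup.eq_zero_of_stabilizer {V : Type*} [NormedAddCommGroup V] [NormedSpace ℝ V]
    [FiniteDimensional ℝ V] {F : (E →L[ℝ] E) → V} (hG : IsSubmersiveGroup (isoJets Γ a a) F)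
    (hσs : ContraTensor.symm σ = σ) (hσ : ∀ θ, symbolFun k A a θ = σ fun _ => θ)
    (hstab : (symbolStabilizer Γ k A a).Finite ∨ OrbitHasFullDim Γ k A a)
    {X : E →L[ℝ] E} (hX : fderiv ℝ F 1 X = 0)
    (hX' : fderiv ℝ (ContraTensor.act : (E →L[ℝ] E) → ContraTensor E k →L[ℝ] _) 1 X σ = 0) :
    X = 0 := by
  rcases hstab with hfin | hdim
  · refine hG.eq_zero_of_finite_stabilizer ContraTensor.contDiff_act ContraTensor.act_one
      ContraTensor.act_mul (σ := σ) ?_ hX hX'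
    refine Set.Finite.subset hfin fun g hg => ?_
    have h1 := (mem_symbolJets_self_iff (k := k) (A := A) hσs hσ).2 hg
    exact ⟨h1.1, funext h1.2⟩
  · let D : (E →L[ℝ] E) →ₗ[ℝ] ((E →L[ℝ] ℝ) → ℝ) :=
      { toFun := fun X θ => fderiv ℝ (ContraTensor.act : (E →L[ℝ] E) → ContraTensor E k →L[ℝ] _)
          1 X σ fun _ => θ
        map_add' := fun X Y => by
          funext θ
          rw [map_add]
          rfl
        map_smul' := fun c X => by
          funext θ
          rw [map_smul]
          rfl }
    have hD : ∀ (c : ℝ → (E →L[ℝ] E)), ContDiff ℝ ∞ c → c 0 = ContinuousLinearMap.id ℝ E →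
        ∀ θ : E →L[ℝ] ℝ,
        deriv (fun t => symbolFun k A a (θ.comp (c t))) 0 = D (deriv c 0) θ := by
      intro c hc hc0 θ
      have h1 : HasDerivAt (fun t => ContraTensor.act (k := k) (c t))
          (fderiv ℝ (ContraTensor.act : (E →L[ℝ] E) → ContraTensor E k →L[ℝ] _) 1 (deriv c 0)) 0 := by
        have h0 : HasFDerivAt (ContraTensor.act : (E →L[ℝ] E) → ContraTensor E k →L[ℝ] _)
            (fderiv ℝ ContraTensor.act 1) (c 0) := by
          rw [hc0]
          exact (ContraTensor.contDiff_act.differentiable (by simp) _).hasFDerivAt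
        exact h0.comp_hasDerivAt (0 : ℝ) (hc.differentiable (by simp) 0).hasDerivAt
      have h2 := (ContraTensor.evalL fun _ : Fin k => θ).hasFDerivAt.comp_hasDerivAt (0 : ℝ)
        (((ContinuousLinearMap.apply ℝ (ContraTensor E k) σ)).hasFDerivAt.comp_hasDerivAt
          (0 : ℝ) h1)
      refine (h2.congr_of_eventuallyEq (Eventually.of_forall fun t => ?_)).deriv
      exact hσ _
    -- The orbit's tangent space is the image of the Lie algebra under the infinitesimal action `D`,
    -- so equality of dimensions and rank–nullity leave `D` no kernel there.
    have hO : orbitTangent Γ k A a = ((fderiv ℝ F 1).ker.map D : Set ((E →L[ℝ] ℝ) → ℝ)) := by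
      ext s
      constructor
      · rintro ⟨c, hc, hc0, hcG, rfl⟩
        refine ⟨deriv c 0, ?_, funext fun θ => (hD c hc hc0 θ).symm⟩
        rw [← isotropyTangent_eq_ker hG]
        exact ⟨c, hc, hc0, hcG, rfl⟩
      · rintro ⟨X, hX, rfl⟩
        rw [← isotropyTangent_eq_ker hG] at hX
        obtain ⟨c, hc, hc0, hcG, rfl⟩ := hX
        exact ⟨c, hc, hc0, hcG, funext fun θ => (hD c hc hc0 θ).symm⟩
    have h1 : Module.finrank ℝ ((fderiv ℝ F 1).ker.map D) =
        Module.finrank ℝ (fderiv ℝ F 1).ker := by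
      have h2 : Set.finrank ℝ ((fderiv ℝ F 1).ker.map D : Set ((E →L[ℝ] ℝ) → ℝ)) =
          Set.finrank ℝ ((fderiv ℝ F 1).ker : Set (E →L[ℝ] E)) := by
        rw [← isotropyTangent_eq_ker hG, ← hO]
        exact hdim
      rwa [Set.finrank, Set.finrank, Submodule.span_eq, Submodule.span_eq] at h2
    have h3 := LinearMap.finrank_range_add_finrank_ker (D.domRestrict (fderiv ℝ F 1).ker)
    rw [LinearMap.range_domRestrict, h1] at h3
    have h4 : (D.domRestrict (fderiv ℝ F 1).ker).ker = ⊥ :=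
      Submodule.finrank_eq_zero.1 (by omega)
    have h5 := LinearMap.ker_eq_bot'.1 h4 ⟨X, hX⟩ (by
      funext θ
      change fderiv ℝ ContraTensor.act 1 X σ (fun _ => θ) = 0
      rw [hX']
      rfl)
    exact congrArg Subtype.val h5

end SymbolJets

/-! ### The symbol-preserving jets form a flat groupoid. -/

section FlatGroupoids

variable {E : Type*} [NormedAddCommGroup E] [NormedSpace ℝ E]
  {M : Type*} [TopologicalSpace M] [ChartedSpace E M]

/-- A groupoid of linear isomorphisms between tangent spaces, with discrete isotropy
groups and with smooth local sections through all of its elements. -/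
structure IsFlatGroupoid (P : M → M → Set (E →L[ℝ] E)) : Prop where
  id_mem : ∀ a, ContinuousLinearMap.id ℝ E ∈ P a a
  comp_mem : ∀ {a b c g f}, g ∈ P b c → f ∈ P a b → g.comp f ∈ P a c
  exists_inv : ∀ {a b g}, g ∈ P a b → ∃ h ∈ P b a, h.comp g = ContinuousLinearMap.id ℝ E ∧
    g.comp h = ContinuousLinearMap.id ℝ E
  eventually_eq_id : ∀ a, ∀ᶠ g in 𝓝 (ContinuousLinearMap.id ℝ E), g ∈ P a a →
    g = ContinuousLinearMap.id ℝ E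
  exists_section : ∀ {o a T}, T ∈ P o a → ∃ β : E → (E →L[ℝ] E),
    ContDiffAt ℝ ∞ β (chartAt E a a) ∧ β (chartAt E a a) = T ∧
      ∀ᶠ b in 𝓝 a, ∃ s ∈ P o b, (chartDeriv a b).comp s = β (chartAt E a b)

variable [FiniteDimensional ℝ E] [IsManifold 𝓘(ℝ, E) ∞ M] [T2Space M]
  {k : ℕ} {A : C^∞⟮𝓘(ℝ, E), M; ℝ⟯ →ₗ[ℝ] C^∞⟮𝓘(ℝ, E), M; ℝ⟯} {Γ : StructureGroupoid M}

/-- The linear jets preserving the symbol of an operator of constant type, if the infinitesimal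
stabilizers vanish. -/
theorem isFlatGroupoid_symbolJets (hΓ : IsLiePseudogroup E Γ)
    (htrans : IsTransitivePseudogroup Γ) (hA : IsDiffOp k A) (htype : HasConstantType Γ k A)
    (hstab : ∀ a : M, (symbolStabilizer Γ k A a).Finite ∨ OrbitHasFullDim Γ k A a) :
    IsFlatGroupoid (symbolJets k A Γ) where
  id_mem := symbolJets_id
  comp_mem := symbolJets_comp
  exists_inv := symbolJets_inv hΓ
  eventually_eq_id o := by
    obtain ⟨σ, hσs, hσ⟩ := exists_symbolTensor hA o
    obtain ⟨V, F, hG⟩ := hΓ.exists_isSubmersiveGroup htrans o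
    filter_upwards [(IsSubmersiveGroup.exists_slice.{_, _, _, 0} hG ContraTensor.contDiff_act ContraTensor.act_one
      ContraTensor.act_mul (σ := σ) fun X =>
        hG.eq_zero_of_stabilizer hσs hσ (hstab o)).1] with g hg hgP
    have h1 := (mem_symbolJets_self_iff hσs hσ).1 hgP
    exact hg h1.1 h1.2
  exists_section {o a T} hT := by
    obtain ⟨σ, hσs, hσ⟩ := exists_symbolTensor hA o
    obtain ⟨V, F, hG⟩ := hΓ.exists_isSubmersiveGroup htrans o
    obtain ⟨β, hβ, hβT, hβs⟩ := hΓ.exists_isoJets_section htrans hT.1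
    obtain ⟨m, hm, hmA⟩ := exists_symbol_family hA a
    have := FiniteDimensional.complete ℝ E
    -- `f` is the symbol at the moving point, pulled back to `o` along the section `β`. Symmetrizing
    -- is needed because the family `m` is known only on the diagonal.
    let f : E → ContraTensor E k := fun y => ContraTensor.symm
      (ContraTensor.act (Ring.inverse (β y)) (m ((chartAt E a).symm y)))
    have hmem := mem_chart_source E a
    obtain ⟨T', -, hT1, hT2⟩ := isoJets_inv hΓ hT.1
    have hf : ContDiffAt ℝ ∞ f (chartAt E a a) := by
      have h1 : ContDiffAt ℝ ∞ (fun y => Ring.inverse (β y)) (chartAt E a a) := by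
        refine ContDiffAt.comp (g := Ring.inverse) _ ?_ hβ
        rw [hβT]
        exact contDiffAt_ringInverse ℝ (⟨T, T', hT2, hT1⟩ : (E →L[ℝ] E)ˣ)
      have h2 : ContDiffAt ℝ ∞ (fun y => m ((chartAt E a).symm y)) (chartAt E a a) := by
        rw [← contMDiffAt_iff_contDiffAt]
        refine ContMDiffAt.comp (chartAt E a a) ?_ ((contMDiffOn_chart_symm (I := 𝓘(ℝ, E))
          (x := a)).contMDiffAt
          ((chartAt E a).open_target.mem_nhds ((chartAt E a).map_source hmem)))
        rwa [(chartAt E a).left_inv hmem]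
      exact ContraTensor.symm.contDiff.contDiffAt.comp _
        ((ContraTensor.contDiff_act.contDiffAt.comp _ h1).clm_apply h2)
    -- Comparing `s` with any symbol-preserving `S`, the element `g = s⁻¹ S` of the isotropy group
    -- carries `σ` to the pulled-back symbol; so `f` stays in the orbit of `σ`.
    have key : ∀ᶠ b in 𝓝 a, b ∈ (chartAt E a).source ∧ ∃ s ∈ isoJets Γ o b,
        (chartDeriv a b).comp s = β (chartAt E a b) ∧ ∀ S ∈ symbolJets k A Γ o b,
          ∃ g ∈ isoJets Γ o o, s.comp g = S ∧ f (chartAt E a b) = ContraTensor.act g σ := by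
      filter_upwards [hβs, hmA, (chartAt E a).open_source.mem_nhds hmem] with b hb hmb hba
      obtain ⟨s, hs, hsβ⟩ := hb
      have hmb' : ∀ θ : E →L[ℝ] ℝ, symbolFun k A b (θ.comp (chartDeriv a b)) =
        m b fun _ => θ := hmb
      refine ⟨hba, s, hs, hsβ, fun S hS => ?_⟩
      obtain ⟨t, ht, hts, hst⟩ := isoJets_inv hΓ hs
      obtain ⟨D, hD⟩ := chartDeriv_isInvertible hba
      have hinv : (Ring.inverse (β (chartAt E a b)) : E →L[ℝ] E) = t.comp (D.symm : E →L[ℝ] E) := by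
        have h1 : β (chartAt E a b) = (D : E →L[ℝ] E).comp s := by rw [hD, hsβ]
        let u : (E →L[ℝ] E)ˣ := ⟨(D : E →L[ℝ] E).comp s, t.comp (D.symm : E →L[ℝ] E), by
          ext v
          have h2 := DFunLike.congr_fun hst (D.symm v)
          simp only [ContinuousLinearMap.comp_apply, ContinuousLinearMap.id_apply] at h2
          simp [h2], by
          ext v
          have h2 := DFunLike.congr_fun hts v
          simp only [ContinuousLinearMap.comp_apply, ContinuousLinearMap.id_apply] at h2
          simp [h2]⟩
        rw [h1]
        exact Ring.inverse_unit u
      refine ⟨t.comp S, isoJets_comp ht hS.1, ?_, ?_⟩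
      · rw [← ContinuousLinearMap.comp_assoc, hst, ContinuousLinearMap.id_comp]
      · refine ContraTensor.eq_of_diag (ContraTensor.symm_symm _) (ContraTensor.symm_act _ hσs)
          fun θ => ?_
        have h3 : (θ.comp (t.comp (D.symm : E →L[ℝ] E))).comp (chartDeriv a b) = θ.comp t := by
          rw [← hD]
          ext v
          simp
        rw [ContraTensor.symm_diag, ContraTensor.act_apply, ContraTensor.act_apply, ← hσ,
          (chartAt E a).left_inv hba, hinv, ← hmb', h3, ← ContinuousLinearMap.comp_assoc, hS.2]
    have hfa : f (chartAt E a a) = σ := by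
      obtain ⟨-, s, hs, hsβ, h1⟩ := key.self_of_nhds
      rw [chartDeriv_self, ContinuousLinearMap.id_comp, hβT] at hsβ
      obtain ⟨g, hg, hgT, hgf⟩ := h1 T hT
      rw [hgf, ← ((mem_symbolJets_self_iff (Γ := Γ) hσs hσ).1 (symbolJets_id o)).2]
      congr 2
      rw [hsβ] at hgT
      have h2 := congrArg (fun x => T'.comp x) hgT
      simpa only [← ContinuousLinearMap.comp_assoc, hT1, ContinuousLinearMap.id_comp] using h2
    have hfG : ∀ᶠ y in 𝓝 (chartAt E a a), ∃ g ∈ isoJets Γ o o, f y = ContraTensor.act g σ := by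
      have h1 : Tendsto (chartAt E a).symm (𝓝 (chartAt E a a)) (𝓝 a) := by
        have h2 := ((chartAt E a).continuousAt_symm ((chartAt E a).map_source hmem)).tendsto
        rwa [(chartAt E a).left_inv hmem] at h2
      filter_upwards [h1.eventually key,
        (chartAt E a).open_target.mem_nhds ((chartAt E a).map_source hmem)] with y hy hyt
      obtain ⟨-, s, hs, -, h2⟩ := hy
      obtain ⟨S, hS⟩ := symbolJets_nonempty hΓ htrans htype o ((chartAt E a).symm y)
      obtain ⟨g, hg, -, hgf⟩ := h2 S hS
      rw [(chartAt E a).right_inv hyt] at hgf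
      exact ⟨g, hg, hgf⟩
    -- Lift `f` to the group: `h y` carries `σ` to the symbol pulled back by `β y`, so `β y ∘ h y`
    -- carries the symbol at `o` to the symbol at the moving point.
    obtain ⟨h, hh, hh1, hhG⟩ := (hG.exists_slice ContraTensor.contDiff_act ContraTensor.act_one
      ContraTensor.act_mul (σ := σ) fun X =>
        hG.eq_zero_of_stabilizer hσs hσ (hstab o)).2 f _ hf hfa hfG
    refine ⟨fun y => (β y).comp (h y), hβ.clm_comp hh, ?_, ?_⟩
    · beta_reduce
      rw [hβT, hh1]
      exact ContinuousLinearMap.comp_id _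
    · filter_upwards [key, ((chartAt E a).continuousAt hmem).eventually hhG] with b hb hhb
      obtain ⟨hba, s, hs, hsβ, h1⟩ := hb
      obtain ⟨S, hS⟩ := symbolJets_nonempty hΓ htrans htype o b
      obtain ⟨g, hg, rfl, hgf⟩ := h1 S hS
      refine ⟨s.comp (h (chartAt E a b)), ⟨isoJets_comp hs hhb.1, fun θ => ?_⟩, by
        rw [← ContinuousLinearMap.comp_assoc, hsβ]⟩
      have h2 := congrArg (fun z : ContraTensor E k => z fun _ => θ.comp s) (hhb.2.trans hgf)
      simp only [ContraTensor.act_apply, ← hσ] at h2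
      rw [← hS.2 θ]
      exact h2

end FlatGroupoids

/-! ### Local frames of a flat groupoid. -/

section Frames

variable {E : Type*} [NormedAddCommGroup E] [NormedSpace ℝ E]
  {M : Type*} [TopologicalSpace M] [ChartedSpace E M] {a b : M}

section

variable [IsManifold 𝓘(ℝ, E) ∞ M]

lemma trivializationAt_snd (hb : b ∈ (chartAt E a).source) (v : E) :
    (trivializationAt E (TangentSpace 𝓘(ℝ, E)) a (⟨b, v⟩ : TangentBundle 𝓘(ℝ, E) M)).2 =
      chartDeriv a b v := by
  have h1 := TangentBundle.continuousLinearMapAt_trivializationAt (I := 𝓘(ℝ, E)) hb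
  have h2 : b ∈ (trivializationAt E (TangentSpace 𝓘(ℝ, E) : M → Type _) a).baseSet := hb
  exact (congrFun ((trivializationAt E (TangentSpace 𝓘(ℝ, E)) a).coe_linearMapAt_of_mem
    (R := ℝ) h2) v).symm.trans (DFunLike.congr_fun h1 v)

lemma chartDeriv_comp_inverse (hb : b ∈ (chartAt E a).source) :
    (chartDeriv (E := E) a b).comp (chartDeriv a b).inverse = ContinuousLinearMap.id ℝ E := by
  obtain ⟨D, hD⟩ := chartDeriv_isInvertible (E := E) hb
  rw [← hD, ContinuousLinearMap.inverse_equiv]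
  ext v
  simp

lemma chartDeriv_inverse_comp (hb : b ∈ (chartAt E a).source) :
    (chartDeriv (E := E) a b).inverse.comp (chartDeriv a b) = ContinuousLinearMap.id ℝ E := by
  obtain ⟨D, hD⟩ := chartDeriv_isInvertible (E := E) hb
  rw [← hD, ContinuousLinearMap.inverse_equiv]
  ext v
  simp

/-- The coordinate changes of the tangent bundle are continuous. -/
lemma continuousAt_chartDeriv_comp_inverse {c : M} (ha : c ∈ (chartAt E a).source)
    (hb : c ∈ (chartAt E b).source) :
    ContinuousAt (fun c => (chartDeriv (E := E) b c).comp (chartDeriv a c).inverse) c := by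
  let ea := trivializationAt E (TangentSpace 𝓘(ℝ, E) : M → Type _) a
  let eb := trivializationAt E (TangentSpace 𝓘(ℝ, E) : M → Type _) b
  have hmem : ea.baseSet ∩ eb.baseSet ∈ 𝓝 c :=
    (ea.open_baseSet.inter eb.open_baseSet).mem_nhds ⟨ha, hb⟩
  refine ((continuousOn_coordChange ℝ ea eb).continuousAt hmem).congr ?_
  filter_upwards [hmem] with d hd
  ext v
  change ea.coordChangeL ℝ eb d v = _
  rw [ea.coordChangeL_apply (R := ℝ) eb hd]
  have h1 := trivializationAt_snd (a := b) hd.2 (ea.symm d v)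
  rw [ContinuousLinearMap.comp_apply]
  refine h1.trans (congrArg _ ?_)
  have h2 : (chartDeriv a d : E →L[ℝ] E) (ea.symm d v) = v := by
    refine (trivializationAt_snd (E := E) (a := a) hd.1 (ea.symm d v)).symm.trans ?_
    exact congrArg Prod.snd (ea.apply_mk_symm hd.1 v)
  conv_rhs => rw [← h2]
  exact (DFunLike.congr_fun (chartDeriv_inverse_comp (E := E) hd.1) _).symm

end

namespace IsFlatGroupoid

variable {P : M → M → Set (E →L[ℝ] E)} (hP : IsFlatGroupoid P)

/-- The coordinates of a local frame around `x`. -/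
def frameCoord (x : M) : E → (E →L[ℝ] E) :=
  (hP.exists_section (hP.id_mem x)).choose

/-- A local section around `x` of the arrows with source `x`. -/
def frame (x b : M) : E →L[ℝ] E :=
  (chartDeriv x b).inverse.comp (hP.frameCoord x (chartAt E x b))

lemma contDiffAt_frameCoord (x : M) : ContDiffAt ℝ ∞ (hP.frameCoord x) (chartAt E x x) :=
  (hP.exists_section (hP.id_mem x)).choose_spec.1

lemma frameCoord_self (x : M) : hP.frameCoord x (chartAt E x x) = ContinuousLinearMap.id ℝ E :=
  (hP.exists_section (hP.id_mem x)).choose_spec.2.1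

include hP in
lemma isUnit {g : E →L[ℝ] E} (hg : g ∈ P a b) : IsUnit g := by
  obtain ⟨h, -, h1, h2⟩ := hP.exists_inv hg
  exact ⟨⟨g, h, h2, h1⟩, rfl⟩

include hP in
lemma inverse_comp {g : E →L[ℝ] E} (hg : g ∈ P a b) :
    (Ring.inverse g).comp g = ContinuousLinearMap.id ℝ E :=
  Ring.inverse_mul_cancel g (hP.isUnit hg)

include hP in
lemma comp_inverse {g : E →L[ℝ] E} (hg : g ∈ P a b) :
    g.comp (Ring.inverse g) = ContinuousLinearMap.id ℝ E :=
  Ring.mul_inverse_cancel g (hP.isUnit hg)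

include hP in
lemma inverse_mem {g : E →L[ℝ] E} (hg : g ∈ P a b) : Ring.inverse g ∈ P b a := by
  obtain ⟨h, hh, h1, h2⟩ := hP.exists_inv hg
  have h3 : Ring.inverse g = h := Ring.inverse_unit (⟨g, h, h2, h1⟩ : (E →L[ℝ] E)ˣ)
  rwa [h3]

lemma eventually_contDiffAt_frameCoord (x : M) :
    ∀ᶠ b in 𝓝 x, ContDiffAt ℝ 1 (hP.frameCoord x) (chartAt E x b) :=
  ((chartAt E x).continuousAt (mem_chart_source E x)).eventually
    (((hP.contDiffAt_frameCoord x).of_le (by simp)).eventually (by simp))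

variable [IsManifold 𝓘(ℝ, E) ∞ M]

lemma frame_self (x : M) : hP.frame x x = ContinuousLinearMap.id ℝ E := by
  have h := chartDeriv_inverse_comp (E := E) (mem_chart_source E x)
  rw [chartDeriv_self, ContinuousLinearMap.comp_id] at h
  rw [frame, frameCoord_self, chartDeriv_self, h, ContinuousLinearMap.comp_id]

lemma chartDeriv_comp_frame {x : M} (hb : b ∈ (chartAt E x).source) :
    (chartDeriv x b).comp (hP.frame x b) = hP.frameCoord x (chartAt E x b) := by
  rw [frame, ← ContinuousLinearMap.comp_assoc, chartDeriv_comp_inverse hb,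
    ContinuousLinearMap.id_comp]

lemma eventually_frame_mem (x : M) : ∀ᶠ b in 𝓝 x, hP.frame x b ∈ P x b := by
  filter_upwards [(hP.exists_section (hP.id_mem x)).choose_spec.2.2,
    (chartAt E x).open_source.mem_nhds (mem_chart_source E x)] with b hb hbx
  obtain ⟨s, hs, hsb⟩ := hb
  have h1 : hP.frame x b = s := chartDeriv_injective hbx ((hP.chartDeriv_comp_frame hbx).trans hsb.symm)
  rwa [h1]

lemma isUnit_chartDeriv (hb : b ∈ (chartAt E a).source) : IsUnit (chartDeriv (E := E) a b) :=
  ⟨⟨chartDeriv a b, (chartDeriv a b).inverse, chartDeriv_comp_inverse hb,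
    chartDeriv_inverse_comp hb⟩, rfl⟩

lemma inverse_frame_comp_inverse {x : M} (hb : b ∈ (chartAt E x).source)
    (hu : IsUnit (hP.frame x b)) :
    Ring.inverse (hP.frame x b) =
      (Ring.inverse (hP.frameCoord x (chartAt E x b))).comp (chartDeriv x b) := by
  rw [← hP.chartDeriv_comp_frame hb]
  change _ = Ring.inverse (chartDeriv x b * hP.frame x b) * chartDeriv x b
  obtain ⟨u, hu⟩ := hu
  obtain ⟨D, hD⟩ := isUnit_chartDeriv (E := E) hb
  rw [← hu, ← hD, ← Units.val_mul, Ring.inverse_unit, Ring.inverse_unit, mul_inv_rev,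
    Units.val_mul, mul_assoc, Units.inv_mul, mul_one]

/-- The arrows of a flat groupoid that start at `x` and are close to a frame form a frame. -/
lemma eventually_eq_frame [FiniteDimensional ℝ E] {x b : M} (hbx : b ∈ (chartAt E x).source)
    {f : M → (E →L[ℝ] E)} (hf : ∀ᶠ c in 𝓝 b, f c ∈ P x c)
    (hfc : ContinuousAt (fun c => (chartDeriv x c).comp (f c)) b) :
    ∀ᶠ c in 𝓝 b, f c = (hP.frame b c).comp (f b) := by
  have := FiniteDimensional.complete ℝ E
  let B : M → (E →L[ℝ] E) := fun c => Ring.inverse (hP.frameCoord b (chartAt E b c))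
  have hBc : ContinuousAt B b := by
    have h1 : ContinuousAt (Ring.inverse : (E →L[ℝ] E) → _) (hP.frameCoord b (chartAt E b b)) := by
      rw [frameCoord_self]
      exact NormedRing.inverse_continuousAt (1 : (E →L[ℝ] E)ˣ)
    have h2 : ContinuousAt (fun c => hP.frameCoord b (chartAt E b c)) b :=
      ContinuousAt.comp (f := chartAt E b) (hP.contDiffAt_frameCoord b).continuousAt
        ((chartAt E b).continuousAt (mem_chart_source E b))
    exact ContinuousAt.comp (f := fun c => hP.frameCoord b (chartAt E b c)) h1 h2
  -- This is `(frame b c)⁻¹ ∘ f c ∘ (f b)⁻¹`, an element of the isotropy at `b`, written through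
  -- charts so that its continuity is visible. It equals the identity at `b`, so by discreteness it
  -- is the identity nearby.
  let u : M → (E →L[ℝ] E) := fun c => (B c).comp (((chartDeriv b c).comp
    (chartDeriv x c).inverse).comp (((chartDeriv x c).comp (f c)).comp (Ring.inverse (f b))))
  have hu : ContinuousAt u b := by
    have h1 := continuousAt_chartDeriv_comp_inverse (E := E) hbx (mem_chart_source E b)
    exact hBc.clm_comp (h1.clm_comp (hfc.clm_comp continuousAt_const))
  have hev : ∀ᶠ c in 𝓝 b, u c = (Ring.inverse (hP.frame b c)).comp
      ((f c).comp (Ring.inverse (f b))) := by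
    filter_upwards [hP.eventually_frame_mem b, (chartAt E b).open_source.mem_nhds
      (mem_chart_source E b), (chartAt E x).open_source.mem_nhds hbx] with c h1 h2 h3
    rw [hP.inverse_frame_comp_inverse h2 (hP.isUnit h1)]
    simp only [u, B, ContinuousLinearMap.comp_assoc]
    congr 2
    rw [← ContinuousLinearMap.comp_assoc, chartDeriv_inverse_comp h3, ContinuousLinearMap.id_comp]
  have hub : u b = ContinuousLinearMap.id ℝ E := by
    rw [hev.self_of_nhds, frame_self, hP.comp_inverse hf.self_of_nhds,
      ContinuousLinearMap.comp_id]
    exact Ring.inverse_one _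
  have h1 : ∀ᶠ c in 𝓝 b, u c ∈ P b b → u c = ContinuousLinearMap.id ℝ E := by
    have h2 := hu.tendsto
    rw [hub] at h2
    exact h2.eventually (hP.eventually_eq_id b)
  filter_upwards [h1, hev, hf, hP.eventually_frame_mem b] with c h2 h3 h4 h5
  have h6 : u c ∈ P b b := by
    rw [h3]
    exact hP.comp_mem (hP.inverse_mem h5) (hP.comp_mem h4 (hP.inverse_mem hf.self_of_nhds))
  have h7 := h2 h6
  rw [h3] at h7
  calc f c = ((hP.frame b c).comp (Ring.inverse (hP.frame b c))).comp ((f c).comp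
        ((Ring.inverse (f b)).comp (f b))) := by
        rw [hP.comp_inverse h5, hP.inverse_comp hf.self_of_nhds, ContinuousLinearMap.id_comp,
          ContinuousLinearMap.comp_id]
    _ = (hP.frame b c).comp (((Ring.inverse (hP.frame b c)).comp
        ((f c).comp (Ring.inverse (f b)))).comp (f b)) := rfl
    _ = _ := by rw [h7, ContinuousLinearMap.id_comp]

/-- The frames around different points are compatible. -/
lemma eventually_frame_comp [FiniteDimensional ℝ E] (x : M) : ∀ᶠ b in 𝓝 x, ∀ᶠ c in 𝓝 b,
    hP.frame x c = (hP.frame b c).comp (hP.frame x b) := by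
  filter_upwards [(hP.eventually_frame_mem x).eventually_nhds,
    hP.eventually_contDiffAt_frameCoord x, (chartAt E x).open_source.mem_nhds
      (mem_chart_source E x)] with b h1 h2 h3
  refine hP.eventually_eq_frame h3 h1 ?_
  have h4 : ContinuousAt (fun c => hP.frameCoord x (chartAt E x c)) b :=
    ContinuousAt.comp (f := chartAt E x) h2.continuousAt ((chartAt E x).continuousAt h3)
  refine h4.congr ?_
  filter_upwards [(chartAt E x).open_source.mem_nhds h3] with c hc
  exact (hP.chartDeriv_comp_frame hc).symm

end IsFlatGroupoid

end Frames

/-! ### The connection with parallel frames. -/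

section FlatConnection

variable {E : Type*} [NormedAddCommGroup E] [NormedSpace ℝ E]
  {M : Type*} [TopologicalSpace M] [ChartedSpace E M]

lemma hasMFDerivAt_of_hasFDerivAt_comp_chartAt_symm {F : Type*} [NormedAddCommGroup F]
    [NormedSpace ℝ F] {f : M → F} {x : M} (hf : ContinuousAt f x) {f' : E →L[ℝ] F}
    (h : HasFDerivAt (fun u => f ((chartAt E x).symm u)) f' (chartAt E x x)) :
    HasMFDerivAt 𝓘(ℝ, E) 𝓘(ℝ, F) f x f' :=
  by
  refine ⟨hf, ?_⟩
  simp only [writtenInExtChartAt, mfld_simps, chartAt_self_eq]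
  exact hasFDerivWithinAt_univ.2 h

lemma HasMFDerivAt.smul_of_normedSpace {F : Type*} [NormedAddCommGroup F] [NormedSpace ℝ F]
    {g : M → ℝ} {f : M → F} {x : M} {g' : E →L[ℝ] ℝ} {f' : E →L[ℝ] F}
    (hg : HasMFDerivAt 𝓘(ℝ, E) 𝓘(ℝ, ℝ) g x g') (hf : HasMFDerivAt 𝓘(ℝ, E) 𝓘(ℝ, F) f x f') :
    HasMFDerivAt 𝓘(ℝ, E) 𝓘(ℝ, F) (fun y => g y • f y) x (g x • f' + g'.smulRight (f x)) := by
  refine hasMFDerivAt_of_hasFDerivAt_comp_chartAt_symm (hg.continuousAt.smul hf.continuousAt) ?_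
  have h1 : HasFDerivAt (fun u => g ((chartAt E x).symm u)) g' (chartAt E x x) :=
    hg.hasFDerivAt_comp_extChartAt_symm
  have h2 : HasFDerivAt (fun u => f ((chartAt E x).symm u)) f' (chartAt E x x) :=
    hf.hasFDerivAt_comp_extChartAt_symm
  have h3 := h1.smul h2
  rwa [(chartAt E x).left_inv (mem_chart_source E x)] at h3

variable [IsManifold 𝓘(ℝ, E) ∞ M]

namespace IsFlatGroupoid

variable {P : M → M → Set (E →L[ℝ] E)} (hP : IsFlatGroupoid P)
  {Y Y' : (b : M) → TangentSpace 𝓘(ℝ, E) b} {x : M}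

/-- The components of a vector field in the frame around `x`. -/
def components (x : M) (Y : (b : M) → TangentSpace 𝓘(ℝ, E) b) (c : M) : E :=
  (Ring.inverse (hP.frame x c) : E →L[ℝ] E) (Y c)

lemma components_self (Y : (b : M) → TangentSpace 𝓘(ℝ, E) b) : hP.components x Y x = Y x := by
  rw [components, frame_self]
  exact DFunLike.congr_fun (Ring.inverse_one (E →L[ℝ] E)) (Y x : E)

lemma components_eventuallyEq (Y : (b : M) → TangentSpace 𝓘(ℝ, E) b) :
    hP.components x Y =ᶠ[𝓝 x] fun c =>
      (Ring.inverse (hP.frameCoord x (chartAt E x c)) : E →L[ℝ] E)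
        (trivializationAt E (TangentSpace 𝓘(ℝ, E)) x (⟨c, Y c⟩ : TangentBundle 𝓘(ℝ, E) M)).2 := by
  filter_upwards [hP.eventually_frame_mem x, (chartAt E x).open_source.mem_nhds
    (mem_chart_source E x)] with c h1 h2
  rw [components, hP.inverse_frame_comp_inverse h2 (hP.isUnit h1)]
  exact congrArg _ (trivializationAt_snd h2 (Y c)).symm

variable [FiniteDimensional ℝ E]

omit [IsManifold 𝓘(ℝ, E) ∞ M] in
lemma contDiffAt_inverse_frameCoord (x : M) :
    ContDiffAt ℝ ∞ (fun y => Ring.inverse (hP.frameCoord x y)) (chartAt E x x) := by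
  have := FiniteDimensional.complete ℝ E
  refine ContDiffAt.comp (g := Ring.inverse) _ ?_ (hP.contDiffAt_frameCoord x)
  rw [frameCoord_self]
  exact contDiffAt_ringInverse ℝ (1 : (E →L[ℝ] E)ˣ)

omit [IsManifold 𝓘(ℝ, E) ∞ M] in
lemma contMDiffAt_inverse_frameCoord (x : M) : ContMDiffAt 𝓘(ℝ, E) 𝓘(ℝ, E →L[ℝ] E) ∞
    (fun c => Ring.inverse (hP.frameCoord x (chartAt E x c))) x :=
  ContMDiffAt.comp (g := fun y => Ring.inverse (hP.frameCoord x y)) x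
    (hP.contDiffAt_inverse_frameCoord x).contMDiffAt
    (contMDiffAt_extChartAt (I := 𝓘(ℝ, E)) (n := ∞) (x := x))

lemma mdifferentiableAt_components
    (hY : MDifferentiableAt 𝓘(ℝ, E) (𝓘(ℝ, E).prod 𝓘(ℝ, E))
      (fun y => (⟨y, Y y⟩ : TangentBundle 𝓘(ℝ, E) M)) x) :
    MDifferentiableAt 𝓘(ℝ, E) 𝓘(ℝ, E) (hP.components x Y) x :=
  (((hP.contMDiffAt_inverse_frameCoord x).mdifferentiableAt (by simp)).clm_apply
    ((mdifferentiableAt_section 𝓘(ℝ, E) Y).1 hY)).congr_of_eventuallyEq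
      (hP.components_eventuallyEq Y)

lemma contMDiffAt_components
    (hY : ContMDiffAt 𝓘(ℝ, E) (𝓘(ℝ, E).prod 𝓘(ℝ, E)) ∞
      (fun y => (⟨y, Y y⟩ : TangentBundle 𝓘(ℝ, E) M)) x) :
    ContMDiffAt 𝓘(ℝ, E) 𝓘(ℝ, E) ∞ (hP.components x Y) x :=
  ((hP.contMDiffAt_inverse_frameCoord x).clm_apply
    ((contMDiffAt_section x).1 hY)).congr_of_eventuallyEq
      (hP.components_eventuallyEq Y)

/-- The connection for which the frames are parallel. -/
def connection : CovariantDerivative 𝓘(ℝ, E) E (TangentSpace 𝓘(ℝ, E) : M → Type _) where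
  toFun Y x := (mfderiv 𝓘(ℝ, E) 𝓘(ℝ, E) (hP.components x Y) x : E →L[ℝ] E)
  isCovariantDerivativeOnUniv :=
    { add := fun {Y Y' x} hY hY' _ => by
        have h1 := (hP.mdifferentiableAt_components hY).hasMFDerivAt.add
          (hP.mdifferentiableAt_components hY').hasMFDerivAt
        refine HasMFDerivAt.mfderiv (h1.congr_of_eventuallyEq (Eventually.of_forall fun c => ?_))
        exact map_add (Ring.inverse (hP.frame x c) : E →L[ℝ] E) (Y c) (Y' c)
      leibniz := fun {Y g x} hY hg _ => by
        have h1 := HasMFDerivAt.smul_of_normedSpace hg.hasMFDerivAt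
          (hP.mdifferentiableAt_components hY).hasMFDerivAt
        rw [hP.components_self] at h1
        refine HasMFDerivAt.mfderiv (h1.congr_of_eventuallyEq (Eventually.of_forall fun c => ?_))
        exact map_smul (Ring.inverse (hP.frame x c) : E →L[ℝ] E) (g c) (Y c) }

/-- Around `x`, the connection is the derivative of the components in a fixed frame. -/
lemma eventually_connection_eq (x : M) : ∀ᶠ b in 𝓝 x, ∀ (Y : (b : M) → TangentSpace 𝓘(ℝ, E) b)
    (f' : E →L[ℝ] E), HasMFDerivAt 𝓘(ℝ, E) 𝓘(ℝ, E) (hP.components x Y) b f' →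
      hP.connection Y b = (hP.frame x b).comp f' := by
  filter_upwards [hP.eventually_frame_comp x, (hP.eventually_frame_mem x).eventually_nhds]
    with b hb hbm Y f' hf'
  have h1 : HasMFDerivAt 𝓘(ℝ, E) 𝓘(ℝ, E) (hP.frame x b) (hP.components x Y b) (hP.frame x b) :=
    (hP.frame x b).hasMFDerivAt
  have h2 := HasMFDerivAt.comp b h1 hf'
  refine HasMFDerivAt.mfderiv (h2.congr_of_eventuallyEq ?_)
  filter_upwards [hb, hP.eventually_frame_mem b, hbm] with c h3 h4 h5
  change (Ring.inverse (hP.frame b c) : E →L[ℝ] E) (Y c) =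
    hP.frame x b ((Ring.inverse (hP.frame x c) : E →L[ℝ] E) (Y c))
  -- The definition uses a different frame at each point; the compatibility of frames turns the
  -- change from `x` to `b` into a constant linear factor.
  have h6 : Ring.inverse (hP.frame b c) = (hP.frame x b).comp (Ring.inverse (hP.frame x c)) := by
    have h7 := hP.comp_inverse h5
    rw [h3, ContinuousLinearMap.comp_assoc] at h7
    have h8 := congrArg (fun z => (Ring.inverse (hP.frame b c)).comp z) h7
    rw [← h3] at h8
    simpa only [← ContinuousLinearMap.comp_assoc, hP.inverse_comp h4, ContinuousLinearMap.id_comp,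
      ContinuousLinearMap.comp_id] using h8.symm
  rw [h6]
  rfl

/-- Near `x` the single frame around `x` suffices. In its chart the covariant derivative is
`frameCoord x` composed with the derivative of the components, and both are smooth. -/
lemma contMDiffAt_connection
    (hY : ContMDiffAt 𝓘(ℝ, E) (𝓘(ℝ, E).prod 𝓘(ℝ, E)) ∞
      (fun y => (⟨y, Y y⟩ : TangentBundle 𝓘(ℝ, E) M)) x) :
    ContMDiffAt 𝓘(ℝ, E) (𝓘(ℝ, E).prod 𝓘(ℝ, E →L[ℝ] E)) ∞
      (fun y => (⟨y, hP.connection Y y⟩ : TotalSpace (E →L[ℝ] E)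
        fun b : M => TangentSpace 𝓘(ℝ, E) b →L[ℝ] TangentSpace 𝓘(ℝ, E) b)) x := by
  have hmem := mem_chart_source E x
  have hu := hP.contMDiffAt_components hY
  let v : E → E := fun y => hP.components x Y ((chartAt E x).symm y)
  have hv : ContDiffAt ℝ ∞ v (chartAt E x x) := by
    rw [← contMDiffAt_iff_contDiffAt]
    refine ContMDiffAt.comp (g := hP.components x Y) (chartAt E x x) ?_ ((contMDiffOn_chart_symm (I := 𝓘(ℝ, E))
      (n := ∞) (x := x)).contMDiffAt
      ((chartAt E x).open_target.mem_nhds ((chartAt E x).map_source hmem)))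
    rwa [(chartAt E x).left_inv hmem]
  let R : E → (E →L[ℝ] E) := fun y => (hP.frameCoord x y).comp (fderiv ℝ v y)
  have hR : ContDiffAt ℝ ∞ R (chartAt E x x) :=
    (hP.contDiffAt_frameCoord x).clm_comp (hv.fderiv_right (by simp))
  rw [contMDiffAt_hom_bundle]
  refine ⟨contMDiffAt_id, ?_⟩
  have hRM : ContMDiffAt 𝓘(ℝ, E) 𝓘(ℝ, E →L[ℝ] E) ∞ (fun c => R (chartAt E x c)) x :=
    ContMDiffAt.comp (g := R) x hR.contMDiffAt
      (contMDiffAt_extChartAt (I := 𝓘(ℝ, E)) (n := ∞) (x := x))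
  refine hRM.congr_of_eventuallyEq ?_
  filter_upwards [(chartAt E x).open_source.mem_nhds hmem, hP.eventually_connection_eq x,
    ((chartAt E x).continuousAt hmem).eventually
      ((hv.of_le (n := ∞) (m := 1) (by simp)).eventually (by simp))] with b hb hbc hbv
  have h1 : HasMFDerivAt 𝓘(ℝ, E) 𝓘(ℝ, E) (hP.components x Y) b
      ((fderiv ℝ v (chartAt E x b)).comp (chartDeriv x b) : E →L[ℝ] E) := by
    have h2 : HasMFDerivAt 𝓘(ℝ, E) 𝓘(ℝ, E) v (extChartAt 𝓘(ℝ, E) x b)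
        (fderiv ℝ v (chartAt E x b)) :=
      (hbv.differentiableAt (by simp)).hasFDerivAt.hasMFDerivAt
    refine (HasMFDerivAt.comp b h2 (hasMFDerivAt_extChartAt_chartDeriv hb)).congr_of_eventuallyEq ?_
    filter_upwards [(chartAt E x).open_source.mem_nhds hb] with c hc
    exact congrArg _ ((chartAt E x).left_inv hc).symm
  have h2 := hbc Y _ h1
  have hb' : b ∈ (trivializationAt E (TangentSpace 𝓘(ℝ, E) : M → Type _) x).baseSet := hb
  change ContinuousLinearMap.inCoordinates E (TangentSpace 𝓘(ℝ, E)) E (TangentSpace 𝓘(ℝ, E))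
    x b x b (hP.connection Y b) = R (chartAt E x b)
  rw [ContinuousLinearMap.inCoordinates_eq hb' hb', h2]
  ext z
  let w : E := ((trivializationAt E (TangentSpace 𝓘(ℝ, E)) x).continuousLinearEquivAt ℝ b hb').symm z
  have hw : (chartDeriv x b : E →L[ℝ] E) w = z := by
    refine (trivializationAt_snd (E := E) hb w).symm.trans ?_
    exact ((trivializationAt E (TangentSpace 𝓘(ℝ, E)) x).continuousLinearEquivAt ℝ b
      hb').apply_symm_apply z
  change (trivializationAt E (TangentSpace 𝓘(ℝ, E)) x
    (⟨b, hP.frame x b (fderiv ℝ v (chartAt E x b) (chartDeriv x b w))⟩ :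
      TangentBundle 𝓘(ℝ, E) M)).2 = hP.frameCoord x (chartAt E x b) (fderiv ℝ v (chartAt E x b) z)
  rw [hw, ← hP.chartDeriv_comp_frame hb]
  exact trivializationAt_snd (E := E) hb _

lemma contMDiffCovariantDerivative_connection :
    CovariantDerivative.ContMDiffCovariantDerivative hP.connection ∞ where
  contMDiff := ⟨fun {Y} hY => by
    intro x _
    exact (hP.contMDiffAt_connection ((hY x (mem_univ x)).contMDiffAt univ_mem)).contMDiffWithinAt⟩

end IsFlatGroupoid

end FlatConnection

/-! ### Continuation along the line and lifts of curves. -/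

section Continuation

/-- Local functions on the line that have unique continuations and exist locally around each point
extend to the whole line. -/
lemma exists_global_of_local {X : Type*} {p : (ℝ → X) → ℝ → Prop}
    (hcongr : ∀ Φ Ψ t, Φ =ᶠ[𝓝 t] Ψ → p Φ t → p Ψ t)
    (huniq : ∀ (Φ Ψ : ℝ → X) (a b : ℝ), (∀ t ∈ Ioo a b, p Φ t) → (∀ t ∈ Ioo a b, p Ψ t) →
      ∀ t₀ ∈ Ioo a b, Φ t₀ = Ψ t₀ → EqOn Φ Ψ (Ioo a b))
    (hloc : ∀ t₀, ∃ ε > 0, ∀ t₁ ∈ Ioo (t₀ - ε) (t₀ + ε), ∀ Φ₀, p Φ₀ t₁ →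
      ∃ Φ : ℝ → X, Φ t₁ = Φ₀ t₁ ∧ ∀ t ∈ Ioo (t₀ - ε) (t₀ + ε), p Φ t)
    {Φ₀ : ℝ → X} (h₀ : p Φ₀ 0) : ∃ Φ : ℝ → X, Φ 0 = Φ₀ 0 ∧ ∀ t, p Φ t := by
  classical
  -- The radii of symmetric intervals carrying a solution. By uniqueness these solutions agree and
  -- glue; if `S` were bounded, the glued solution would extend past both ends of the interval of
  -- radius `sSup S`.
  let S : Set ℝ := {r | 0 < r ∧ ∃ Φ : ℝ → X, Φ 0 = Φ₀ 0 ∧ ∀ t ∈ Ioo (-r) r, p Φ t}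
  have hglue : ∃ Φ : ℝ → X, Φ 0 = Φ₀ 0 ∧ ∀ t, (∃ r ∈ S, t ∈ Ioo (-r) r) → p Φ t := by
    let F : ℝ → ℝ → X := fun r => if h : r ∈ S then h.2.choose else Φ₀
    have hF : ∀ r ∈ S, F r 0 = Φ₀ 0 ∧ ∀ t ∈ Ioo (-r) r, p (F r) t := fun r hr => by
      simp only [F, dif_pos hr]
      exact hr.2.choose_spec
    let Φ : ℝ → X := fun t => if h : ∃ r ∈ S, t ∈ Ioo (-r) r then F h.choose t else Φ₀ t
    have hΦ : ∀ r ∈ S, EqOn Φ (F r) (Ioo (-r) r) := fun r hr t ht => by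
      have h : ∃ r ∈ S, t ∈ Ioo (-r) r := ⟨r, hr, ht⟩
      have h1 : Φ t = F h.choose t := dif_pos h
      rw [h1]
      obtain ⟨h2, h3⟩ := h.choose_spec
      set r' := h.choose
      have h4 := h2.1
      have h5 := hr.1
      refine huniq (F r') (F r) (-min r' r) (min r' r) (fun s hs => (hF _ h2).2 s ?_)
        (fun s hs => (hF _ hr).2 s ?_) 0 ⟨by simp [h4, h5], by simp [h4, h5]⟩
        ((hF _ h2).1.trans (hF _ hr).1.symm) ⟨?_, lt_min h3.2 ht.2⟩
      · exact ⟨by linarith [hs.1, min_le_left r' r], hs.2.trans_le (min_le_left _ _)⟩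
      · exact ⟨by linarith [hs.1, min_le_right r' r], hs.2.trans_le (min_le_right _ _)⟩
      · have := lt_min (a := -t) (b := r') (c := r) (by linarith [h3.1]) (by linarith [ht.1])
        linarith
    refine ⟨Φ, ?_, ?_⟩
    · by_cases h : ∃ r ∈ S, (0 : ℝ) ∈ Ioo (-r) r
      · obtain ⟨r, hr, h0⟩ := h
        rw [hΦ r hr h0, (hF r hr).1]
      · exact dif_neg h
    · rintro t ⟨r, hr, ht⟩
      refine hcongr (F r) Φ t ?_ ((hF r hr).2 t ht)
      filter_upwards [isOpen_Ioo.mem_nhds ht] with s hs using (hΦ r hr hs).symm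
  obtain ⟨Φ, hΦ0, hΦ⟩ := hglue
  by_cases hS : BddAbove S
  · exfalso
    have hne : S.Nonempty := by
      obtain ⟨ε, hε, h⟩ := hloc 0
      obtain ⟨Ψ, hΨ0, hΨ⟩ := h 0 ⟨by linarith, by linarith⟩ Φ₀ h₀
      exact ⟨ε, hε, Ψ, hΨ0, by simpa using hΨ⟩
    set R := sSup S
    have hR : 0 < R := by
      obtain ⟨r, hr⟩ := hne
      exact hr.1.trans_le (le_csSup hS hr)
    have hΦR : ∀ t ∈ Ioo (-R) R, p Φ t := fun t ht => by
      obtain ⟨r, hr, htr⟩ := exists_lt_of_lt_csSup hne (abs_lt.2 ht)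
      exact hΦ t ⟨r, hr, abs_lt.1 htr⟩
    obtain ⟨ε₁, hε₁, h1⟩ := hloc R
    obtain ⟨ε₂, hε₂, h2⟩ := hloc (-R)
    -- `δ ≤ R` keeps the overlaps at the two ends on opposite sides of `0`, so outside the old
    -- interval the sign of `t` decides which extension is used.
    let δ := min (min ε₁ ε₂) R
    have hδ : 0 < δ := lt_min (lt_min hε₁ hε₂) hR
    have hδ1 : δ ≤ ε₁ := (min_le_left _ _).trans (min_le_left _ _)
    have hδ2 : δ ≤ ε₂ := (min_le_left _ _).trans (min_le_right _ _)
    have hδR : δ ≤ R := min_le_right _ _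
    obtain ⟨Ψ₁, hΨ₁, hΨ₁p⟩ := h1 (R - δ / 2) ⟨by linarith, by linarith⟩ Φ
      (hΦR _ ⟨by linarith, by linarith⟩)
    obtain ⟨Ψ₂, hΨ₂, hΨ₂p⟩ := h2 (-R + δ / 2) ⟨by linarith, by linarith⟩ Φ
      (hΦR _ ⟨by linarith, by linarith⟩)
    have e1 : EqOn Φ Ψ₁ (Ioo (R - δ) R) := huniq _ _ _ _
      (fun t ht => hΦR t ⟨by linarith [ht.1], ht.2⟩)
      (fun t ht => hΨ₁p t ⟨by linarith [ht.1], by linarith [ht.2]⟩) (R - δ / 2)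
      ⟨by linarith, by linarith⟩ hΨ₁.symm
    have e2 : EqOn Φ Ψ₂ (Ioo (-R) (-R + δ)) := huniq _ _ _ _
      (fun t ht => hΦR t ⟨ht.1, by linarith [ht.2]⟩)
      (fun t ht => hΨ₂p t ⟨by linarith [ht.1], by linarith [ht.2]⟩) (-R + δ / 2)
      ⟨by linarith, by linarith⟩ hΨ₂.symm
    let Φ' : ℝ → X := fun t => if t ∈ Ioo (-R) R then Φ t else if 0 < t then Ψ₁ t else Ψ₂ t
    have hmem : R + δ ∈ S := by
      refine ⟨by linarith, Φ', ?_, fun t ht => ?_⟩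
      · simp only [Φ', if_pos (show (0 : ℝ) ∈ Ioo (-R) R from ⟨by linarith, hR⟩), hΦ0]
      · rcases lt_or_ge t R with htR | htR
        · rcases lt_or_ge (-R) t with htR' | htR'
          · refine hcongr Φ Φ' t ?_ (hΦR t ⟨htR', htR⟩)
            filter_upwards [isOpen_Ioo.mem_nhds (show t ∈ Ioo (-R) R from ⟨htR', htR⟩)] with s hs
            exact (if_pos hs).symm
          · refine hcongr Ψ₂ Φ' t ?_ (hΨ₂p t ⟨by linarith [ht.1], by linarith⟩)
            filter_upwards [isOpen_Iio.mem_nhds (show t ∈ Iio (-R + δ) by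
              simp only [mem_Iio]; linarith)] with s hs
            have hs' : s < -R + δ := hs
            by_cases hsR : s ∈ Ioo (-R) R
            · simp only [Φ', if_pos hsR]
              exact (e2 ⟨hsR.1, hs⟩).symm
            · have h3 : ¬ 0 < s := fun h0 => hsR ⟨by linarith, by linarith⟩
              simp only [Φ', if_neg hsR, if_neg h3]
        · refine hcongr Ψ₁ Φ' t ?_ (hΨ₁p t ⟨by linarith, by linarith [ht.2]⟩)
          filter_upwards [isOpen_Ioi.mem_nhds (show t ∈ Ioi (R - δ) by
            simp only [mem_Ioi]; linarith)] with s hs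
          have hs' : R - δ < s := hs
          by_cases hsR : s ∈ Ioo (-R) R
          · simp only [Φ', if_pos hsR]
            exact (e1 ⟨hs, hsR.2⟩).symm
          · have h3 : 0 < s := by
              by_contra h0
              exact hsR ⟨by linarith, by linarith⟩
            simp only [Φ', if_neg hsR, if_pos h3]
    have := le_csSup hS hmem
    linarith
  · refine ⟨Φ, hΦ0, fun t => hΦ t ?_⟩
    rw [not_bddAbove_iff] at hS
    obtain ⟨r, hr, htr⟩ := hS |t|
    exact ⟨r, hr, abs_lt.1 htr⟩

end Continuation

section Lifts

variable {E : Type*} [NormedAddCommGroup E] [NormedSpace ℝ E]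
  {M : Type*} [TopologicalSpace M] [ChartedSpace E M] [IsManifold 𝓘(ℝ, E) ∞ M]

namespace IsFlatGroupoid

variable {P : M → M → Set (E →L[ℝ] E)} (hP : IsFlatGroupoid P) {γ : ℝ → M} {a : M}

/-- Near time `t`, the curve `Φ` of arrows with source `a` and target `γ` follows the frames. -/
def IsLiftAt (γ : ℝ → M) (a : M) (Φ : ℝ → (E →L[ℝ] E)) (t : ℝ) : Prop :=
  Φ t ∈ P a (γ t) ∧ ∀ᶠ s in 𝓝 t, Φ s = (hP.frame (γ t) (γ s)).comp (Φ t)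

/-- The truth value of `Φ t = Ψ t` is locally constant, because near each time both curves are
carried by the same invertible frame. -/
lemma IsLiftAt.eqOn (hγ : Continuous γ) {Φ Ψ : ℝ → (E →L[ℝ] E)} {I : Set ℝ}
    (hI : IsPreconnected I) (hΦ : ∀ t ∈ I, hP.IsLiftAt γ a Φ t) (hΨ : ∀ t ∈ I, hP.IsLiftAt γ a Ψ t)
    {t₀ : ℝ} (ht₀ : t₀ ∈ I) (h : Φ t₀ = Ψ t₀) : EqOn Φ Ψ I := by
  classical
  have h1 : ContinuousOn (fun t => decide (Φ t = Ψ t)) I := fun t ht => by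
    refine ContinuousAt.continuousWithinAt ((continuousAt_const (y := decide (Φ t = Ψ t))).congr ?_)
    filter_upwards [(hΦ t ht).2, (hΨ t ht).2, hγ.continuousAt.eventually
      (hP.eventually_frame_mem (γ t))] with s h2 h3 h4
    rw [decide_eq_decide, h2, h3]
    refine ⟨fun h5 => by rw [h5], fun h5 => ?_⟩
    have h6 := congrArg (fun z => (Ring.inverse (hP.frame (γ t) (γ s))).comp z) h5
    simpa only [← ContinuousLinearMap.comp_assoc, hP.inverse_comp h4,
      ContinuousLinearMap.id_comp] using h6
  intro t ht
  have h2 := hI.constant h1 ht₀ ht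
  rw [decide_eq_decide] at h2
  exact h2.1 h

variable [FiniteDimensional ℝ E]

lemma exists_lift (hγ : Continuous γ) : ∃ Φ : ℝ → (E →L[ℝ] E),
    Φ 0 = ContinuousLinearMap.id ℝ E ∧ ∀ t, hP.IsLiftAt γ (γ 0) Φ t := by
  have hloc : ∀ t₀, ∃ ε > 0, ∀ t₁ ∈ Ioo (t₀ - ε) (t₀ + ε), ∀ T ∈ P (γ 0) (γ t₁),
      ∃ Φ : ℝ → (E →L[ℝ] E), Φ t₁ = T ∧
        ∀ t ∈ Ioo (t₀ - ε) (t₀ + ε), hP.IsLiftAt γ (γ 0) Φ t := by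
    -- Near `γ t₀` a lift is a frame composed with a constant. The interval depends only on `t₀`,
    -- neither on the starting time nor on the initial arrow, as continuation requires.
    intro t₀
    have h1 : ∀ᶠ t in 𝓝 t₀, hP.frame (γ t₀) (γ t) ∈ P (γ t₀) (γ t) ∧ ∀ᶠ c in 𝓝 (γ t),
        hP.frame (γ t₀) c = (hP.frame (γ t) c).comp (hP.frame (γ t₀) (γ t)) :=
      hγ.continuousAt.eventually ((hP.eventually_frame_mem _).and (hP.eventually_frame_comp _))
    obtain ⟨ε, hε, h2⟩ := Metric.eventually_nhds_iff_ball.1 h1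
    rw [Real.ball_eq_Ioo] at h2
    refine ⟨ε, hε, fun t₁ ht₁ T hT => ⟨fun t => (hP.frame (γ t₀) (γ t)).comp
      ((Ring.inverse (hP.frame (γ t₀) (γ t₁))).comp T), ?_, fun t ht => ⟨?_, ?_⟩⟩⟩
    · beta_reduce
      rw [← ContinuousLinearMap.comp_assoc, hP.comp_inverse (h2 t₁ ht₁).1,
        ContinuousLinearMap.id_comp]
    · exact hP.comp_mem (h2 t ht).1 (hP.comp_mem (hP.inverse_mem (h2 t₁ ht₁).1) hT)
    · filter_upwards [hγ.continuousAt.eventually (h2 t ht).2] with s hs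
      rw [hs, ContinuousLinearMap.comp_assoc]
  refine exists_global_of_local (p := hP.IsLiftAt γ (γ 0)) ?_ ?_ ?_
    (Φ₀ := fun t => hP.frame (γ 0) (γ t)) ?_ |>.imp fun Φ h => ⟨h.1.trans (hP.frame_self _), h.2⟩
  · rintro Φ Ψ t h ⟨h1, h2⟩
    rw [IsLiftAt, ← h.self_of_nhds]
    refine ⟨h1, ?_⟩
    filter_upwards [h, h2] with s h3 h4
    rw [← h3, h4]
  · exact fun Φ Ψ a b h1 h2 t₀ ht₀ h => IsLiftAt.eqOn hP hγ isPreconnected_Ioo h1 h2 ht₀ h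
  · intro t₀
    obtain ⟨ε, hε, h⟩ := hloc t₀
    exact ⟨ε, hε, fun t₁ ht₁ Φ₀ h0 => h t₁ ht₁ _ h0.1⟩
  · refine ⟨(hP.eventually_frame_mem _).self_of_nhds, Eventually.of_forall fun s => ?_⟩
    beta_reduce
    rw [hP.frame_self, ContinuousLinearMap.comp_id]

end IsFlatGroupoid

end Lifts

/-! ### Parallel transport of the flat connection. -/

section ParallelTransport

variable {E : Type*} [NormedAddCommGroup E] [NormedSpace ℝ E]
  {M : Type*} [TopologicalSpace M] [ChartedSpace E M] [IsManifold 𝓘(ℝ, E) ∞ M]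

lemma hasDerivAt_chartAt_comp {γ : ℝ → M} {t : ℝ} {γ' : E}
    (hγ : HasMFDerivAt 𝓘(ℝ, ℝ) 𝓘(ℝ, E) γ t (ContinuousLinearMap.toSpanSingleton ℝ γ')) :
    HasDerivAt (fun s => chartAt E (γ t) (γ s)) γ' t := by
  have h1 := hasMFDerivAt_extChartAt_chartDeriv (mem_chart_source E (γ t))
  rw [chartDeriv_self] at h1
  have h2 := (HasMFDerivAt.comp t h1 hγ).hasFDerivAt
  have h3 : HasDerivAt (fun s => chartAt E (γ t) (γ s))
    (ContinuousLinearMap.toSpanSingleton ℝ γ' 1) t := HasFDerivAt.hasDerivAt h2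
  rwa [ContinuousLinearMap.toSpanSingleton_apply, one_smul] at h3

omit [IsManifold 𝓘(ℝ, E) ∞ M] in
lemma hasMFDerivAt_toSpanSingleton {γ : ℝ → M} {t : ℝ}
    (hγ : MDifferentiableAt 𝓘(ℝ, ℝ) 𝓘(ℝ, E) γ t) :
    HasMFDerivAt 𝓘(ℝ, ℝ) 𝓘(ℝ, E) γ t (ContinuousLinearMap.toSpanSingleton ℝ
      (mfderiv 𝓘(ℝ, ℝ) 𝓘(ℝ, E) γ t (1 : ℝ) : E)) := by
  refine hγ.hasMFDerivAt.congr_mfderiv ?_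
  exact ContinuousLinearMap.ext_ring
    (one_smul ℝ (mfderiv 𝓘(ℝ, ℝ) 𝓘(ℝ, E) γ t (1 : ℝ) : E)).symm

namespace IsFlatGroupoid

variable {P : M → M → Set (E →L[ℝ] E)} (hP : IsFlatGroupoid P)

omit [IsManifold 𝓘(ℝ, E) ∞ M] in
lemma hasFDerivAt_frameCoord (x : M) :
    HasFDerivAt (hP.frameCoord x) (fderiv ℝ (hP.frameCoord x) (chartAt E x x)) (chartAt E x x) :=
  ((hP.contDiffAt_frameCoord x).differentiableAt (by simp)).hasFDerivAt

variable [FiniteDimensional ℝ E]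

omit [IsManifold 𝓘(ℝ, E) ∞ M] in
lemma hasFDerivAt_inverse_frameCoord (x : M) :
    HasFDerivAt (fun y => Ring.inverse (hP.frameCoord x y))
      (-fderiv ℝ (hP.frameCoord x) (chartAt E x x)) (chartAt E x x) := by
  have := FiniteDimensional.complete ℝ E
  have h1 := hasFDerivAt_ringInverse (𝕜 := ℝ) (1 : (E →L[ℝ] E)ˣ)
  have h2 : ((1 : (E →L[ℝ] E)ˣ) : E →L[ℝ] E) = hP.frameCoord x (chartAt E x x) :=
    (hP.frameCoord_self x).symm
  rw [h2] at h1
  refine (h1.comp _ (hP.hasFDerivAt_frameCoord x)).congr_fderiv ?_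
  refine ContinuousLinearMap.ext fun v => ?_
  change -((1 : E →L[ℝ] E) * fderiv ℝ (hP.frameCoord x) (chartAt E x x) v * 1) = _
  rw [one_mul, mul_one]
  rfl

/-- The Christoffel symbols: a field with constant coordinates `v` has frame components
`frameCoord⁻¹ v`, and the inverse at the identity differentiates to minus the derivative. -/
lemma connection_extend (x : M) (v w : E) :
    (hP.connection (FiberBundle.extend E (x := x) (v : TangentSpace 𝓘(ℝ, E) x)) x w : E) =
      -(fderiv ℝ (hP.frameCoord x) (chartAt E x x) w v) := by
  have hmem := mem_chart_source E x
  let v' : TangentSpace 𝓘(ℝ, E) x := v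
  have h1 : hP.components x (FiberBundle.extend E v') =ᶠ[𝓝 x] fun c =>
      (Ring.inverse (hP.frameCoord x (chartAt E x c)) : E →L[ℝ] E) v := by
    filter_upwards [hP.components_eventuallyEq (x := x) (FiberBundle.extend E v'),
      (chartAt E x).open_source.mem_nhds hmem] with c hc hcs
    rw [hc]
    congr 1
    have hc' : c ∈ (trivializationAt E (TangentSpace 𝓘(ℝ, E) : M → Type _) x).baseSet := hcs
    have h2 := congrArg Prod.snd
      ((trivializationAt E (TangentSpace 𝓘(ℝ, E) : M → Type _) x).apply_mk_symm hc'
        (trivializationAt E (TangentSpace 𝓘(ℝ, E) : M → Type _) x ⟨x, v'⟩).2)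
    refine h2.trans ?_
    refine (trivializationAt_snd (E := E) hmem v).trans ?_
    rw [chartDeriv_self]
    rfl
  have h2 : HasMFDerivAt 𝓘(ℝ, E) 𝓘(ℝ, E)
      (fun c => (Ring.inverse (hP.frameCoord x (chartAt E x c)) : E →L[ℝ] E) v) x
      (((ContinuousLinearMap.apply ℝ E v).comp
        (-fderiv ℝ (hP.frameCoord x) (chartAt E x x))).comp (chartDeriv x x) : E →L[ℝ] E) := by
    have h3 : HasMFDerivAt 𝓘(ℝ, E) 𝓘(ℝ, E)
      (fun y => (Ring.inverse (hP.frameCoord x y) : E →L[ℝ] E) v) (extChartAt 𝓘(ℝ, E) x x)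
      ((ContinuousLinearMap.apply ℝ E v).comp
        (-fderiv ℝ (hP.frameCoord x) (chartAt E x x))) :=
      ((ContinuousLinearMap.apply ℝ E v).hasFDerivAt.comp _
        (hP.hasFDerivAt_inverse_frameCoord x)).hasMFDerivAt
    exact HasMFDerivAt.comp x h3 (hasMFDerivAt_extChartAt_chartDeriv hmem)
  have h3 : hP.connection (FiberBundle.extend E v') x = (((ContinuousLinearMap.apply ℝ E v).comp
        (-fderiv ℝ (hP.frameCoord x) (chartAt E x x))).comp (chartDeriv x x) : E →L[ℝ] E) :=
    (h2.congr_of_eventuallyEq h1).mfderiv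
  refine (DFunLike.congr_fun h3 w).trans ?_
  rw [chartDeriv_self]
  rfl

variable {γ : ℝ → M}

omit [FiniteDimensional ℝ E] in
lemma hasDerivAt_frameCoord_comp {t : ℝ} {γ' : E}
    (hγ : HasMFDerivAt 𝓘(ℝ, ℝ) 𝓘(ℝ, E) γ t (ContinuousLinearMap.toSpanSingleton ℝ γ')) :
    HasDerivAt (fun s => hP.frameCoord (γ t) (chartAt E (γ t) (γ s)))
      (fderiv ℝ (hP.frameCoord (γ t)) (chartAt E (γ t) (γ t)) γ') t :=
  HasFDerivAt.comp_hasDerivAt (f := fun s => chartAt E (γ t) (γ s)) t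
    (hP.hasFDerivAt_frameCoord (γ t)) (hasDerivAt_chartAt_comp hγ)

/-- A vector field along a curve is parallel when its components in the frames have zero
derivative. -/
lemma hasDerivAt_parallel_iff {V : ℝ → E} {t : ℝ} {γ' : E}
    (hγ : HasMFDerivAt 𝓘(ℝ, ℝ) 𝓘(ℝ, E) γ t (ContinuousLinearMap.toSpanSingleton ℝ γ')) :
    HasDerivAt (fun s : ℝ => (trivializationAt E (TangentSpace 𝓘(ℝ, E)) (γ t)
      (⟨γ s, V s⟩ : TangentBundle 𝓘(ℝ, E) M)).2)
      (fderiv ℝ (hP.frameCoord (γ t)) (chartAt E (γ t) (γ t)) γ' (V t)) t ↔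
    HasDerivAt (fun s => (Ring.inverse (hP.frame (γ t) (γ s)) : E →L[ℝ] E) (V s)) 0 t := by
  set x := γ t
  have hmem := mem_chart_source E x
  set b : ℝ → (E →L[ℝ] E) := fun s => hP.frameCoord x (chartAt E x (γ s))
  set q : ℝ → E := fun s => (Ring.inverse (hP.frame x (γ s)) : E →L[ℝ] E) (V s)
  set p : ℝ → E := fun s => (trivializationAt E (TangentSpace 𝓘(ℝ, E)) x
      (⟨γ s, V s⟩ : TangentBundle 𝓘(ℝ, E) M)).2
  set D := fderiv ℝ (hP.frameCoord x) (chartAt E x x)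
  have hb : HasDerivAt b (D γ') t := hP.hasDerivAt_frameCoord_comp hγ
  have hb' : HasDerivAt (fun s => Ring.inverse (b s)) (-(D γ')) t :=
    HasFDerivAt.comp_hasDerivAt (f := fun s => chartAt E (γ t) (γ s)) t
      (hP.hasFDerivAt_inverse_frameCoord (γ t)) (hasDerivAt_chartAt_comp hγ)
  have hbt : b t = ContinuousLinearMap.id ℝ E := hP.frameCoord_self x
  have hqt : q t = V t := by
    change (Ring.inverse (hP.frame x x) : E →L[ℝ] E) (V t) = V t
    rw [frame_self]
    exact DFunLike.congr_fun (Ring.inverse_one (E →L[ℝ] E)) (V t)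
  have hpt : p t = V t := by
    refine (trivializationAt_snd (E := E) hmem (V t)).trans ?_
    rw [chartDeriv_self]
    rfl
  have hev : ∀ᶠ s in 𝓝 t, q s = (Ring.inverse (b s) : E →L[ℝ] E) (p s) ∧ p s = b s (q s) := by
    filter_upwards [hγ.continuousAt.eventually (hP.eventually_frame_mem x),
      hγ.continuousAt.eventually ((chartAt E x).open_source.mem_nhds hmem)] with s h1 h2
    have h3 : p s = chartDeriv x (γ s) (V s) := trivializationAt_snd (E := E) h2 (V s)
    constructor
    · rw [h3]
      simp only [q]
      rw [hP.inverse_frame_comp_inverse h2 (hP.isUnit h1)]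
      rfl
    · rw [h3]
      simp only [q, b]
      rw [← hP.chartDeriv_comp_frame h2, ContinuousLinearMap.comp_apply]
      congr 1
      exact (DFunLike.congr_fun (hP.comp_inverse h1) (V s)).symm
  constructor
  · intro h
    have h1 := hb'.clm_apply h
    rw [hpt, hbt] at h1
    have h2 : -(D γ') (V t) + (Ring.inverse (ContinuousLinearMap.id ℝ E) : E →L[ℝ] E)
        (D γ' (V t)) = 0 := by
      have h3 : (Ring.inverse (ContinuousLinearMap.id ℝ E) : E →L[ℝ] E) =
        ContinuousLinearMap.id ℝ E := Ring.inverse_one _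
      rw [h3]
      simp
    exact (h1.congr_deriv h2).congr_of_eventuallyEq (hev.mono fun s hs => hs.1)
  · intro h
    have h1 := hb.clm_apply h
    rw [hqt, map_zero, add_zero] at h1
    exact h1.congr_of_eventuallyEq (hev.mono fun s hs => hs.2)

variable {a : M} {Φ : ℝ → (E →L[ℝ] E)}

/-- Along a lift, the frames at different times differ by constant factors, so the separate
conditions at each `t` say together that `Φ⁻¹ V` has zero derivative everywhere. -/
lemma isParallelAlong_iff (hγ : ContMDiff 𝓘(ℝ, ℝ) 𝓘(ℝ, E) ∞ γ)
    (hΦ : ∀ t, hP.IsLiftAt γ a Φ t) (V : (t : ℝ) → TangentSpace 𝓘(ℝ, E) (γ t)) :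
    IsParallelAlong hP.connection γ V ↔
      ∀ t, (Ring.inverse (Φ t) : E →L[ℝ] E) (V t) = (Ring.inverse (Φ 0) : E →L[ℝ] E) (V 0) := by
  have h1 : ∀ t, HasDerivAt
      (fun s : ℝ => (trivializationAt E (TangentSpace 𝓘(ℝ, E)) (γ t)
        (⟨γ s, V s⟩ : TangentBundle 𝓘(ℝ, E) M)).2)
      (-(hP.connection (FiberBundle.extend E (V t)) (γ t)
        (mfderiv 𝓘(ℝ, ℝ) 𝓘(ℝ, E) γ t (1 : ℝ)) : E)) t ↔
      HasDerivAt (fun s => (Ring.inverse (Φ s) : E →L[ℝ] E) (V s : E)) 0 t := by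
    intro t
    have h2 := hasMFDerivAt_toSpanSingleton (hγ.contMDiffAt.mdifferentiableAt (x := t) (by simp))
    have h3 := hP.connection_extend (γ t) (V t) (mfderiv 𝓘(ℝ, ℝ) 𝓘(ℝ, E) γ t (1 : ℝ))
    refine (Iff.of_eq (congrArg (fun z : E => HasDerivAt _ z t)
      ((congrArg (fun z : E => -z) h3).trans (neg_neg _)))).trans ?_
    refine (hP.hasDerivAt_parallel_iff (V := V) h2).trans ?_
    have hev : ∀ᶠ s in 𝓝 t, Ring.inverse (Φ s) =
        (Ring.inverse (Φ t)).comp (Ring.inverse (hP.frame (γ t) (γ s))) := by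
      filter_upwards [(hΦ t).2, hγ.continuous.continuousAt.eventually
        (hP.eventually_frame_mem (γ t))] with s h4 h5
      rw [h4]
      obtain ⟨u, hu⟩ := hP.isUnit h5
      obtain ⟨u', hu'⟩ := hP.isUnit (hΦ t).1
      change Ring.inverse (hP.frame (γ t) (γ s) * Φ t) = Ring.inverse (Φ t) * Ring.inverse _
      rw [← hu, ← hu', ← Units.val_mul, Ring.inverse_unit, Ring.inverse_unit, Ring.inverse_unit,
        mul_inv_rev, Units.val_mul]
    constructor
    · intro h4
      have h5 := (Ring.inverse (Φ t) : E →L[ℝ] E).hasFDerivAt.comp_hasDerivAt t h4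
      rw [map_zero] at h5
      refine h5.congr_of_eventuallyEq (hev.mono fun s hs => ?_)
      beta_reduce
      rw [hs]
      rfl
    · intro h4
      have h5 := (Φ t).hasFDerivAt.comp_hasDerivAt t h4
      rw [map_zero] at h5
      refine h5.congr_of_eventuallyEq (hev.mono fun s hs => ?_)
      simp only [Function.comp_apply]
      rw [hs]
      exact (DFunLike.congr_fun (hP.comp_inverse (hΦ t).1) _).symm
  constructor
  · intro h t
    have h2 : ∀ t, HasDerivAt (fun s => (Ring.inverse (Φ s) : E →L[ℝ] E) (V s : E)) 0 t :=
      fun t => (h1 t).1 (h t)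
    exact is_const_of_deriv_eq_zero (fun t => (h2 t).differentiableAt) (fun t => (h2 t).deriv) t 0
  · intro h t
    refine (h1 t).2 ?_
    have h2 : (fun s => (Ring.inverse (Φ s) : E →L[ℝ] E) (V s : E)) =
      fun _ => (Ring.inverse (Φ 0) : E →L[ℝ] E) (V 0 : E) := funext h
    rw [h2]
    exact hasDerivAt_const t _

/-- The parallel fields are exactly `t ↦ Φ t v` for the lift `Φ` starting at the identity, so the
transport is `Φ 1`. -/
lemma isParallelTransport_connection (hγ : ContMDiff 𝓘(ℝ, ℝ) 𝓘(ℝ, E) ∞ γ) :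
    ∃ T ∈ P (γ 0) (γ 1), IsParallelTransport hP.connection γ T := by
  obtain ⟨Φ, hΦ0, hΦ⟩ := hP.exists_lift hγ.continuous
  refine ⟨Φ 1, (hΦ 1).1, fun v w => ?_⟩
  have h0 : ∀ v : E, (Ring.inverse (Φ 0) : E →L[ℝ] E) v = v := fun v => by
    rw [hΦ0]
    exact DFunLike.congr_fun (Ring.inverse_one (E →L[ℝ] E)) v
  constructor
  · rintro ⟨V, hV, rfl, rfl⟩
    have h1 := ((hP.isParallelAlong_iff hγ hΦ V).1 hV 1).trans (h0 _)
    refine (congrArg (Φ 1) h1.symm).trans ?_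
    exact DFunLike.congr_fun (hP.comp_inverse (hΦ 1).1) (V 1 : E)
  · rintro rfl
    refine ⟨fun t => (Φ t : E →L[ℝ] E) v, (hP.isParallelAlong_iff hγ hΦ _).2 fun t => ?_, ?_, rfl⟩
    · rw [h0]
      refine (DFunLike.congr_fun (hP.inverse_comp (hΦ t).1) v).trans ?_
      rw [hΦ0]
      rfl
    · beta_reduce
      rw [hΦ0]
      rfl

end IsFlatGroupoid

end ParallelTransport

/-! ### Uniqueness of the connection. -/

section Uniqueness

variable {E : Type*} [NormedAddCommGroup E] [NormedSpace ℝ E]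
  {M : Type*} [TopologicalSpace M] [ChartedSpace E M] [IsManifold 𝓘(ℝ, E) ∞ M]

/-- Every tangent vector is the velocity of a smooth curve. -/
lemma exists_contMDiff_curve (x : M) (w : E) : ∃ γ : ℝ → M, ContMDiff 𝓘(ℝ, ℝ) 𝓘(ℝ, E) ∞ γ ∧
    γ 0 = x ∧ (mfderiv 𝓘(ℝ, ℝ) 𝓘(ℝ, E) γ 0 (1 : ℝ) : E) = w := by
  have hmem := mem_chart_source E x
  obtain ⟨r, hr, hball⟩ := Metric.isOpen_iff.1 (chartAt E x).open_target _
    ((chartAt E x).map_source hmem)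
  have hw : 0 < ‖w‖ + 1 := by positivity
  set ε : ℝ := r / (‖w‖ + 1)
  have hε : 0 < ε := div_pos hr hw
  -- The sine bounds the displacement by `ε ‖w‖ < r`, so the curve stays in the chart for all times,
  -- while its velocity at `0` is still `w`.
  let c : ℝ → E := fun t => chartAt E x x + (ε * Real.sin (ε⁻¹ * t)) • w
  have hc : ContDiff ℝ ∞ c := by
    have h1 : ContDiff ℝ ∞ fun t : ℝ => ε * Real.sin (ε⁻¹ * t) :=
      contDiff_const.mul (Real.contDiff_sin.comp (contDiff_const.mul contDiff_id))
    exact contDiff_const.add (h1.smul contDiff_const)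
  have hct : ∀ t, c t ∈ (chartAt E x).target := fun t => by
    refine hball ?_
    rw [Metric.mem_ball, dist_eq_norm]
    have h1 : c t - chartAt E x x = (ε * Real.sin (ε⁻¹ * t)) • w := by simp [c]
    rw [h1, norm_smul, norm_mul, Real.norm_of_nonneg hε.le, Real.norm_eq_abs]
    calc ε * |Real.sin (ε⁻¹ * t)| * ‖w‖ ≤ ε * 1 * ‖w‖ := by
          gcongr
          exact Real.abs_sin_le_one _
      _ < ε * (‖w‖ + 1) := by
          rw [mul_one]
          exact mul_lt_mul_of_pos_left (lt_add_one _) hε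
      _ = r := div_mul_cancel₀ _ hw.ne'
  have hcd : HasDerivAt c w 0 := by
    have h1 : HasDerivAt (fun t : ℝ => ε * Real.sin (ε⁻¹ * t)) 1 0 := by
      have h2 := ((hasDerivAt_id (0 : ℝ)).const_mul ε⁻¹).sin.const_mul ε
      refine h2.congr_deriv ?_
      simp [hε.ne']
    have h3 := (h1.smul_const w).const_add (chartAt E x x)
    rwa [one_smul] at h3
  have hc0 : (chartAt E x).symm (c 0) = x := by
    simp [c, (chartAt E x).left_inv hmem]
  let γ : ℝ → M := fun t => (chartAt E x).symm (c t)
  have hγ : ContMDiff 𝓘(ℝ, ℝ) 𝓘(ℝ, E) ∞ γ := fun t =>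
    ContMDiffAt.comp (g := (chartAt E x).symm) t ((contMDiffOn_chart_symm (I := 𝓘(ℝ, E)) (n := ∞)
      (x := x)).contMDiffAt ((chartAt E x).open_target.mem_nhds (hct t))) hc.contMDiff.contMDiffAt
  refine ⟨γ, hγ, hc0, ?_⟩
  have h1 := hasDerivAt_chartAt_comp (hasMFDerivAt_toSpanSingleton
    (hγ.contMDiffAt.mdifferentiableAt (x := 0) (by simp)))
  refine h1.unique (hcd.congr_of_eventuallyEq (Eventually.of_forall fun t => ?_))
  have h2 : γ 0 = x := hc0
  rw [h2]
  exact (chartAt E x).right_inv (hct t)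

variable {nabla : CovariantDerivative 𝓘(ℝ, E) E (TangentSpace 𝓘(ℝ, E) : M → Type _)} {γ : ℝ → M}

/-- Rescaling time turns transport up to time `τ` into transport up to time `1`, the only one
covered by the definition of parallel transport. -/
lemma IsParallelAlong.comp_mul (hγ : ContMDiff 𝓘(ℝ, ℝ) 𝓘(ℝ, E) ∞ γ)
    {V : (t : ℝ) → TangentSpace 𝓘(ℝ, E) (γ t)} (hV : IsParallelAlong nabla γ V) (τ : ℝ) :
    IsParallelAlong nabla (fun t => γ (τ * t)) fun t => V (τ * t) := by
  intro t
  have hm : HasDerivAt (fun t : ℝ => τ * t) τ t := by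
    simpa using (hasDerivAt_id t).const_mul τ
  have h1 := (hV (τ * t)).scomp t hm
  refine h1.congr_deriv ?_
  have h2 := hasMFDerivAt_toSpanSingleton (hγ.contMDiffAt.mdifferentiableAt (x := τ * t) (by simp))
  have h3 : HasMFDerivAt 𝓘(ℝ, ℝ) 𝓘(ℝ, ℝ) (fun t : ℝ => τ * t) t
    (ContinuousLinearMap.toSpanSingleton ℝ τ) := hm.hasFDerivAt.hasMFDerivAt
  have h4 := (HasMFDerivAt.comp (g := γ) t h2 h3).mfderiv
  have h5 : (mfderiv 𝓘(ℝ, ℝ) 𝓘(ℝ, E) (fun t => γ (τ * t)) t (1 : ℝ) : E) =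
      τ • (mfderiv 𝓘(ℝ, ℝ) 𝓘(ℝ, E) γ (τ * t) (1 : ℝ) : E) := by
    refine (DFunLike.congr_fun h4 (1 : ℝ)).trans ?_
    change ((1 : ℝ) • τ) • (mfderiv 𝓘(ℝ, ℝ) 𝓘(ℝ, E) γ (τ * t) (1 : ℝ) : E) = _
    rw [one_smul]
  let L : E →L[ℝ] E := nabla (FiberBundle.extend E (V (τ * t))) (γ (τ * t))
  let z : E := mfderiv 𝓘(ℝ, ℝ) 𝓘(ℝ, E) γ (τ * t) (1 : ℝ)
  exact (smul_neg τ (L z)).trans ((congrArg Neg.neg (map_smul L τ z).symm).trans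
    (congrArg (fun z => -(L z)) h5.symm))

namespace IsFlatGroupoid

variable {P : M → M → Set (E →L[ℝ] E)} (hP : IsFlatGroupoid P) [FiniteDimensional ℝ E]

/-- A connection whose parallel transports lie in a flat groupoid agrees with the connection of
this groupoid on the coordinate vector fields. -/
lemma extend_eq_connection_extend
    (hnabla : ∀ γ : ℝ → M, ContMDiff 𝓘(ℝ, ℝ) 𝓘(ℝ, E) ∞ γ →
      ∃ T ∈ P (γ 0) (γ 1), IsParallelTransport nabla γ T)
    (hγ : ContMDiff 𝓘(ℝ, ℝ) 𝓘(ℝ, E) ∞ γ) (v : TangentSpace 𝓘(ℝ, E) (γ 0)) :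
    nabla (FiberBundle.extend E v) (γ 0) (mfderiv 𝓘(ℝ, ℝ) 𝓘(ℝ, E) γ 0 (1 : ℝ)) =
      hP.connection (FiberBundle.extend E v) (γ 0) (mfderiv 𝓘(ℝ, ℝ) 𝓘(ℝ, E) γ 0 (1 : ℝ)) := by
  have hT : ∀ τ : ℝ, ∃ T ∈ P (γ 0) (γ τ), ∀ V : ℝ → E, IsParallelAlong nabla γ V →
      T (V 0) = V τ := by
    intro τ
    have hγτ : ContMDiff 𝓘(ℝ, ℝ) 𝓘(ℝ, E) ∞ fun t => γ (τ * t) :=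
      hγ.comp (contDiff_const.mul contDiff_id : ContDiff ℝ ∞ fun t : ℝ => τ * t).contMDiff
    obtain ⟨T, hTP, hT⟩ := hnabla _ hγτ
    refine ⟨T, by simpa only [mul_zero, mul_one] using hTP, fun V hV => ?_⟩
    let T' : E →L[ℝ] E := T
    have h1 : T' (V (τ * 0)) = V (τ * 1) :=
      (hT (V (τ * 0)) (V (τ * 1))).1 ⟨_, hV.comp_mul hγ τ, rfl, rfl⟩
    rwa [mul_zero, mul_one] at h1
  choose T hTP hT using hT
  have hV : ∀ v : E, ∃ V : ℝ → E, IsParallelAlong nabla γ V ∧ V 0 = v := fun v => by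
    obtain ⟨T, -, hT⟩ := hnabla γ hγ
    obtain ⟨V, hV, hV0, -⟩ := (hT v (T v)).2 rfl
    exact ⟨V, hV, hV0⟩
  have hmem := mem_chart_source E (γ 0)
  have hT0 : T 0 = ContinuousLinearMap.id ℝ E := by
    refine ContinuousLinearMap.ext fun v => ?_
    obtain ⟨V, hV, rfl⟩ := hV v
    exact hT 0 V hV
  have hsrc : ∀ᶠ s in 𝓝 (0 : ℝ), γ s ∈ (chartAt E (γ 0)).source :=
    hγ.continuous.continuousAt.eventually ((chartAt E (γ 0)).open_source.mem_nhds hmem)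
  -- The arrows `T s` are chosen separately for each `s`, but they act on parallel fields, which are
  -- differentiable; continuity in the chart follows.
  have hTc : ContinuousAt (fun s => (chartDeriv (γ 0) (γ s)).comp (T s)) 0 := by
    refine continuousAt_clm_apply.2 fun v => ?_
    obtain ⟨V, hV, rfl⟩ := hV v
    refine (hV 0).continuousAt.congr ?_
    filter_upwards [hsrc] with s hs
    rw [ContinuousLinearMap.comp_apply, hT s V hV]
    exact trivializationAt_snd (E := E) hs (V s)
  have hd := hasMFDerivAt_toSpanSingleton (hγ.contMDiffAt.mdifferentiableAt (x := 0) (by simp))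
  let u : ℝ → (E →L[ℝ] E) := fun s =>
    (Ring.inverse (hP.frameCoord (γ 0) (chartAt E (γ 0) (γ s)))).comp ((chartDeriv (γ 0) (γ s)).comp (T s))
  have huc : ContinuousAt u 0 := by
    refine ContinuousAt.clm_comp ?_ hTc
    exact ContinuousAt.comp (f := fun s => chartAt E (γ 0) (γ s))
      (g := fun y => Ring.inverse (hP.frameCoord (γ 0) y))
      (hP.contDiffAt_inverse_frameCoord (γ 0)).continuousAt (hasDerivAt_chartAt_comp hd).continuousAt
  have hframe : ∀ᶠ s in 𝓝 (0 : ℝ), hP.frame (γ 0) (γ s) ∈ P (γ 0) (γ s) :=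
    hγ.continuous.continuousAt.eventually (hP.eventually_frame_mem (γ 0))
  have hu : ∀ᶠ s in 𝓝 (0 : ℝ), u s = (Ring.inverse (hP.frame (γ 0) (γ s))).comp (T s) := by
    filter_upwards [hsrc, hframe] with s h1 h2
    rw [hP.inverse_frame_comp_inverse h1 (hP.isUnit h2)]
    rfl
  have hu0 : u 0 = ContinuousLinearMap.id ℝ E := by
    rw [hu.self_of_nhds, hT0, frame_self, ContinuousLinearMap.comp_id]
    exact Ring.inverse_one _
  have hTf : ∀ᶠ s in 𝓝 (0 : ℝ), (Ring.inverse (hP.frame (γ 0) (γ s))).comp (T s) =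
      ContinuousLinearMap.id ℝ E := by
    have h1 := huc.tendsto
    rw [hu0] at h1
    -- `(frame)⁻¹ ∘ T s` is an isotropy element close to the identity, hence equal to it: the
    -- transport follows the frame for small `s`.
    filter_upwards [h1.eventually (hP.eventually_eq_id (γ 0)), hu, hframe] with s h2 h3 h4
    rw [← h3]
    refine h2 ?_
    rw [h3]
    exact hP.comp_mem (hP.inverse_mem h4) (hTP s)
  obtain ⟨V, hV, hV0⟩ := hV v
  have h1 : HasDerivAt (fun s => (Ring.inverse (hP.frame (γ 0) (γ s)) : E →L[ℝ] E) (V s)) 0 0 := by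
    refine (hasDerivAt_const (0 : ℝ) (V 0)).congr_of_eventuallyEq ?_
    filter_upwards [hTf] with s hs
    rw [← hT s V hV]
    exact DFunLike.congr_fun hs (V 0)
  have h2 := (hP.hasDerivAt_parallel_iff (V := V) hd).2 h1
  have h3 := (hV 0).unique h2
  have h4 := hP.connection_extend (γ 0) v (mfderiv 𝓘(ℝ, ℝ) 𝓘(ℝ, E) γ 0 (1 : ℝ))
  subst hV0
  exact (neg_eq_iff_eq_neg.1 h3).trans h4.symm

/-- The difference of two connections is tensorial, so `Y` may be replaced by the extension of its
value at `x`, and every direction `w` is the velocity of a curve. -/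
theorem eq_connection
    (hnabla : ∀ γ : ℝ → M, ContMDiff 𝓘(ℝ, ℝ) 𝓘(ℝ, E) ∞ γ →
      ∃ T ∈ P (γ 0) (γ 1), IsParallelTransport nabla γ T)
    {Y : (x : M) → TangentSpace 𝓘(ℝ, E) x} {x : M}
    (hY : MDifferentiableAt 𝓘(ℝ, E) (𝓘(ℝ, E).prod 𝓘(ℝ, E))
      (fun y => (⟨y, Y y⟩ : TangentBundle 𝓘(ℝ, E) M)) x) :
    nabla Y x = hP.connection Y x := by
  have h1 := nabla.isCovariantDerivativeOnUniv.difference_apply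
    hP.connection.isCovariantDerivativeOnUniv (mem_univ x) hY
  have h2 := nabla.isCovariantDerivativeOnUniv.difference_apply
    hP.connection.isCovariantDerivativeOnUniv (mem_univ x)
    (FiberBundle.mdifferentiableAt_extend (I := 𝓘(ℝ, E)) (F := E) (Y x))
  rw [FiberBundle.extend_apply_self, h1] at h2
  rw [← sub_eq_zero, h2, sub_eq_zero]
  refine ContinuousLinearMap.ext fun w => ?_
  obtain ⟨γ, hγ, rfl, rfl⟩ := exists_contMDiff_curve (E := E) x w
  exact hP.extend_eq_connection_extend hnabla hγ _

end IsFlatGroupoid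

end Uniqueness

/-- Uniqueness is tested only on fields differentiable at the point, since the axioms of a covariant
derivative constrain only these. -/
theorem mainTheorem3
    {E : Type*} [NormedAddCommGroup E] [NormedSpace ℝ E] [FiniteDimensional ℝ E]
    {M : Type*} [TopologicalSpace M] [ChartedSpace E M] [IsManifold 𝓘(ℝ, E) ∞ M]
    [T2Space M] [SecondCountableTopology M] [ConnectedSpace M]
    (Γ : StructureGroupoid M) (hΓ : IsAlgebraicLiePseudogroup E Γ)
    (htrans : IsTransitivePseudogroup Γ)
    (k : ℕ) (A : C^∞⟮𝓘(ℝ, E), M; ℝ⟯ →ₗ[ℝ] C^∞⟮𝓘(ℝ, E), M; ℝ⟯) (hA : IsDiffOp k A)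
    (htype : HasConstantType Γ k A)
    (hstab : (∀ a : M, (symbolStabilizer Γ k A a).Finite) ∨
      (∀ a : M, OrbitHasFullDim Γ k A a)) :
    ∃ nabla : CovariantDerivative 𝓘(ℝ, E) E (TangentSpace 𝓘(ℝ, E) : M → Type _),
      (CovariantDerivative.ContMDiffCovariantDerivative nabla ∞ ∧ IsGammaConnection Γ nabla ∧
        PreservesSymbol nabla (symbol k A)) ∧
      ∀ nabla' : CovariantDerivative 𝓘(ℝ, E) E (TangentSpace 𝓘(ℝ, E) : M → Type _),
        CovariantDerivative.ContMDiffCovariantDerivative nabla' ∞ → IsGammaConnection Γ nabla' →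
        PreservesSymbol nabla' (symbol k A) →
        ∀ (Y : (x : M) → TangentSpace 𝓘(ℝ, E) x) (x : M),
          MDifferentiableAt 𝓘(ℝ, E) (𝓘(ℝ, E).prod 𝓘(ℝ, E))
            (fun y => (⟨y, Y y⟩ : TangentBundle 𝓘(ℝ, E) M)) x →
          nabla' Y x = nabla Y x := by
  have hstab' : ∀ a : M, (symbolStabilizer Γ k A a).Finite ∨ OrbitHasFullDim Γ k A a :=
    fun a => hstab.imp (fun h => h a) fun h => h a
  have hP := isFlatGroupoid_symbolJets hΓ.toIsLiePseudogroup htrans hA htype hstab'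
  refine ⟨hP.connection, ⟨hP.contMDiffCovariantDerivative_connection, fun γ hγ => ?_,
    fun γ hγ T hT => ?_⟩, fun nabla' _ hΓ' hA' Y x hY => ?_⟩
  · obtain ⟨T, hT, hTt⟩ := hP.isParallelTransport_connection hγ
    exact ⟨T, hT.1, hTt⟩
  · obtain ⟨T', hT', hTt⟩ := hP.isParallelTransport_connection hγ
    -- A transport along a given curve is determined by its parallel fields, so an arbitrary `T`
    -- coincides with the one in the groupoid.
    have h1 : T = T' := ContinuousLinearMap.ext fun v =>
      (hT v _).1 ((hTt v (T' v)).2 rfl)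
    rw [h1]
    exact funext hT'.2
  · refine hP.eq_connection (fun γ hγ => ?_) hY
    obtain ⟨T, hT, hTt⟩ := hΓ' γ hγ
    -- The `Γ`-connection property and preservation of the symbol together place the transports of
    -- `nabla'` in the flat groupoid.
    exact ⟨T, ⟨hT, fun θ => congrFun (hA' γ hγ T hTt) θ⟩, hTt⟩

end
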